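/- **Setting.** Let $T=\bigcup_{n\ge 0}\{0,1\}^n$ be the complete plane rooted binary tree with root $\partial$, and $T_n$ the set of its vertices of generations $0,\dots,n$. Let $T^\infty\supset T$ be the tree obtained by adding to $T$ a line of ancestors $u_{-j}=\mathrm p^j(\partial)$, $j\ge 1$, of the root, and by attaching to each $u_{-j}$, as its second child besides $u_{-j+1}$ (with $u_0=\partial$), the root of a further copy of $T$. Write $\mathrm p(u)$ for the parent of $u$, and $T^\infty(u)$ for the complete binary tree formed by $u$ and its descendants. Let $\mathcal X,\mathcal Y$ be metric spaces with their Borel $\sigma$-fields, $\Theta\subset\mathbb R^d$, $\theta^\star\in\Theta$, and for $\theta\in\Theta$ let $Q_\theta$ be a probability kernel from $\mathcal X$ to $\mathcal X$ and $G_\theta$ a probability kernel from $\mathcal X$ to $\mathcal Y$. *Process.* On a probability space with measure $\mathbb P_{\theta^\star}$, let $(X_u,Y_u)_{u\in T^\infty}$ be a stationary hidden Markov tree with kernels $Q_{\theta^\star},G_{\theta^\star}$. That is, there is a probability measure $\nu$ on $\mathcal X$ with $\nu Q_{\theta^\star}=\nu$ such that, for every $k\ge 0$, with $w=\mathrm p^k(\partial)$: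 for each $n$, the hidden variables of the first $n$ generations of $T^\infty(w)$ have joint law $\nu(dx_w)\prod_{u\ne w}Q_{\theta^\star}(x_{\mathrm p(u)};dx_u)$, and conditionally on them the observed variables $Y_u$ of these generations are independent with laws $G_{\theta^\star}(X_u;\cdot)$. *Likelihood.* Let $\lambda$ be a probability measure on $\mathcal X$ and $\mu$ a $\sigma$-finite measure on $\mathcal Y$. Given densities $q_\theta,g_\theta$ as in (A1) below, for a finite subtree $\Delta$ of $T^\infty$ with root $w$ put $$p_\theta(y_\Delta\mid X_w=x)=g_\theta(x,y_w)\int\prod_{v\in\Delta\setminus\{w\}}q_\theta(x_{\mathrm p(v)},x_v)\,g_\theta(x_v,y_v)\,\lambda(dx_v),\qquad x_w:=x,$$ with value $1$ if $\Delta=\emptyset$, and let $\ell_{n,x}(\theta)=\log p_\theta(Y_{T_n}\mid X_\partial=x)$. A maximum likelihood estimator is any sequence $(\hat\theta_{n,x})_n$ of $\Theta$-valued maps on the probability space with $\hat\theta_{n,x}\in\operatorname{argmax}_{\theta\in\Theta}\ell_{n,x}(\theta)$ $\mathbb P_{\theta^\star}$-a.s. for each $n$ (in particular any measurable selection $\hat\theta_{n,x}(Y_{T_n})$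 of the argmax). *Contrast function.* Let $\mathcal U=(\mathcal U_{(-j)})_{j\ge 0}$ be i.i.d. Bernoulli$(1/2)$ variables, independent of $(X,Y)$, and order the two children of $u_{-j-1}$ so that $u_{-j}$ is the left child if $\mathcal U_{(-j)}=0$ and the right child otherwise. Let $<_{\mathcal U}$ be the resulting breadth-first order on $T^\infty$ (by height, and lexicographically, from left to right, within a generation). Put $\Delta^*(\partial,k)=\{v\in T^\infty(\mathrm p^k(\partial)):v<_{\mathcal U}\partial\}$, $\Delta(\partial,k)=\Delta^*(\partial,k)\cup\{\partial\}$, $$h_{\partial,k,x}(\theta)=\log\frac{p_\theta(Y_{\Delta(\partial,k)}\mid X_{\mathrm p^k(\partial)}=x)}{p_\theta(Y_{\Delta^*(\partial,k)}\mid X_{\mathrm p^k(\partial)}=x)},\qquad h_{\partial,\infty}(\theta)=\lim_{k\to\infty}h_{\partial,k,x}(\theta)$$ (under the assumptions below the limit exists, uniformly in $x$, and does not depend on $x$), and $\ell(\theta)=\mathbb E_{\mathcal U}\otimes\mathbb E_{\theta^\star}[h_{\partial,\infty}(\theta)]$. **Theorem (strong consistency of the MLE, stationary case).** Assume: 1.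 (A1: fully dominated model) $Q_\theta(x;dx')=q_\theta(x,x')\,\lambda(dx')$ and $G_\theta(x;dy)=g_\theta(x,y)\,\mu(dy)$ for all $\theta\in\Theta$, $x\in\mathcal X$, with $q_\theta$ and $g_\theta$ jointly measurable. 2. (A2: regularity) There are $\sigma^-,\sigma^+\in(0,\infty)$ with $\sigma^-\le q_\theta(x,x')\le\sigma^+$ for all $\theta,x,x'$. For every $y$, $\sup_{\theta}\int g_\theta(x,y)\,\lambda(dx)<\infty$ and $b^-(y):=\inf_{\theta}\int g_\theta(x,y)\,\lambda(dx)>0$. Moreover $g_\theta(x,y)>0$ for all $\theta,x,y$. 3. (A3: $L^1$ and $L^2$ regularity) $\sup_{\theta,x,y}g_\theta(x,y)<\infty$, $\mathbb E_{\theta^\star}|\log b^-(Y_\partial)|<\infty$ and $\mathbb E_{\theta^\star}[(\log b^-(Y_\partial))^2]<\infty$. 4. (A4: continuity) For all $x,x'\in\mathcal X$ and $y\in\mathcal Y$, the maps $\theta\mapsto q_\theta(x,x')$ and $\theta\mapsto g_\theta(x,y)$ are continuous on $\Theta$. 5. $\Theta$ is compact, and $\ell$ has a unique maximizer on $\Theta$.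 Then this maximizer is $\theta^\star$, and for every $x\in\mathcal X$ every maximum likelihood estimator satisfies $\hat\theta_{n,x}\to\theta^\star$ $\mathbb P_{\theta^\star}$-a.s. as $n\to\infty$. -/

import Mathlib

open MeasureTheory ProbabilityTheory Filter Topology

noncomputable section

namespace HMT

/-! ### The extended binary tree -/

/-- The infinite tree `T^∞`: the complete binary tree `T` with root `∂`, a line of ancestors
`u_{-1}, u_{-2}, …` of `∂`, and, hanging from each `u_{-j}`, a further copy `T^{(j)}` of `T`.
A vertex of a copy of `T` is the list of the steps (`false` = left child, `true` = right child)
leading to it from the root of that copy, the most recent step being the head of the list. -/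
inductive ExtTree : Type
  /-- the vertex `s` of `T`; in particular `main []` is `∂` -/
  | main (s : List Bool) : ExtTree
  /-- the ancestor `u_{-(j+1)}` of `∂` -/
  | spine (j : ℕ) : ExtTree
  /-- the vertex `s` of the copy `T^{(j+1)}` of `T` whose root is a child of `u_{-(j+1)}` -/
  | graft (j : ℕ) (s : List Bool) : ExtTree
  deriving DecidableEq

namespace ExtTree

/-- The root `∂` of `T`. -/
def root : ExtTree := main []

/-- The parent `p(u)`. -/
def parent : ExtTree → ExtTree
  | main [] => spine 0
  | main (_ :: s) => main s
  | spine j => spine (j + 1)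
  | graft j [] => spine j
  | graft j (_ :: s) => graft j s

/-- The height, normalized by `h(∂) = 0`. -/
def height : ExtTree → ℤ
  | main s => s.length
  | spine j => -(j + 1)
  | graft j s => s.length - j

/-- The two children of a vertex (as an unordered pair). -/
def children : ExtTree → Finset ExtTree
  | main s => {main (false :: s), main (true :: s)}
  | spine 0 => {main [], graft 0 []}
  | spine (j + 1) => {spine j, graft (j + 1) []}
  | graft j s => {graft j (false :: s), graft j (true :: s)}

theorem mem_children (v w : ExtTree) : v ∈ children w ↔ parent v = w := by
  rcases w with s | (_ | j) | ⟨j, s⟩ <;>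
    rcases v with (_ | ⟨_ | _, t⟩) | i | ⟨i, (_ | ⟨_ | _, t⟩)⟩ <;>
    simp [children, parent]

/-- The descendants of `w` at distance exactly `n` from `w`. -/
def gen (w : ExtTree) : ℕ → Finset ExtTree
  | 0 => {w}
  | n + 1 => (gen w n).biUnion children

/-- `T^∞(w, n)`: the descendants of `w` at distance at most `n` from `w` (with `w` included). -/
def subtree (w : ExtTree) (n : ℕ) : Finset ExtTree :=
  (Finset.range (n + 1)).biUnion (gen w)

theorem mem_gen (v w : ExtTree) (n : ℕ) : v ∈ gen w n ↔ parent^[n] v = w := by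
  induction n generalizing v with
  | zero => simp [gen]
  | succ n ih => simp [gen, ih, mem_children]

theorem mem_subtree (v w : ExtTree) (n : ℕ) :
    v ∈ subtree w n ↔ ∃ i ≤ n, parent^[i] v = w := by
  simp [subtree, mem_gen]

/-- The finite tree `T_n`: the first `n + 1` generations (`0` to `n`) of `T`. -/
def T (n : ℕ) : Finset ExtTree := subtree root n

/-- The plane embedding of `T^∞` determined by `U : ℕ → Bool`: `label U v` is `false` if `v` is
the left child of its parent and `true` if it is the right child. The ancestor `u_{-j}` of `∂`
(with `u_0 = ∂`) is the left child of `u_{-j-1}` if and only if `U j = false`. -/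
def label (U : ℕ → Bool) : ExtTree → Bool
  | main [] => U 0
  | main (b :: _) => b
  | spine j => U (j + 1)
  | graft j [] => !(U j)
  | graft _ (b :: _) => b

/-- The breadth-first-search order `v <_U u`: smaller height first, and, at equal heights, the
lexicographic order, i.e. at their most recent common ancestor the path to `v` goes left and the
path to `u` goes right. -/
def lt (U : ℕ → Bool) (v u : ExtTree) : Prop :=
  v.height < u.height ∨
    (v.height = u.height ∧ ∃ i : ℕ, parent^[i + 1] v = parent^[i + 1] u ∧
      label U (parent^[i] v) = false ∧ label U (parent^[i] u) = true)

open Classical in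
/-- `Δ*_U(u, k)`, the set of all `v ∈ T^∞(p^k(u))` such that `v <_U u`
(see `mem_pastStrict`). -/
def pastStrict (U : ℕ → Bool) (u : ExtTree) (k : ℕ) : Finset ExtTree :=
  (subtree (parent^[k] u) k).filter (fun v => lt U v u)

/-- `Δ_U(u, k) = Δ*_U(u, k) ∪ {u}`. -/
def past (U : ℕ → Bool) (u : ExtTree) (k : ℕ) : Finset ExtTree :=
  insert u (pastStrict U u k)

theorem height_parent (v : ExtTree) : (parent v).height = v.height - 1 := by
  rcases v with (_ | ⟨_, t⟩) | i | ⟨i, (_ | ⟨_, t⟩)⟩ <;> simp [parent, height] <;> ring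

theorem height_parent_iterate (v : ExtTree) (n : ℕ) :
    (parent^[n] v).height = v.height - n := by
  induction n with
  | zero => simp
  | succ n ih => rw [Function.iterate_succ_apply', height_parent, ih]; push_cast; ring

theorem mem_pastStrict (U : ℕ → Bool) (u v : ExtTree) (k : ℕ) :
    v ∈ pastStrict U u k ↔ (∃ i, parent^[i] v = parent^[k] u) ∧ lt U v u := by
  simp only [pastStrict, Finset.mem_filter, mem_subtree]
  refine and_congr_left fun h => ⟨fun ⟨i, _, hi⟩ => ⟨i, hi⟩, fun ⟨i, hi⟩ => ⟨i, ?_, hi⟩⟩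
  have e := congrArg height hi
  rw [height_parent_iterate, height_parent_iterate] at e
  rcases h with h | h
  · omega
  · have := h.1
    omega

end ExtTree

open ExtTree

/-! ### Hidden Markov tree processes -/

section Processes

variable {Ω 𝒳 𝒴 : Type*} [MeasurableSpace Ω] [MeasurableSpace 𝒳] [MeasurableSpace 𝒴]

/-- `(X_u)`, `u` in the complete binary tree `T^∞(w)` rooted at `w`, is a branching Markov process
with transition kernel `Q` and initial distribution `ν`: for all `n`, the law of `X` on the first
`n` generations below `w` is `ν(dx_w) ∏_{u ≠ w} Q(x_{p(u)}; dx_u)`. The product is written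
generation by generation: the root has law `ν` and, conditionally on `X` on generations `0` to `n`,
the variables of generation `n + 1` are independent with laws `Q(X_{p(u)}; ·)`. -/
structure IsBranchingMarkov (P : Measure Ω) (Q : Kernel 𝒳 𝒳) (ν : Measure 𝒳)
    (X : ExtTree → Ω → 𝒳) (w : ExtTree) : Prop where
  measurable : ∀ v, Measurable (X v)
  initial : P.map (X w) = ν
  transition : ∀ (n : ℕ) (S : Set (subtree w n → 𝒳)), MeasurableSet S →
    ∀ C : ExtTree → Set 𝒳, (∀ v, MeasurableSet (C v)) →
      P {ω | (fun v : subtree w n => X v ω) ∈ S ∧ ∀ v ∈ gen w (n + 1), X v ω ∈ C v} =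
        ∫⁻ ω in {ω | (fun v : subtree w n => X v ω) ∈ S},
          ∏ v ∈ gen w (n + 1), Q (X (parent v) ω) (C v) ∂P

/-- `((X_u, Y_u))`, `u` in the complete binary tree `T^∞(w)` rooted at `w`, is a hidden Markov tree
with parameter `(Q, G, ν)`: `X` is a branching Markov process with transition kernel `Q` and
initial distribution `ν` and, conditionally on `X` on generations `0` to `n`, the variables `Y_u` of
these generations are independent with laws `G(X_u; ·)`. -/
structure IsHMT (P : Measure Ω) (Q : Kernel 𝒳 𝒳) (G : Kernel 𝒳 𝒴) (ν : Measure 𝒳)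
    (X : ExtTree → Ω → 𝒳) (Y : ExtTree → Ω → 𝒴) (w : ExtTree) : Prop where
  hidden : IsBranchingMarkov P Q ν X w
  measurable : ∀ v, Measurable (Y v)
  emission : ∀ (n : ℕ) (S : Set (subtree w n → 𝒳)), MeasurableSet S →
    ∀ B : ExtTree → Set 𝒴, (∀ v, MeasurableSet (B v)) →
      P {ω | (fun v : subtree w n => X v ω) ∈ S ∧ ∀ v ∈ subtree w n, Y v ω ∈ B v} =
        ∫⁻ ω in {ω | (fun v : subtree w n => X v ω) ∈ S},
          ∏ v ∈ subtree w n, G (X v ω) (B v) ∂P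

/-- `((X_u, Y_u))`, `u ∈ T^∞`, is a stationary hidden Markov tree with kernels `Q`, `G` and
invariant distribution `ν`: its restriction to each of the complete binary trees `T^∞(p^k(∂))`,
which exhaust `T^∞`, is a hidden Markov tree with parameter `(Q, G, ν)`, and `ν Q = ν`. -/
structure IsStationaryHMT (P : Measure Ω) (Q : Kernel 𝒳 𝒳) (G : Kernel 𝒳 𝒴) (ν : Measure 𝒳)
    (X : ExtTree → Ω → 𝒳) (Y : ExtTree → Ω → 𝒴) : Prop where
  invariant : Kernel.Invariant Q ν
  isHMT : ∀ k : ℕ, IsHMT P Q G ν X Y (parent^[k] root)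

end Processes

/-! ### Likelihood and contrast function -/

section Likelihood

variable {Ω 𝒳 𝒴 : Type*} [MeasurableSpace Ω] [MeasurableSpace 𝒳] [MeasurableSpace 𝒴]

/-- The hidden state at `u`: the value at `u` of the configuration `z` of the non-root vertices of
the subtree `Δ` rooted at `w`, and `x` at the root. -/
def hiddenAt (Δ : Finset ExtTree) (w : ExtTree) (x : 𝒳) (z : Δ.erase w → 𝒳) (u : ExtTree) : 𝒳 :=
  if h : u ∈ Δ.erase w then z ⟨u, h⟩ else x

/-- The conditional density `p(y_Δ | X_w = x)` of the observations on the finite subtree `Δ` with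
root `w`, for the densities `q`, `g`:
`g(x, y_w) ∫ ∏_{v ∈ Δ ∖ {w}} q(x_{p(v)}, x_v) g(x_v, y_v) λ(dx_v)`, and `1` if `Δ = ∅`. -/
def condDensity (lam : Measure 𝒳) (q : 𝒳 → 𝒳 → ℝ) (g : 𝒳 → 𝒴 → ℝ) (Δ : Finset ExtTree)
    (w : ExtTree) (x : 𝒳) (y : ExtTree → 𝒴) : ℝ :=
  if Δ = ∅ then 1 else
    g x (y w) * ∫ z : Δ.erase w → 𝒳,
      ∏ v : Δ.erase w, q (hiddenAt Δ w x z (parent v)) (z v) * g (z v) (y v)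
        ∂(Measure.pi fun _ => lam)

/-- The log-likelihood `ℓ_{n,x} = log p(y_{T_n} | X_∂ = x)`. -/
def logLik (lam : Measure 𝒳) (q : 𝒳 → 𝒳 → ℝ) (g : 𝒳 → 𝒴 → ℝ) (n : ℕ) (x : 𝒳)
    (y : ExtTree → 𝒴) : ℝ :=
  Real.log (condDensity lam q g (T n) root x y)

/-- The log-likelihood contribution
`h_{u,k,x} = log (p(y_{Δ_U(u,k)} | X_{p^k(u)} = x) / p(y_{Δ*_U(u,k)} | X_{p^k(u)} = x))`. -/
def logIncr (lam : Measure 𝒳) (q : 𝒳 → 𝒳 → ℝ) (g : 𝒳 → 𝒴 → ℝ) (U : ℕ → Bool) (u : ExtTree)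
    (k : ℕ) (x : 𝒳) (y : ExtTree → 𝒴) : ℝ :=
  Real.log (condDensity lam q g (past U u k) (parent^[k] u) x y /
    condDensity lam q g (pastStrict U u k) (parent^[k] u) x y)

/-- The log-likelihood contribution with infinite past, `h_{u,∞} = lim_{k → ∞} h_{u,k,x}`, the
limit being uniform in `x`: convergence along `atTop ×ˢ ⊤` means that `k → ∞` while `x` is
arbitrary. -/
def logIncrInf (lam : Measure 𝒳) (q : 𝒳 → 𝒳 → ℝ) (g : 𝒳 → 𝒴 → ℝ) (U : ℕ → Bool) (u : ExtTree)
    (y : ExtTree → 𝒴) : ℝ :=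
  limUnder ((atTop : Filter ℕ) ×ˢ (⊤ : Filter 𝒳)) fun p => logIncr lam q g U u p.1 p.2 y

/-- The law of a sequence of independent Bernoulli variables with parameter `1/2`. -/
def coinLaw : Measure (ℕ → Bool) :=
  Measure.infinitePi fun _ => (PMF.uniformOfFintype Bool).toMeasure

/-- The contrast function `E_U ⊗ E [h_{∂,∞}]`, at the parameter with densities `q`, `g`, where `Y`
is the observed process under the probability measure `P`. -/
def contrast (P : Measure Ω) (Y : ExtTree → Ω → 𝒴) (lam : Measure 𝒳) (q : 𝒳 → 𝒳 → ℝ)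
    (g : 𝒳 → 𝒴 → ℝ) : ℝ :=
  ∫ p : (ℕ → Bool) × Ω, logIncrInf lam q g p.1 root (fun v => Y v p.2) ∂(coinLaw.prod P)

end Likelihood

/-! ### Assumptions on the model -/

section Assumptions

variable {𝒳 𝒴 Θ : Type*} [MeasurableSpace 𝒳] [MeasurableSpace 𝒴]

/-- Fully dominated model: `Q_θ(x; dx') = q_θ(x, x') λ(dx')` and `G_θ(x; dy) = g_θ(x, y) μ(dy)`
with jointly measurable densities. -/
structure FullyDominated (lam : Measure 𝒳) (mu : Measure 𝒴) (Q : Θ → Kernel 𝒳 𝒳)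
    (G : Θ → Kernel 𝒳 𝒴) (q : Θ → 𝒳 → 𝒳 → ℝ) (g : Θ → 𝒳 → 𝒴 → ℝ) : Prop where
  measurable_q : ∀ θ, Measurable fun p : 𝒳 × 𝒳 => q θ p.1 p.2
  Q_eq : ∀ θ x A, MeasurableSet A → Q θ x A = ∫⁻ x' in A, ENNReal.ofReal (q θ x x') ∂lam
  measurable_g : ∀ θ, Measurable fun p : 𝒳 × 𝒴 => g θ p.1 p.2
  G_eq : ∀ θ x B, MeasurableSet B → G θ x B = ∫⁻ y in B, ENNReal.ofReal (g θ x y) ∂mu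

/-- `b⁻(y) = inf_θ ∫ g_θ(x, y) λ(dx)`. -/
def bMinus (lam : Measure 𝒳) (g : Θ → 𝒳 → 𝒴 → ℝ) (y : 𝒴) : ℝ :=
  ⨅ θ, ∫ x, g θ x y ∂lam

/-- Regularity of the densities: `q_θ` takes its values in some `[σ⁻, σ⁺] ⊂ (0, ∞)`, for every `y`
the integral `∫ g_θ(x, y) λ(dx)` is bounded away from `0` and `∞` uniformly in `θ`, and `g_θ > 0`. -/
structure Regular (lam : Measure 𝒳) (q : Θ → 𝒳 → 𝒳 → ℝ) (g : Θ → 𝒳 → 𝒴 → ℝ) : Prop where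
  q_bounds : ∃ σm σp : ℝ, 0 < σm ∧ ∀ θ x x', σm ≤ q θ x x' ∧ q θ x x' ≤ σp
  integrable_g : ∀ θ y, Integrable (fun x => g θ x y) lam
  bddAbove_integral : ∀ y, BddAbove (Set.range fun θ => ∫ x, g θ x y ∂lam)
  bMinus_pos : ∀ y, 0 < bMinus lam g y
  g_pos : ∀ θ x y, 0 < g θ x y

end Assumptions

end HMT

end

open MeasureTheory ProbabilityTheory Filter Topology

noncomputable section

set_option linter.unusedSectionVars false

namespace HMT

/-! ### Sums over binary words -/

/-! The log-likelihood is studied through its increments from one generation to the next. By the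
breadth-first chain rule (`sumWord_telescope`), the contribution `genLik` of generation `m` is the
sum, over its `2 ^ m` vertices, of the logarithm of the conditional density `condRatio` of the
observation there given the preceding ones.

Forgetting. Write `ρ = 1 - σm / σp` and `C = (σp - σm) / σm`. Since `σm ≤ q ≤ σp`, the transition
kernel, reweighted by any positive likelihood, satisfies a Doeblin condition and contracts
oscillations by `ρ`. Cutting the past `k` generations above a vertex therefore changes its
log-contribution by at most `C * ρ ^ k`, uniformly in the parameter, the data and the initial state
(`abs_log_condRatio_append_sub_le`). Two consequences follow. The increment at a high generation is,
up to a relative error of this size, a sum over disjoint subtrees of one function of `k + 1`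
generations (`abs_log_lik_sub_genSum_le`). The mean of that function, divided by `2 ^ k`, is within
`C * ρ ^ k` of the contrast (`abs_integral_genLik_sub_contrast_le`), because for fair coins the root
is a uniform vertex of generation `k` below its `k`-th ancestor.

Law of large numbers. For a centred square-integrable function of finitely many generations,
conditional independence of the two child subtrees gives a recursion for the second moments of its
sums over a generation. The normalized second moments are summable, hence almost sure convergence
(`HasTreeLaw.tendsto_genSum`).

Maximality of the true parameter. The mean log-likelihood ratio of a finite tree against the true
parameter is nonpositive. A parameter with larger contrast would make it, up to summed errors, grow
without bound (`contrast_le`).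

Consistency. If the contrast at `θ` is strictly below its value at the true parameter, the law of
large numbers, applied to a local supremum of `genLik`, makes every late increment smaller on a
whole neighbourhood of `θ` by a fixed amount, so the log-likelihood there is eventually smaller
(`exists_nhds_logLik_lt`). Compactness concludes (`tendsto_argmax`).

These arguments use recursive objects on binary words (`lik`, `pastLik`, `treeKernel`). They are
tied to the densities and the process on the extended tree by `condDensity_T`, `logIncr_root_succ`
and `IsHMT.hasTreeLaw`. -/

/-- The sum of `f` over the binary words of length `n`. -/
def sumWord : ℕ → (List Bool → ℝ) → ℝ
  | 0, f => f []
  | n + 1, f => sumWord n (fun s => f (false :: s)) + sumWord n (fun s => f (true :: s))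

theorem sumWord_congr {n : ℕ} {f h : List Bool → ℝ} (H : ∀ s, s.length = n → f s = h s) :
    sumWord n f = sumWord n h := by
  induction n generalizing f h with
  | zero => exact H [] rfl
  | succ n ih =>
    exact congrArg₂ (· + ·) (ih fun s hs => H _ (by simp [hs]))
      (ih fun s hs => H _ (by simp [hs]))

theorem sumWord_le {n : ℕ} {f h : List Bool → ℝ} (H : ∀ s, s.length = n → f s ≤ h s) :
    sumWord n f ≤ sumWord n h := by
  induction n generalizing f h with
  | zero => exact H [] rfl
  | succ n ih =>
    exact add_le_add (ih fun s hs => H _ (by simp [hs])) (ih fun s hs => H _ (by simp [hs]))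

theorem sumWord_sub (n : ℕ) (f h : List Bool → ℝ) :
    sumWord n (fun s => f s - h s) = sumWord n f - sumWord n h := by
  induction n generalizing f h with
  | zero => rfl
  | succ n ih => simp only [sumWord, ih]; ring

theorem sumWord_const (n : ℕ) (a : ℝ) : sumWord n (fun _ => a) = 2 ^ n * a := by
  induction n with
  | zero => simp [sumWord]
  | succ n ih => simp only [sumWord, ih]; ring

theorem sumWord_append (j k : ℕ) (f : List Bool → ℝ) :
    sumWord (j + k) f = sumWord j (fun s => sumWord k (fun t => f (s ++ t))) := by
  induction j generalizing f with
  | zero => simp [sumWord]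
  | succ j ih => rw [Nat.succ_add_eq_add_succ, Nat.add_succ]; simp [sumWord, ih]

theorem abs_sumWord_le {n : ℕ} {f h : List Bool → ℝ} (H : ∀ s, s.length = n → |f s| ≤ h s) :
    |sumWord n f| ≤ sumWord n h := by
  induction n generalizing f h with
  | zero => exact H [] rfl
  | succ n ih =>
    exact (abs_add_le _ _).trans
      (add_le_add (ih fun s hs => H _ (by simp [hs])) (ih fun s hs => H _ (by simp [hs])))

theorem sumWord_induction {M : Type*} (p : (M → ℝ) → Prop)
    (hadd : ∀ f h, p f → p h → p (fun a => f a + h a)) {n : ℕ} {F : List Bool → M → ℝ}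
    (H : ∀ s, s.length = n → p (F s)) : p (fun a => sumWord n fun s => F s a) := by
  induction n generalizing F with
  | zero => exact H [] rfl
  | succ n ih =>
    exact hadd _ _ (ih (F := fun s => F (false :: s)) fun s hs => H _ (by simp [hs]))
      (ih (F := fun s => F (true :: s)) fun s hs => H _ (by simp [hs]))

/-! ### Likelihoods of binary trees, by recursion from the root

A configuration of the complete binary tree is a function on `List Bool`, a word being the path
(from the root downwards) to a vertex. -/

section Model

variable {Θ 𝒳 𝒴 : Type*} [MeasurableSpace 𝒳] [MeasurableSpace 𝒴] [TopologicalSpace Θ]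

/-- The restriction of a configuration to the subtree of the descendants of a child of the root. -/
def sub (b : Bool) (c : List Bool → 𝒴) : List Bool → 𝒴 := fun s => c (b :: s)

theorem measurable_sub (b : Bool) : Measurable (sub b : (List Bool → 𝒴) → _) := by
  unfold sub; fun_prop

/-- A family of transition and emission densities which are bounded and depend continuously on the
parameter, with transition densities bounded away from zero. -/
structure DensityModel (lam : Measure 𝒳) (q : Θ → 𝒳 → 𝒳 → ℝ) (g : Θ → 𝒳 → 𝒴 → ℝ)
    (σm σp B : ℝ) : Prop where
  q_meas : ∀ θ, Measurable fun p : 𝒳 × 𝒳 => q θ p.1 p.2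
  g_meas : ∀ θ, Measurable fun p : 𝒳 × 𝒴 => g θ p.1 p.2
  σm_pos : 0 < σm
  le_q : ∀ θ x x', σm ≤ q θ x x'
  q_le : ∀ θ x x', q θ x x' ≤ σp
  q_int : ∀ θ x, ∫ x', q θ x x' ∂lam = 1
  g_pos : ∀ θ x y, 0 < g θ x y
  g_le : ∀ θ x y, g θ x y ≤ B
  q_cont : ∀ x x', Continuous fun θ => q θ x x'
  g_cont : ∀ x y, Continuous fun θ => g θ x y

/-- The action of the density `q` on functions. -/
def qInt (lam : Measure 𝒳) (q : 𝒳 → 𝒳 → ℝ) (f : 𝒳 → ℝ) (x : 𝒳) : ℝ := ∫ x', q x x' * f x' ∂lam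

/-- The likelihood of the first `n` generations, given the hidden state `x` of the root. -/
def lik (lam : Measure 𝒳) (q : 𝒳 → 𝒳 → ℝ) (g : 𝒳 → 𝒴 → ℝ) : ℕ → (List Bool → 𝒴) → 𝒳 → ℝ
  | 0, _, _ => 1
  | n + 1, c, x => g x (c []) * qInt lam q (lik lam q g n (sub false c)) x *
      qInt lam q (lik lam q g n (sub true c)) x

/-- The likelihood of the vertices preceding the vertex `s` in the breadth-first order, given the
hidden state `x` of the root, `f₀` being the factor attached to the vertex `s` itself. -/
def pastLik (lam : Measure 𝒳) (q : 𝒳 → 𝒳 → ℝ) (g : 𝒳 → 𝒴 → ℝ) (f₀ : 𝒳 → 𝒴 → ℝ) :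
    List Bool → (List Bool → 𝒴) → 𝒳 → ℝ
  | [], c, x => f₀ x (c [])
  -- The sibling subtree has one more generation in the past when `b = true`: it is then the left
  -- one, and its vertices at the height of the target come first.
  | b :: s, c, x => g x (c []) * qInt lam q (pastLik lam q g f₀ s (sub b c)) x *
      qInt lam q (lik lam q g (s.length + b.toNat) (sub (!b) c)) x

/-- A positive, bounded, jointly measurable family of functions, continuous in the parameter. -/
structure Tame (f : Θ → (List Bool → 𝒴) → 𝒳 → ℝ) : Prop where
  meas : ∀ θ, Measurable fun p : (List Bool → 𝒴) × 𝒳 => f θ p.1 p.2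
  pos : ∀ θ c x, 0 < f θ c x
  bdd : ∃ M, ∀ θ c x, f θ c x ≤ M
  cont : ∀ c x, Continuous fun θ => f θ c x

theorem Tame.mul {f h : Θ → (List Bool → 𝒴) → 𝒳 → ℝ} (hf : Tame f) (hh : Tame h) :
    Tame fun θ c x => f θ c x * h θ c x where
  meas θ := (hf.meas θ).mul (hh.meas θ)
  pos θ c x := mul_pos (hf.pos θ c x) (hh.pos θ c x)
  bdd := by
    obtain ⟨M, hM⟩ := hf.bdd
    obtain ⟨N, hN⟩ := hh.bdd
    exact ⟨M * N, fun θ c x => mul_le_mul (hM θ c x) (hN θ c x) (hh.pos θ c x).le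
      ((hf.pos θ c x).le.trans (hM θ c x))⟩
  cont c x := (hf.cont c x).mul (hh.cont c x)

theorem Tame.one : Tame fun (_ : Θ) (_ : List Bool → 𝒴) (_ : 𝒳) => (1 : ℝ) where
  meas _ := measurable_const
  pos _ _ _ := one_pos
  bdd := ⟨1, fun _ _ _ => le_rfl⟩
  cont _ _ := continuous_const

theorem Tame.measurable_right {f : Θ → (List Bool → 𝒴) → 𝒳 → ℝ} (hf : Tame f) (θ : Θ)
    (c : List Bool → 𝒴) : Measurable (f θ c) :=
  (hf.meas θ).comp (measurable_const.prodMk measurable_id)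

variable {lam : Measure 𝒳} [IsProbabilityMeasure lam] {q : Θ → 𝒳 → 𝒳 → ℝ} {g : Θ → 𝒳 → 𝒴 → ℝ}
  {σm σp B : ℝ}

namespace DensityModel

theorem q_meas_right (hm : DensityModel lam q g σm σp B) (θ : Θ) (x : 𝒳) :
    Measurable (q θ x) :=
  (hm.q_meas θ).comp (measurable_const.prodMk measurable_id)

theorem q_pos (hm : DensityModel lam q g σm σp B) (θ : Θ) (x x' : 𝒳) : 0 < q θ x x' :=
  hm.σm_pos.trans_le (hm.le_q θ x x')

theorem integrable_q_mul (hm : DensityModel lam q g σm σp B) (θ : Θ) (x : 𝒳) {f : 𝒳 → ℝ}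
    (hf : Measurable f) {M : ℝ} (hM : ∀ x, |f x| ≤ M) :
    Integrable (fun x' => q θ x x' * f x') lam := by
  refine Integrable.of_bound ((hm.q_meas_right θ x).mul hf).aestronglyMeasurable (σp * M)
    (ae_of_all _ fun x' => ?_)
  rw [Real.norm_eq_abs, abs_mul, abs_of_pos (hm.q_pos θ x x')]
  exact mul_le_mul (hm.q_le θ x x') (hM x') (abs_nonneg _)
    ((hm.q_pos θ x x').le.trans (hm.q_le θ x x'))

theorem σp_pos (hm : DensityModel lam q g σm σp B) (θ : Θ) (x : 𝒳) : 0 < σp :=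
  (hm.q_pos θ x x).trans_le (hm.q_le θ x x)

theorem qInt_mono (hm : DensityModel lam q g σm σp B) (θ : Θ) (x : 𝒳) {f h : 𝒳 → ℝ}
    (hf : Measurable f) {M : ℝ} (hM : ∀ x, |f x| ≤ M) (hh : Measurable h) {N : ℝ}
    (hN : ∀ x, |h x| ≤ N) (H : ∀ x, f x ≤ h x) : qInt lam (q θ) f x ≤ qInt lam (q θ) h x :=
  integral_mono (hm.integrable_q_mul θ x hf hM) (hm.integrable_q_mul θ x hh hN)
    fun x' => mul_le_mul_of_nonneg_left (H x') (hm.q_pos θ x x').le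

theorem qInt_const (hm : DensityModel lam q g σm σp B) (θ : Θ) (x : 𝒳) (a : ℝ) :
    qInt lam (q θ) (fun _ => a) x = a := by
  rw [qInt, integral_mul_const, hm.q_int, one_mul]

/-- The bound survives because `q θ x` is a probability density; continuity in `θ` is dominated
convergence with the constant dominating function `σp * M`. -/
theorem tame_qInt [FirstCountableTopology Θ] (hm : DensityModel lam q g σm σp B)
    {f : Θ → (List Bool → 𝒴) → 𝒳 → ℝ}
    (hf : Tame f) : Tame fun θ c x => qInt lam (q θ) (f θ c) x where
  meas θ := by
    have : StronglyMeasurable fun p : ((List Bool → 𝒴) × 𝒳) × 𝒳 =>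
        q θ p.1.2 p.2 * f θ p.1.1 p.2 := by
      apply Measurable.stronglyMeasurable
      exact ((hm.q_meas θ).comp (by fun_prop : Measurable fun p : ((List Bool → 𝒴) × 𝒳) × 𝒳 =>
        (p.1.2, p.2))).mul ((hf.meas θ).comp (by fun_prop : Measurable
        fun p : ((List Bool → 𝒴) × 𝒳) × 𝒳 => (p.1.1, p.2)))
    exact this.integral_prod_right.measurable
  pos θ c x := by
    obtain ⟨M, hM⟩ := hf.bdd
    refine (integral_pos_iff_support_of_nonneg
      (fun x' => (mul_pos (hm.q_pos θ x x') (hf.pos θ c x')).le)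
      (hm.integrable_q_mul θ x (hf.measurable_right θ c) (M := M) fun x => ?_)).2 ?_
    · rw [abs_of_pos (hf.pos θ c x)]; exact hM θ c x
    · have : (Function.support fun x' => q θ x x' * f θ c x') = Set.univ := by
        ext x'; simp [(hm.q_pos θ x x').ne', (hf.pos θ c x').ne']
      rw [this]; simp
  bdd := by
    obtain ⟨M, hM⟩ := hf.bdd
    refine ⟨M, fun θ c x => ?_⟩
    rw [← hm.qInt_const θ x M]
    refine hm.qInt_mono θ x (hf.measurable_right θ c) (M := M) (fun x => ?_) measurable_const
      (N := |M|) (fun x => le_rfl) (hM θ c)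
    rw [abs_of_pos (hf.pos θ c x)]; exact hM θ c x
  cont c x := by
    obtain ⟨M, hM⟩ := hf.bdd
    refine continuous_of_dominated (bound := fun _ => σp * M) (fun θ => ?_) (fun θ => ?_)
      (integrable_const _) (ae_of_all _ fun x' => (hm.q_cont x x').mul (hf.cont c x'))
    · exact ((hm.q_meas_right θ x).mul (hf.measurable_right θ c)).aestronglyMeasurable
    · refine ae_of_all _ fun x' => ?_
      rw [Real.norm_eq_abs, abs_of_pos (mul_pos (hm.q_pos θ x x') (hf.pos θ c x'))]
      exact mul_le_mul (hm.q_le θ x x') (hM θ c x') (hf.pos θ c x').le (hm.σp_pos θ x).le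

theorem _root_.HMT.Tame.sub {f : Θ → (List Bool → 𝒴) → 𝒳 → ℝ} (hf : Tame f) (b : Bool) :
    Tame fun θ c x => f θ (sub b c) x where
  meas θ := (hf.meas θ).comp ((measurable_sub b).prodMap measurable_id)
  pos θ c x := hf.pos θ _ x
  bdd := by
    obtain ⟨M, hM⟩ := hf.bdd
    exact ⟨M, fun θ c x => hM θ _ x⟩
  cont c x := hf.cont _ x

theorem tame_g (hm : DensityModel lam q g σm σp B) :
    Tame fun θ (c : List Bool → 𝒴) x => g θ x (c []) where
  meas θ := (hm.g_meas θ).comp (by fun_prop : Measurable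
    fun p : (List Bool → 𝒴) × 𝒳 => (p.2, p.1 []))
  pos θ c x := hm.g_pos θ x _
  bdd := ⟨B, fun θ c x => hm.g_le θ x _⟩
  cont c x := hm.g_cont x _

variable [FirstCountableTopology Θ]

theorem tame_lik (hm : DensityModel lam q g σm σp B) (n : ℕ) :
    Tame fun θ c x => lik lam (q θ) (g θ) n c x := by
  induction n with
  | zero => exact Tame.one
  | succ n ih => exact (hm.tame_g.mul (hm.tame_qInt (ih.sub _))).mul (hm.tame_qInt (ih.sub _))

theorem tame_pastLik (hm : DensityModel lam q g σm σp B) {f₀ : Θ → 𝒳 → 𝒴 → ℝ}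
    (hf₀ : Tame fun θ (c : List Bool → 𝒴) x => f₀ θ x (c [])) (s : List Bool) :
    Tame fun θ c x => pastLik lam (q θ) (g θ) (f₀ θ) s c x := by
  induction s with
  | nil => exact hf₀
  | cons b s ih =>
    exact (hm.tame_g.mul (hm.tame_qInt (ih.sub b))).mul
      (hm.tame_qInt ((hm.tame_lik (s.length + b.toNat)).sub (!b)))

end DensityModel

/-- The conditional density of the observation at the vertex `s` given the observations at the
preceding vertices and the hidden state `x` of the parent of the root. -/
def condRatio (lam : Measure 𝒳) (q : 𝒳 → 𝒳 → ℝ) (g : 𝒳 → 𝒴 → ℝ) (s : List Bool)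
    (c : List Bool → 𝒴) (x : 𝒳) : ℝ :=
  qInt lam q (pastLik lam q g g s c) x / qInt lam q (pastLik lam q g (fun _ _ => 1) s c) x

namespace DensityModel

variable [FirstCountableTopology Θ]

theorem tame_condRatio_num (hm : DensityModel lam q g σm σp B) (s : List Bool) :
    Tame fun θ c x => qInt lam (q θ) (pastLik lam (q θ) (g θ) (g θ) s c) x :=
  hm.tame_qInt (hm.tame_pastLik hm.tame_g s)

theorem tame_condRatio_den (hm : DensityModel lam q g σm σp B) (s : List Bool) :
    Tame fun θ c x => qInt lam (q θ) (pastLik lam (q θ) (g θ) (fun _ _ => 1) s c) x :=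
  hm.tame_qInt (hm.tame_pastLik (f₀ := fun _ _ _ => 1) Tame.one s)

theorem condRatio_pos (hm : DensityModel lam q g σm σp B) (θ : Θ) (s : List Bool)
    (c : List Bool → 𝒴) (x : 𝒳) : 0 < condRatio lam (q θ) (g θ) s c x :=
  div_pos ((hm.tame_condRatio_num s).pos θ c x) ((hm.tame_condRatio_den s).pos θ c x)

theorem measurable_condRatio (hm : DensityModel lam q g σm σp B) (θ : Θ) (s : List Bool) :
    Measurable fun p : (List Bool → 𝒴) × 𝒳 => condRatio lam (q θ) (g θ) s p.1 p.2 :=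
  ((hm.tame_condRatio_num s).meas θ).div ((hm.tame_condRatio_den s).meas θ)

theorem continuous_condRatio (hm : DensityModel lam q g σm σp B) (s : List Bool)
    (c : List Bool → 𝒴) (x : 𝒳) : Continuous fun θ => condRatio lam (q θ) (g θ) s c x :=
  ((hm.tame_condRatio_num s).cont c x).div ((hm.tame_condRatio_den s).cont c x)
    fun θ => ((hm.tame_condRatio_den s).pos θ c x).ne'

end DensityModel

/-! ### Contraction -/

/-- Averages of a function with respect to two probability densities, both bounded below by
`ε ψ` for the same probability density `ψ`. -/
theorem integral_sub_le_of_minorized {f φ₁ φ₂ ψ : 𝒳 → ℝ} {ε m D : ℝ} {μ : Measure 𝒳}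
    (hφ₁ : Integrable φ₁ μ) (hφ₂ : Integrable φ₂ μ) (hψ : Integrable ψ μ)
    (hf₁ : Integrable (fun x => φ₁ x * f x) μ) (hf₂ : Integrable (fun x => φ₂ x * f x) μ)
    (h₁ : ∀ x, ε * ψ x ≤ φ₁ x) (h₂ : ∀ x, ε * ψ x ≤ φ₂ x)
    (i₁ : ∫ x, φ₁ x ∂μ = 1) (i₂ : ∫ x, φ₂ x ∂μ = 1) (i : ∫ x, ψ x ∂μ = 1)
    (hm : ∀ x, m ≤ f x) (hM : ∀ x, f x ≤ m + D) :
    ∫ x, φ₁ x * f x ∂μ - ∫ x, φ₂ x * f x ∂μ ≤ (1 - ε) * D := by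
  rw [← integral_sub hf₁ hf₂]
  have e₁ : Integrable (fun x => φ₁ x - ε * ψ x) μ := hφ₁.sub (hψ.const_mul ε)
  have e₂ : Integrable (fun x => φ₂ x - ε * ψ x) μ := hφ₂.sub (hψ.const_mul ε)
  -- The common part `ε ψ` cancels in the difference. On the remainders, each of mass `1 - ε`, `f`
  -- is replaced by its upper bound for `φ₁` and by its lower bound for `φ₂`.
  have hint : Integrable (fun x => (φ₁ x - ε * ψ x) * (m + D) - (φ₂ x - ε * ψ x) * m) μ :=
    (e₁.mul_const _).sub (e₂.mul_const _)
  refine (integral_mono (hf₁.sub hf₂) hint fun x => ?_).trans_eq ?_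
  · have a := mul_le_mul_of_nonneg_left (hM x) (sub_nonneg.2 (h₁ x))
    have b := mul_le_mul_of_nonneg_left (hm x) (sub_nonneg.2 (h₂ x))
    simp only [Pi.sub_apply]; linarith
  · rw [integral_sub (e₁.mul_const _) (e₂.mul_const _), integral_mul_const, integral_mul_const,
      integral_sub hφ₁ (hψ.const_mul ε), integral_sub hφ₂ (hψ.const_mul ε), integral_const_mul,
      i₁, i₂, i]
    ring

end Model

section Contraction

variable {Θ 𝒳 𝒴 : Type*} [MeasurableSpace 𝒳] [MeasurableSpace 𝒴] [TopologicalSpace Θ]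
  {lam : Measure 𝒳} [IsProbabilityMeasure lam] {q : Θ → 𝒳 → 𝒳 → ℝ} {g : Θ → 𝒳 → 𝒴 → ℝ}
  {σm σp B : ℝ}

namespace DensityModel

theorem rate_nonneg (hm : DensityModel lam q g σm σp B) (θ : Θ) (x : 𝒳) : 0 ≤ 1 - σm / σp :=
  sub_nonneg.2 ((div_le_one (hm.σp_pos θ x)).2 ((hm.le_q θ x x).trans (hm.q_le θ x x)))

theorem rate_lt_one (hm : DensityModel lam q g σm σp B) (θ : Θ) (x : 𝒳) : 1 - σm / σp < 1 :=
  sub_lt_self _ (div_pos hm.σm_pos (hm.σp_pos θ x))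

theorem qInt_pos (hm : DensityModel lam q g σm σp B) (θ : Θ) (x : 𝒳) {h : 𝒳 → ℝ}
    (hh : Measurable h) (hpos : ∀ x, 0 < h x) {N : ℝ} (hN : ∀ x, h x ≤ N) :
    0 < qInt lam (q θ) h x := by
  refine (integral_pos_iff_support_of_nonneg (fun x' => (mul_pos (hm.q_pos θ x x') (hpos x')).le)
      (hm.integrable_q_mul θ x hh (M := N) fun x => ?_)).2 ?_
  · rw [abs_of_pos (hpos x)]; exact hN x
  · have : (Function.support fun x' => q θ x x' * h x') = Set.univ := by
      ext x'; simp [(hm.q_pos θ x x').ne', (hpos x').ne']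
    rw [this]; simp

theorem le_average (hm : DensityModel lam q g σm σp B) (θ : Θ) (x : 𝒳) {f h : 𝒳 → ℝ}
    (hh : Measurable h) (hpos : ∀ x, 0 < h x) {N : ℝ} (hN : ∀ x, h x ≤ N)
    (hf : Measurable f) {m M : ℝ} (hfm : ∀ x, m ≤ f x) (hfM : ∀ x, f x ≤ M) :
    m ≤ qInt lam (q θ) (fun x => h x * f x) x / qInt lam (q θ) h x ∧
      qInt lam (q θ) (fun x => h x * f x) x / qInt lam (q θ) h x ≤ M := by
  have hp := hm.qInt_pos θ x hh hpos hN
  have hi : Integrable (fun x' => q θ x x' * h x') lam :=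
    hm.integrable_q_mul θ x hh (M := N) fun x => by rw [abs_of_pos (hpos x)]; exact hN x
  have hif : Integrable (fun x' => q θ x x' * (h x' * f x')) lam := by
    refine hm.integrable_q_mul θ x (hh.mul hf) (M := N * max |m| |M|) fun x => ?_
    rw [abs_mul, abs_of_pos (hpos x)]
    exact mul_le_mul (hN x) (abs_le_max_abs_abs (hfm x) (hfM x)) (abs_nonneg _)
      ((hpos x).le.trans (hN x))
  rw [le_div_iff₀ hp, div_le_iff₀ hp, qInt, qInt, ← integral_const_mul, ← integral_const_mul]
  constructor
  · refine integral_mono (hi.const_mul m) hif fun x' => ?_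
    have := mul_le_mul_of_nonneg_left (hfm x') (mul_pos (hm.q_pos θ x x') (hpos x')).le
    simp only; linarith
  · refine integral_mono hif (hi.const_mul M) fun x' => ?_
    have := mul_le_mul_of_nonneg_left (hfM x') (mul_pos (hm.q_pos θ x x') (hpos x')).le
    simp only; linarith

/-- Doeblin condition for the posterior kernel: `q x x' * h x' / ∫ q x h` is at least `σm / σp`
times the density `h / ∫ h`, which does not depend on `x`. The rate is thus the same for every
weight `h`, in particular for any likelihood of observations below. -/
theorem average_sub_le (hm : DensityModel lam q g σm σp B) (θ : Θ) {f h : 𝒳 → ℝ}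
    (hh : Measurable h) (hpos : ∀ x, 0 < h x) {N : ℝ} (hN : ∀ x, h x ≤ N)
    (hf : Measurable f) {D : ℝ} (hfD : ∀ x x', f x - f x' ≤ D) (x x' : 𝒳) :
    qInt lam (q θ) (fun x => h x * f x) x / qInt lam (q θ) h x -
      qInt lam (q θ) (fun x => h x * f x) x' / qInt lam (q θ) h x' ≤ (1 - σm / σp) * D := by
  have hσp := hm.σp_pos θ x
  have : Nonempty 𝒳 := ⟨x⟩
  have hbdd : BddBelow (Set.range f) := ⟨f x - D, by rintro _ ⟨z, rfl⟩; linarith [hfD x z]⟩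
  have hmf : ∀ z, ⨅ z, f z ≤ f z := ciInf_le hbdd
  have hMf : ∀ z, f z ≤ (⨅ z, f z) + D := fun z => by
    have : f z - D ≤ ⨅ z, f z := le_ciInf fun z' => by linarith [hfD z z']
    linarith
  generalize (⨅ z, f z) = m at hmf hMf
  have hhN : ∀ x, |h x| ≤ N := fun x => by rw [abs_of_pos (hpos x)]; exact hN x
  have hhi : Integrable h lam := Integrable.of_bound hh.aestronglyMeasurable N (ae_of_all _ hhN)
  have hI : 0 < ∫ x, h x ∂lam := by
    refine (integral_pos_iff_support_of_nonneg (fun x => (hpos x).le) hhi).2 ?_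
    have : Function.support h = Set.univ := by ext x; simp [(hpos x).ne']
    rw [this]; simp
  have hi : ∀ x, Integrable (fun x' => q θ x x' * h x') lam := fun x =>
    hm.integrable_q_mul θ x hh (M := N) hhN
  have hif : ∀ x, Integrable (fun x' => q θ x x' * (h x' * f x')) lam := fun x => by
    refine hm.integrable_q_mul θ x (hh.mul hf) (M := N * max |m| |m + D|) fun x => ?_
    rw [abs_mul]
    exact mul_le_mul (hhN x) (abs_le_max_abs_abs (hmf x) (hMf x)) (abs_nonneg _)
      ((abs_nonneg _).trans (hhN x))
  have key : ∀ x x', σm / σp * (h x' / ∫ x, h x ∂lam) ≤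
      q θ x x' * h x' / qInt lam (q θ) h x := fun x x' => by
    have hp := hm.qInt_pos θ x hh hpos hN
    have hle : qInt lam (q θ) h x ≤ σp * ∫ x, h x ∂lam := by
      rw [qInt, ← integral_const_mul]
      exact integral_mono (hi x) (hhi.const_mul _)
        fun x' => mul_le_mul_of_nonneg_right (hm.q_le θ x x') (hpos x').le
    rw [div_mul_div_comm]
    exact div_le_div₀ (mul_pos (hm.q_pos θ x x') (hpos x')).le
      (mul_le_mul_of_nonneg_right (hm.le_q θ x x') (hpos x').le) hp hle
  have e : ∀ x, qInt lam (q θ) (fun x => h x * f x) x / qInt lam (q θ) h x =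
      ∫ x', q θ x x' * h x' / qInt lam (q θ) h x * f x' ∂lam := fun x => by
    rw [qInt, ← integral_div]
    congr 1; ext x'; ring
  have hint : ∀ x, Integrable (fun x' => q θ x x' * h x' / qInt lam (q θ) h x * f x') lam :=
    fun x => by
      convert (hif x).div_const (qInt lam (q θ) h x) using 2; ring
  rw [e, e]
  refine integral_sub_le_of_minorized ((hi x).div_const _) ((hi x').div_const _)
    (hhi.div_const _) (hint x) (hint x') (key x) (key x') ?_ ?_ ?_ hmf hMf
  · rw [integral_div]; exact div_self (hm.qInt_pos θ x hh hpos hN).ne'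
  · rw [integral_div]; exact div_self (hm.qInt_pos θ x' hh hpos hN).ne'
  · rw [integral_div]; exact div_self hI.ne'

/-- The case of constant weight: this is the contraction hypothesis of the law of large numbers. -/
theorem qInt_sub_le (hm : DensityModel lam q g σm σp B) (θ : Θ) {f : 𝒳 → ℝ}
    (hf : Measurable f) {D : ℝ} (hfD : ∀ x x', f x - f x' ≤ D) (x x' : 𝒳) :
    qInt lam (q θ) f x - qInt lam (q θ) f x' ≤ (1 - σm / σp) * D := by
  have := hm.average_sub_le θ (h := fun _ => 1) measurable_const (fun _ => one_pos)
    (N := 1) (fun _ => le_rfl) hf hfD x x'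
  simpa [hm.qInt_const] using this

end DensityModel

/-! ### Forgetting of the initial state -/

theorem abs_log_sub_log_le {a b m D : ℝ} (hm : 0 < m) (ha : m ≤ a) (hb : m ≤ b)
    (h : |a - b| ≤ D) : |Real.log a - Real.log b| ≤ D / m := by
  have key : ∀ a b, m ≤ a → m ≤ b → |a - b| ≤ D → Real.log a - Real.log b ≤ D / m := by
    intro a b ha hb h
    have hb0 := hm.trans_le hb
    have ha0 := hm.trans_le ha
    rw [← Real.log_div ha0.ne' hb0.ne']
    refine (Real.log_le_sub_one_of_pos (div_pos ha0 hb0)).trans ?_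
    rw [div_sub_one hb0.ne']
    exact div_le_div₀ ((abs_nonneg _).trans h) ((le_abs_self _).trans h) hm hb
  rw [abs_le]
  have := key b a hb ha (by rwa [abs_sub_comm])
  exact ⟨by linarith, key a b ha hb h⟩

variable [FirstCountableTopology Θ]

/-- The restriction of a configuration to the descendants of the vertex `s`. -/
def shift (s : List Bool) (c : List Bool → 𝒴) : List Bool → 𝒴 := fun t => c (s ++ t)

theorem shift_nil (c : List Bool → 𝒴) : shift [] c = c := rfl

theorem shift_cons (b : Bool) (s : List Bool) (c : List Bool → 𝒴) :
    shift (b :: s) c = shift s (sub b c) := rfl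

theorem measurable_shift (s : List Bool) : Measurable (shift s : (List Bool → 𝒴) → _) := by
  unfold shift; fun_prop

namespace DensityModel

/-- Conditioning on the hidden state of the root: the contribution at `b :: s` is the average of the
contribution at `s` in the child subtree, under the posterior law of that state given the past. The
sibling factor is common to numerator and denominator. -/
theorem condRatio_cons (hm : DensityModel lam q g σm σp B) (θ : Θ) (b : Bool) (s : List Bool)
    (c : List Bool → 𝒴) (x : 𝒳) :
    condRatio lam (q θ) (g θ) (b :: s) c x =
      qInt lam (q θ) (fun x' => pastLik lam (q θ) (g θ) (fun _ _ => 1) (b :: s) c x' *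
        condRatio lam (q θ) (g θ) s (sub b c) x') x /
      qInt lam (q θ) (pastLik lam (q θ) (g θ) (fun _ _ => 1) (b :: s) c) x := by
  unfold condRatio
  congr 2
  ext x'
  have := ((hm.tame_condRatio_den s).pos θ (sub b c) x').ne'
  simp only [pastLik]
  field_simp

theorem tame_pastLik_one (hm : DensityModel lam q g σm σp B) (s : List Bool) :
    Tame fun θ c x => pastLik lam (q θ) (g θ) (fun _ _ => 1) s c x :=
  hm.tame_pastLik (f₀ := fun _ _ _ => 1) Tame.one s

/-- Lengthening the past only averages the contributions seen from lower down, so any interval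
containing these still contains the result. -/
theorem condRatio_append_mem (hm : DensityModel lam q g σm σp B) (θ : Θ) (s t : List Bool)
    (c : List Bool → 𝒴) {m M : ℝ} (h₁ : ∀ x, m ≤ condRatio lam (q θ) (g θ) t (shift s c) x)
    (h₂ : ∀ x, condRatio lam (q θ) (g θ) t (shift s c) x ≤ M) (x : 𝒳) :
    m ≤ condRatio lam (q θ) (g θ) (s ++ t) c x ∧ condRatio lam (q θ) (g θ) (s ++ t) c x ≤ M := by
  induction s generalizing c x with
  | nil => exact ⟨h₁ x, h₂ x⟩
  | cons b s ih =>
    rw [List.cons_append, hm.condRatio_cons]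
    have hT := hm.tame_pastLik_one (b :: (s ++ t))
    obtain ⟨N, hN⟩ := hT.bdd
    have ih' := ih (sub b c) h₁ h₂
    exact hm.le_average θ x (hT.measurable_right θ c) (hT.pos θ c) (hN θ c)
      ((hm.measurable_condRatio θ (s ++ t)).comp (measurable_const.prodMk measurable_id))
      (fun x => (ih' x).1) (fun x => (ih' x).2)

theorem integrable_g (hm : DensityModel lam q g σm σp B) (θ : Θ) (y : 𝒴) :
    Integrable (fun x => g θ x y) lam := by
  refine Integrable.of_bound ((hm.g_meas θ).comp
    (measurable_id.prodMk measurable_const)).aestronglyMeasurable B (ae_of_all _ fun x => ?_)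
  rw [Real.norm_eq_abs, abs_of_pos (hm.g_pos θ x y)]
  exact hm.g_le θ x y

theorem integral_g_pos (hm : DensityModel lam q g σm σp B) (θ : Θ) (y : 𝒴) :
    0 < ∫ x, g θ x y ∂lam := by
  refine (integral_pos_iff_support_of_nonneg (fun x => (hm.g_pos θ x y).le)
    (hm.integrable_g θ y)).2 ?_
  have : (Function.support fun x => g θ x y) = Set.univ := by ext x; simp [(hm.g_pos θ x y).ne']
  rw [this]; simp

theorem condRatio_nil_mem (hm : DensityModel lam q g σm σp B) (θ : Θ)
    (c : List Bool → 𝒴) (x : 𝒳) :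
    σm * ∫ x, g θ x (c []) ∂lam ≤ condRatio lam (q θ) (g θ) [] c x ∧
      condRatio lam (q θ) (g θ) [] c x ≤ σp * ∫ x, g θ x (c []) ∂lam := by
  have e : condRatio lam (q θ) (g θ) [] c x = ∫ x', q θ x x' * g θ x' (c []) ∂lam := by
    have h₁ : qInt lam (q θ) (pastLik lam (q θ) (g θ) (fun _ _ => 1) [] c) x = 1 :=
      hm.qInt_const θ x 1
    rw [condRatio, h₁, div_one]; rfl
  have hi : Integrable (fun x' => q θ x x' * g θ x' (c [])) lam :=
    hm.integrable_q_mul θ x (f := fun x' => g θ x' (c []))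
      ((hm.g_meas θ).comp (measurable_id.prodMk measurable_const))
      (M := B) fun x' => by rw [abs_of_pos (hm.g_pos θ x' _)]; exact hm.g_le θ x' _
  rw [e, ← integral_const_mul, ← integral_const_mul]
  exact ⟨integral_mono ((hm.integrable_g θ _).const_mul _) hi
      fun x' => mul_le_mul_of_nonneg_right (hm.le_q θ x x') (hm.g_pos θ x' _).le,
    integral_mono hi ((hm.integrable_g θ _).const_mul _)
      fun x' => mul_le_mul_of_nonneg_right (hm.q_le θ x x') (hm.g_pos θ x' _).le⟩

theorem condRatio_mem (hm : DensityModel lam q g σm σp B) (θ : Θ) (s : List Bool)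
    (c : List Bool → 𝒴) (x : 𝒳) :
    σm * ∫ x, g θ x (c s) ∂lam ≤ condRatio lam (q θ) (g θ) s c x ∧
      condRatio lam (q θ) (g θ) s c x ≤ σp * ∫ x, g θ x (c s) ∂lam := by
  have h := fun x => hm.condRatio_nil_mem θ (shift s c) x
  have e : shift s c [] = c s := by simp [shift]
  rw [e] at h
  have := hm.condRatio_append_mem θ s [] c (fun x => (h x).1) (fun x => (h x).2) x
  rwa [List.append_nil] at this

/-- The oscillation in the initial state is at most `(σp - σm) ∫ g` when there is no past, and every
ancestor on the path contributes one contraction factor. -/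
theorem condRatio_sub_le (hm : DensityModel lam q g σm σp B) (θ : Θ) (s : List Bool)
    (c : List Bool → 𝒴) (x x' : 𝒳) :
    condRatio lam (q θ) (g θ) s c x - condRatio lam (q θ) (g θ) s c x' ≤
      (1 - σm / σp) ^ s.length * ((σp - σm) * ∫ x, g θ x (c s) ∂lam) := by
  induction s generalizing c x x' with
  | nil =>
    have h₁ := (hm.condRatio_nil_mem θ c x).2
    have h₂ := (hm.condRatio_nil_mem θ c x').1
    simp only [List.length_nil, pow_zero, one_mul]; linarith
  | cons b s ih =>
    rw [hm.condRatio_cons, hm.condRatio_cons, List.length_cons, pow_succ', mul_assoc]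
    have hT := hm.tame_pastLik_one (b :: s)
    obtain ⟨N, hN⟩ := hT.bdd
    exact hm.average_sub_le θ (hT.measurable_right θ c) (hT.pos θ c) (hN θ c)
      ((hm.measurable_condRatio θ s).comp (measurable_const.prodMk measurable_id))
      (ih (sub b c)) x x'

/-- Uniform geometric forgetting. -/
theorem abs_log_condRatio_append_sub_le (hm : DensityModel lam q g σm σp B) (θ : Θ)
    (s t : List Bool) (c : List Bool → 𝒴) (x x' : 𝒳) :
    |Real.log (condRatio lam (q θ) (g θ) (s ++ t) c x) -
      Real.log (condRatio lam (q θ) (g θ) t (shift s c) x')| ≤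
      (σp - σm) / σm * (1 - σm / σp) ^ t.length := by
  set c' := shift s c
  have hI := hm.integral_g_pos θ (c' t)
  have hlow := fun x => (hm.condRatio_mem θ t c' x).1
  have hosc := hm.condRatio_sub_le θ t c'
  set D := (1 - σm / σp) ^ t.length * ((σp - σm) * ∫ x, g θ x (c' t) ∂lam)
  -- Two uses of averaging: the interval of radius `D` around the value at `x'` controls the
  -- distance, and the crude bounds give the lower bound `σm ∫ g` needed to pass to logarithms. The
  -- integral of `g` then cancels in the quotient.
  have h₁ := hm.condRatio_append_mem θ s t c (m := condRatio lam (q θ) (g θ) t c' x' - D)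
    (M := condRatio lam (q θ) (g θ) t c' x' + D) (fun x => by linarith [hosc x' x])
    (fun x => by linarith [hosc x x']) x
  have h₂ := hm.condRatio_append_mem θ s t c hlow (fun x => (hm.condRatio_mem θ t c' x).2) x
  refine (abs_log_sub_log_le (D := D) (mul_pos hm.σm_pos hI) h₂.1 (hlow x')
    (abs_le.2 ⟨by linarith [h₁.1], by linarith [h₁.2]⟩)).trans_eq ?_
  have := hm.σm_pos.ne'
  simp only [D]
  field_simp

/-! ### Telescoping -/

/-- The past of a word with that word included is the strict past of the next word, so consecutive
terms cancel. The functional `ψ` is arbitrary because the induction descends into one child and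
absorbs the root and sibling factors into it. -/
theorem sumWord_telescope (hm : DensityModel lam q g σm σp B) (θ : Θ) (n : ℕ)
    (ψ : (𝒳 → ℝ) → ℝ) (c : List Bool → 𝒴) :
    sumWord n (fun s => ψ (pastLik lam (q θ) (g θ) (g θ) s c) -
        ψ (pastLik lam (q θ) (g θ) (fun _ _ => 1) s c)) =
      ψ (lik lam (q θ) (g θ) (n + 1) c) - ψ (lik lam (q θ) (g θ) n c) := by
  induction n generalizing ψ c with
  | zero =>
    simp only [sumWord]
    congr 2
    ext x
    have : qInt lam (q θ) (fun _ => 1) x = 1 := hm.qInt_const θ x 1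
    simp only [pastLik, lik, this, mul_one]
  | succ n ih =>
    have key : ∀ b : Bool, sumWord n (fun s =>
        ψ (pastLik lam (q θ) (g θ) (g θ) (b :: s) c) -
          ψ (pastLik lam (q θ) (g θ) (fun _ _ => 1) (b :: s) c)) =
        ψ (fun x => g θ x (c []) * qInt lam (q θ) (lik lam (q θ) (g θ) (n + 1) (sub b c)) x *
          qInt lam (q θ) (lik lam (q θ) (g θ) (n + b.toNat) (sub (!b) c)) x) -
        ψ (fun x => g θ x (c []) * qInt lam (q θ) (lik lam (q θ) (g θ) n (sub b c)) x *
          qInt lam (q θ) (lik lam (q θ) (g θ) (n + b.toNat) (sub (!b) c)) x) := by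
      intro b
      rw [← ih (fun f => ψ (fun x => g θ x (c []) * qInt lam (q θ) f x *
          qInt lam (q θ) (lik lam (q θ) (g θ) (n + b.toNat) (sub (!b) c)) x)) (sub b c)]
      exact sumWord_congr fun s hs => by simp only [← hs]; rfl
    rw [sumWord, key false, key true]
    simp only [Bool.toNat_false, Bool.toNat_true, Bool.not_false, Bool.not_true, add_zero]
    have e₁ : (fun x => g θ x (c []) *
        qInt lam (q θ) (lik lam (q θ) (g θ) (n + 1) (sub true c)) x *
          qInt lam (q θ) (lik lam (q θ) (g θ) (n + 1) (sub false c)) x) =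
        lik lam (q θ) (g θ) (n + 1 + 1) c := by
      ext x; rw [lik]; ring
    -- The state between the last left word and the first right word: the left subtree has its last
    -- generation, the right one does not yet. This term ends one half-sum and starts the other.
    have e₂ : (fun x => g θ x (c []) * qInt lam (q θ) (lik lam (q θ) (g θ) n (sub true c)) x *
          qInt lam (q θ) (lik lam (q θ) (g θ) (n + 1) (sub false c)) x) =
        fun x => g θ x (c []) * qInt lam (q θ) (lik lam (q θ) (g θ) (n + 1) (sub false c)) x *
          qInt lam (q θ) (lik lam (q θ) (g θ) n (sub true c)) x := by
      ext x; ring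
    have e₃ : (fun x => g θ x (c []) * qInt lam (q θ) (lik lam (q θ) (g θ) n (sub false c)) x *
          qInt lam (q θ) (lik lam (q θ) (g θ) n (sub true c)) x) =
        lik lam (q θ) (g θ) (n + 1) c := rfl
    rw [e₁, e₂, e₃]; ring

end DensityModel

/-- The log-likelihood contribution of generation `m`, given the hidden state `x` of the parent of
the root. -/
def genLik (lam : Measure 𝒳) (q : 𝒳 → 𝒳 → ℝ) (g : 𝒳 → 𝒴 → ℝ) (m : ℕ) (x : 𝒳)
    (c : List Bool → 𝒴) : ℝ :=
  sumWord m fun s => Real.log (condRatio lam q g s c x)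

namespace DensityModel

theorem genLik_eq (hm : DensityModel lam q g σm σp B) (θ : Θ) (m : ℕ) (x : 𝒳)
    (c : List Bool → 𝒴) :
    genLik lam (q θ) (g θ) m x c =
      Real.log (qInt lam (q θ) (lik lam (q θ) (g θ) (m + 1) c) x) -
        Real.log (qInt lam (q θ) (lik lam (q θ) (g θ) m c) x) := by
  rw [← hm.sumWord_telescope θ m (fun f => Real.log (qInt lam (q θ) f x)) c]
  exact sumWord_congr fun s _ => Real.log_div ((hm.tame_condRatio_num s).pos θ c x).ne'
    ((hm.tame_condRatio_den s).pos θ c x).ne'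

theorem log_qInt_lik (hm : DensityModel lam q g σm σp B) (θ : Θ) (n : ℕ) (x : 𝒳)
    (c : List Bool → 𝒴) :
    Real.log (qInt lam (q θ) (lik lam (q θ) (g θ) n c) x) =
      ∑ m ∈ Finset.range n, genLik lam (q θ) (g θ) m x c := by
  rw [Finset.sum_congr rfl fun m _ => hm.genLik_eq θ m x c,
    Finset.sum_range_sub fun m => Real.log (qInt lam (q θ) (lik lam (q θ) (g θ) m c) x)]
  have : qInt lam (q θ) (lik lam (q θ) (g θ) 0 c) x = 1 := hm.qInt_const θ x 1
  rw [this, Real.log_one, sub_zero]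

/-- Conditioning `genLik` on the parent of the root pays off here: given the root state `x`, the two
child subtrees contribute separately, each with parent state `x`. -/
theorem log_lik_succ_sub (hm : DensityModel lam q g σm σp B) (θ : Θ) (n : ℕ) (x : 𝒳)
    (c : List Bool → 𝒴) :
    Real.log (lik lam (q θ) (g θ) (n + 2) c x) - Real.log (lik lam (q θ) (g θ) (n + 1) c x) =
      genLik lam (q θ) (g θ) n x (sub false c) + genLik lam (q θ) (g θ) n x (sub true c) := by
  have hp : ∀ m c, qInt lam (q θ) (lik lam (q θ) (g θ) m c) x ≠ 0 := fun m c =>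
    ((hm.tame_qInt (hm.tame_lik m)).pos θ c x).ne'
  have hg := (hm.g_pos θ x (c [])).ne'
  have e : ∀ m, Real.log (lik lam (q θ) (g θ) (m + 1) c x) = Real.log (g θ x (c [])) +
      Real.log (qInt lam (q θ) (lik lam (q θ) (g θ) m (sub false c)) x) +
      Real.log (qInt lam (q θ) (lik lam (q θ) (g θ) m (sub true c)) x) := fun m => by
    rw [lik, Real.log_mul (mul_ne_zero hg (hp _ _)) (hp _ _), Real.log_mul hg (hp _ _)]
  rw [e, e, hm.genLik_eq, hm.genLik_eq]; ring

/-- Every word of length `j + k` is cut after its first `j` letters; forgetting costs the same for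
each of the `2 ^ (j + k)` words. -/
theorem abs_genLik_add_sub_le (hm : DensityModel lam q g σm σp B) (θ : Θ) (j k : ℕ) (x x' : 𝒳)
    (c : List Bool → 𝒴) :
    |genLik lam (q θ) (g θ) (j + k) x c -
      sumWord j fun s => genLik lam (q θ) (g θ) k x' (shift s c)| ≤
      2 ^ (j + k) * ((σp - σm) / σm * (1 - σm / σp) ^ k) := by
  unfold genLik
  rw [sumWord_append, ← sumWord_sub]
  refine (abs_sumWord_le (h := fun _ => 2 ^ k * ((σp - σm) / σm * (1 - σm / σp) ^ k))
    fun s _ => ?_).trans_eq ?_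
  · rw [← sumWord_sub, ← sumWord_const]
    exact abs_sumWord_le fun t ht => ht ▸ hm.abs_log_condRatio_append_sub_le θ s t c x x'
  · rw [sumWord_const, pow_add]; ring

theorem measurable_genLik (hm : DensityModel lam q g σm σp B) (θ : Θ) (m : ℕ) (x : 𝒳) :
    Measurable (genLik lam (q θ) (g θ) m x) :=
  sumWord_induction (p := Measurable) (fun _ _ hf hh => hf.add hh) fun s _ =>
    Real.measurable_log.comp ((hm.measurable_condRatio θ s).comp
      (measurable_id.prodMk measurable_const))

theorem continuous_genLik (hm : DensityModel lam q g σm σp B) (m : ℕ) (x : 𝒳)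
    (c : List Bool → 𝒴) : Continuous fun θ => genLik lam (q θ) (g θ) m x c :=
  sumWord_induction (p := Continuous) (fun _ _ hf hh => hf.add hh) fun s _ =>
    (hm.continuous_condRatio s c x).log fun θ => (hm.condRatio_pos θ s c x).ne'

end DensityModel

/-! ### Dependence on finitely many generations -/

/-- The configuration which coincides with `c` on generations `0` to `n` and is constant along
the branches afterwards. -/
def truncate (n : ℕ) (c : List Bool → 𝒴) : List Bool → 𝒴 := fun s => c (s.take n)

theorem lik_congr {q : 𝒳 → 𝒳 → ℝ} {g : 𝒳 → 𝒴 → ℝ} {n : ℕ} {c c' : List Bool → 𝒴}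
    (h : ∀ s, s.length < n → c s = c' s) : lik lam q g n c = lik lam q g n c' := by
  induction n generalizing c c' with
  | zero => rfl
  | succ n ih =>
    ext x
    have : ∀ b, lik lam q g n (sub b c) = lik lam q g n (sub b c') := fun b =>
      ih fun s hs => h _ (by simpa using hs)
    rw [lik, lik, this, this, h [] (by simp)]

theorem pastLik_congr {q : 𝒳 → 𝒳 → ℝ} {g f₀ : 𝒳 → 𝒴 → ℝ} {s : List Bool} {c c' : List Bool → 𝒴}
    (h : ∀ t, t.length ≤ s.length → c t = c' t) :
    pastLik lam q g f₀ s c = pastLik lam q g f₀ s c' := by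
  induction s generalizing c c' with
  | nil => ext x; rw [pastLik, pastLik, h [] le_rfl]
  | cons b s ih =>
    ext x
    have h₁ : lik lam q g (s.length + b.toNat) (sub (!b) c) =
        lik lam q g (s.length + b.toNat) (sub (!b) c') :=
      lik_congr fun t ht => h _ (by have := b.toNat_le; simp; omega)
    rw [pastLik, pastLik, h₁, ih (c := sub b c) (c' := sub b c') fun t ht => h _ (by simpa using ht),
      h [] (by simp)]

theorem condRatio_congr {q : 𝒳 → 𝒳 → ℝ} {g : 𝒳 → 𝒴 → ℝ} {s : List Bool} {c c' : List Bool → 𝒴}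
    (h : ∀ t, t.length ≤ s.length → c t = c' t) : condRatio lam q g s c = condRatio lam q g s c' := by
  ext x; rw [condRatio, condRatio, pastLik_congr h, pastLik_congr h]

theorem truncate_eq {n : ℕ} (c : List Bool → 𝒴) {t : List Bool} (ht : t.length ≤ n) :
    truncate n c t = c t := by
  rw [truncate, List.take_of_length_le ht]

theorem condRatio_truncate {q : 𝒳 → 𝒳 → ℝ} {g : 𝒳 → 𝒴 → ℝ} {s : List Bool} {n : ℕ}
    (hs : s.length ≤ n) (c : List Bool → 𝒴) :
    condRatio lam q g s (truncate n c) = condRatio lam q g s c :=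
  condRatio_congr fun _ ht => truncate_eq c (ht.trans hs)

/-- `HasTreeLaw` prescribes only the laws of truncated configurations; invariance under truncation
is what lets these laws be applied to a functional. -/
theorem genLik_truncate {q : 𝒳 → 𝒳 → ℝ} {g : 𝒳 → 𝒴 → ℝ} {m n : ℕ}
    (hs : m ≤ n) (x : 𝒳) (c : List Bool → 𝒴) :
    genLik lam q g m x (truncate n c) = genLik lam q g m x c :=
  sumWord_congr fun s h => by rw [condRatio_truncate (h.trans_le hs)]

end Contraction

/-! ### The law of the observed tree -/

section TreeKernel

variable {𝒳 𝒴 : Type*} [MeasurableSpace 𝒳] [MeasurableSpace 𝒴]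

/-- The configuration with value `y` at the root and restrictions `c₀`, `c₁` to the subtrees. -/
def glue (p : 𝒴 × (List Bool → 𝒴) × (List Bool → 𝒴)) : List Bool → 𝒴
  | [] => p.1
  | false :: s => p.2.1 s
  | true :: s => p.2.2 s

theorem measurable_glue :
    Measurable (glue : 𝒴 × (List Bool → 𝒴) × (List Bool → 𝒴) → List Bool → 𝒴) := by
  refine measurable_pi_lambda _ fun s => ?_
  rcases s with _ | ⟨_ | _, s⟩ <;> simp only [glue] <;> fun_prop

/-- The law of the observations on generations `0` to `n` given the hidden state of the root. (The
configuration is extended by constants to the other generations.) -/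
def treeKernel (Q : Kernel 𝒳 𝒳) (G : Kernel 𝒳 𝒴) : ℕ → Kernel 𝒳 (List Bool → 𝒴)
  | 0 => G.map fun y _ => y
  | n + 1 => (G ×ₖ ((treeKernel Q G n ∘ₖ Q) ×ₖ (treeKernel Q G n ∘ₖ Q))).map glue

theorem measurable_const_config : Measurable fun (y : 𝒴) (_ : List Bool) => y :=
  measurable_pi_lambda _ fun _ => measurable_id

variable (Q : Kernel 𝒳 𝒳) [IsMarkovKernel Q] (G : Kernel 𝒳 𝒴) [IsMarkovKernel G]

instance (n : ℕ) : IsMarkovKernel (treeKernel Q G n) := by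
  induction n with
  | zero => exact Kernel.IsMarkovKernel.map _ measurable_const_config
  | succ n ih => exact Kernel.IsMarkovKernel.map _ measurable_glue

theorem treeKernel_succ_apply (n : ℕ) (x : 𝒳) :
    treeKernel Q G (n + 1) x = ((G x).prod (((treeKernel Q G n ∘ₖ Q) x).prod
      ((treeKernel Q G n ∘ₖ Q) x))).map glue := by
  rw [treeKernel, Kernel.map_apply _ measurable_glue, Kernel.prod_apply, Kernel.prod_apply]

theorem map_sub_treeKernel_succ (b : Bool) (n : ℕ) (x : 𝒳) :
    (treeKernel Q G (n + 1) x).map (sub b) = (treeKernel Q G n ∘ₖ Q) x := by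
  rw [treeKernel_succ_apply, Measure.map_map (measurable_sub b) measurable_glue]
  cases b
  · have : sub false ∘ (glue : 𝒴 × _ × _ → _) = Prod.fst ∘ Prod.snd := rfl
    rw [this, ← Measure.map_map measurable_fst measurable_snd]
    simp
  · have : sub true ∘ (glue : 𝒴 × _ × _ → _) = Prod.snd ∘ Prod.snd := rfl
    rw [this, ← Measure.map_map measurable_snd measurable_snd]
    simp

-- By invariance of `ν`, the subtree of either child of a stationary tree is again a stationary
-- tree, one generation shorter.
variable {Q} in
theorem map_sub_treeKernel_comp {ν : Measure 𝒳} (hν : Kernel.Invariant Q ν) (b : Bool) (n : ℕ) :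
    (treeKernel Q G (n + 1) ∘ₘ ν).map (sub b) = treeKernel Q G n ∘ₘ ν := by
  have : (treeKernel Q G (n + 1)).map (sub b) = treeKernel Q G n ∘ₖ Q := by
    ext1 x; rw [Kernel.map_apply _ (measurable_sub b), map_sub_treeKernel_succ]
  rw [Measure.map_comp _ _ (measurable_sub b), this, ← Measure.comp_assoc]
  congr 1

/-- Given the root state, the two child subtrees are independent with the same law. -/
theorem integral_mul_treeKernel_succ (n : ℕ) (x : 𝒳) {f : (List Bool → 𝒴) → ℝ}
    (hf : Measurable f) :
    ∫ c, f (sub false c) * f (sub true c) ∂(treeKernel Q G (n + 1) x) =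
      (∫ c, f c ∂(treeKernel Q G n ∘ₖ Q) x) ^ 2 := by
  have hfm : Measurable fun c => f (sub false c) * f (sub true c) :=
    (hf.comp (measurable_sub false)).mul (hf.comp (measurable_sub true))
  rw [treeKernel_succ_apply, integral_map measurable_glue.aemeasurable hfm.aestronglyMeasurable]
  have h := integral_prod_mul (μ := G x) (ν := ((treeKernel Q G n ∘ₖ Q) x).prod
      ((treeKernel Q G n ∘ₖ Q) x)) (fun _ => (1 : ℝ)) (fun p => f p.1 * f p.2)
  rw [integral_prod_mul] at h
  simp only [one_mul, integral_const, probReal_univ, smul_eq_mul, mul_one] at h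
  rw [sq, ← h]
  rfl

theorem integral_comp_measure {α β : Type*} {mα : MeasurableSpace α} {mβ : MeasurableSpace β}
    {κ : Kernel α β} {μ : Measure α} {f : β → ℝ} (hf : Integrable f (κ ∘ₘ μ)) :
    ∫ z, f z ∂(κ ∘ₘ μ) = ∫ x, ∫ y, f y ∂κ x ∂μ := by
  rw [Measure.comp_eq_comp_const_apply] at hf ⊢
  rw [Kernel.integral_comp hf, Kernel.const_apply]

/-- Applied to `Q x ≤ C • ν`, it carries integrability under the stationary law over to the
conditional law given any hidden state. -/
theorem comp_le_smul {α β : Type*} {mα : MeasurableSpace α} {mβ : MeasurableSpace β}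
    (κ : Kernel α β) {μ ν : Measure α} {C : ENNReal} (h : μ ≤ C • ν) :
    κ ∘ₘ μ ≤ C • (κ ∘ₘ ν) := by
  refine Measure.le_iff.2 fun s hs => ?_
  rw [Measure.smul_apply, Measure.bind_apply hs κ.aemeasurable, Measure.bind_apply hs κ.aemeasurable,
    ← lintegral_smul_measure]
  exact lintegral_mono' h le_rfl

/-- The sum of `F` over the subtrees rooted at generation `n`. -/
def genSum (F : (List Bool → 𝒴) → ℝ) (n : ℕ) (c : List Bool → 𝒴) : ℝ :=
  sumWord n fun s => F (shift s c)

theorem genSum_succ (F : (List Bool → 𝒴) → ℝ) (n : ℕ) (c : List Bool → 𝒴) :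
    genSum F (n + 1) c = genSum F n (sub false c) + genSum F n (sub true c) := rfl

theorem measurable_genSum {F : (List Bool → 𝒴) → ℝ} (hF : Measurable F) (n : ℕ) :
    Measurable (genSum F n) :=
  sumWord_induction (p := Measurable) (fun _ _ hf hh => hf.add hh) fun s _ =>
    hF.comp (measurable_shift s)

/-! ### Second moments of sums over a generation -/

section Variance

variable {Q G} {ν : Measure 𝒳} [IsProbabilityMeasure ν] (hν : Kernel.Invariant Q ν)
  {F : (List Bool → 𝒴) → ℝ} (hF : Measurable F) {k : ℕ}

include hν hF

theorem measurePreserving_sub (b : Bool) (n : ℕ) :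
    MeasurePreserving (sub b) (treeKernel Q G (n + 1) ∘ₘ ν) (treeKernel Q G n ∘ₘ ν) :=
  ⟨measurable_sub b, map_sub_treeKernel_comp G hν b n⟩

theorem memLp_genSum (hF2 : MemLp F 2 (treeKernel Q G k ∘ₘ ν)) (n : ℕ) :
    MemLp (genSum F n) 2 (treeKernel Q G (k + n) ∘ₘ ν) := by
  induction n with
  | zero => exact hF2
  | succ n ih =>
    exact (ih.comp_measurePreserving (measurePreserving_sub hν hF false (k + n))).add
      (ih.comp_measurePreserving (measurePreserving_sub hν hF true (k + n)))

theorem integral_genSum_eq_zero (hF2 : MemLp F 2 (treeKernel Q G k ∘ₘ ν))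
    (h0 : ∫ c, F c ∂(treeKernel Q G k ∘ₘ ν) = 0) (n : ℕ) :
    ∫ c, genSum F n c ∂(treeKernel Q G (k + n) ∘ₘ ν) = 0 := by
  induction n with
  | zero => exact h0
  | succ n ih =>
    have hi := (memLp_genSum hν hF hF2 n).integrable one_le_two
    have hp := fun b => measurePreserving_sub (G := G) hν hF b (k + n)
    have e : ∀ b, ∫ c, genSum F n (sub b c) ∂(treeKernel Q G (k + n + 1) ∘ₘ ν) = 0 := fun b => by
      rw [← ih, ← (hp b).map_eq, integral_map (measurable_sub b).aemeasurable
        (measurable_genSum hF n).aestronglyMeasurable]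
    have hi' : ∀ b, Integrable (fun c => genSum F n (sub b c))
      (treeKernel Q G (k + n + 1) ∘ₘ ν) := fun b => (hp b).integrable_comp_of_integrable hi
    simp only [genSum_succ]
    rw [← add_assoc, integral_add (hi' _) (hi' _), e, e, add_zero]

/-- The conditional mean of `genSum F n` over the subtree of a child of a vertex. -/
theorem integral_genSum_succ_comp {C : ENNReal} (hC : C ≠ ⊤) (hQ : ∀ x, Q x ≤ C • ν)
    (hF2 : MemLp F 2 (treeKernel Q G k ∘ₘ ν)) (n : ℕ) (x : 𝒳) :
    ∫ c, genSum F (n + 1) c ∂(treeKernel Q G (k + (n + 1)) ∘ₖ Q) x =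
      ∫ x', 2 * ∫ c, genSum F n c ∂(treeKernel Q G (k + n) ∘ₖ Q) x' ∂Q x := by
  have hi : ∀ n x, Integrable (genSum F n) ((treeKernel Q G (k + n) ∘ₖ Q) x) := fun n x => by
    refine (((memLp_genSum hν hF hF2 n).of_measure_le_smul hC ?_).integrable one_le_two)
    rw [Kernel.comp_apply]
    exact comp_le_smul _ (hQ x)
  rw [Kernel.integral_comp (hi _ x)]
  congr 1
  ext x'
  have e : ∀ b, ∫ c, genSum F n (sub b c) ∂(treeKernel Q G (k + n + 1) x') =
      ∫ c, genSum F n c ∂(treeKernel Q G (k + n) ∘ₖ Q) x' := fun b => by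
    rw [← map_sub_treeKernel_succ Q G b, integral_map (measurable_sub b).aemeasurable
      (measurable_genSum hF n).aestronglyMeasurable]
  have hi' : ∀ b, Integrable (fun c => genSum F n (sub b c)) (treeKernel Q G (k + n + 1) x') :=
    fun b => by
      have := hi n x'
      rw [← map_sub_treeKernel_succ Q G b] at this
      exact this.comp_measurable (measurable_sub b)
  simp only [genSum_succ]
  rw [← add_assoc, integral_add (hi' _) (hi' _), e, e, two_mul]

/-- Expansion of the square of the sum over the two child subtrees: the squares have the stationary
law of the previous step, and the cross term is a squared conditional mean by conditional
independence. -/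
theorem integral_sq_genSum_succ
    (hF2 : MemLp F 2 (treeKernel Q G k ∘ₘ ν)) (n : ℕ) :
    ∫ c, genSum F (n + 1) c ^ 2 ∂(treeKernel Q G (k + (n + 1)) ∘ₘ ν) =
      2 * ∫ c, genSum F n c ^ 2 ∂(treeKernel Q G (k + n) ∘ₘ ν) +
      2 * ∫ x, (∫ c, genSum F n c ∂(treeKernel Q G (k + n) ∘ₖ Q) x) ^ 2 ∂ν := by
  have hL := memLp_genSum hν hF hF2 n
  have hp := fun b => measurePreserving_sub (G := G) hν hF b (k + n)
  have hL' := fun b => hL.comp_measurePreserving (hp b)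
  have e : ∀ b, ∫ c, genSum F n (sub b c) ^ 2 ∂(treeKernel Q G (k + n + 1) ∘ₘ ν) =
      ∫ c, genSum F n c ^ 2 ∂(treeKernel Q G (k + n) ∘ₘ ν) := fun b => by
    rw [← (hp b).map_eq, integral_map (measurable_sub b).aemeasurable
      ((measurable_genSum hF n).pow_const 2).aestronglyMeasurable]
  have hi : ∀ b, Integrable (fun c => genSum F n (sub b c) ^ 2)
    (treeKernel Q G (k + n + 1) ∘ₘ ν) := fun b => (hL' b).integrable_sq
  have hc : Integrable (fun c => genSum F n (sub false c) * genSum F n (sub true c))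
    (treeKernel Q G (k + n + 1) ∘ₘ ν) := (hL' false).integrable_mul (hL' true)
  have hcross := integral_comp_measure hc
  simp only [integral_mul_treeKernel_succ Q G (k + n) _ (measurable_genSum hF n)] at hcross
  rw [← hcross, ← add_assoc]
  have : ∀ c, genSum F (n + 1) c ^ 2 = (genSum F n (sub false c) ^ 2 + genSum F n (sub true c) ^ 2)
      + 2 * (genSum F n (sub false c) * genSum F n (sub true c)) := fun c => by
    rw [genSum_succ]; ring
  simp only [this]
  have hi₂ : Integrable (fun c => genSum F n (sub false c) ^ 2 + genSum F n (sub true c) ^ 2)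
    (treeKernel Q G (k + n + 1) ∘ₘ ν) := (hi _).add (hi _)
  rw [integral_add hi₂ (hc.const_mul 2), integral_add (hi _) (hi _), e, e,
    integral_const_mul]
  ring

/-- Geometric decay of the conditional means, for a kernel `Q` which contracts oscillations. -/
theorem abs_integral_genSum_comp_le {C : ENNReal} (hC : C ≠ ⊤) (hQ : ∀ x, Q x ≤ C • ν) {ρ : ℝ}
    (hcontr : ∀ f : 𝒳 → ℝ, Measurable f → ∀ D, (∀ x x', f x - f x' ≤ D) →
      ∀ x x', ∫ z, f z ∂Q x - ∫ z, f z ∂Q x' ≤ ρ * D)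
    (hF2 : MemLp F 2 (treeKernel Q G k ∘ₘ ν)) (h0 : ∫ c, F c ∂(treeKernel Q G k ∘ₘ ν) = 0) :
    ∃ D, ∀ n x, |∫ c, genSum F n c ∂(treeKernel Q G (k + n) ∘ₖ Q) x| ≤ (2 * ρ) ^ n * D := by
  set f : ℕ → 𝒳 → ℝ := fun n x => ∫ c, genSum F n c ∂(treeKernel Q G (k + n) ∘ₖ Q) x
  have hfm : ∀ n, Measurable (f n) := fun n =>
    ((measurable_genSum hF n).stronglyMeasurable.integral_kernel).measurable
  have hle : ∀ n x, (treeKernel Q G n ∘ₖ Q) x ≤ C • (treeKernel Q G n ∘ₘ ν) := fun n x => by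
    rw [Kernel.comp_apply]; exact comp_le_smul _ (hQ x)
  set D₀ : ℝ := C.toReal * ∫ c, |F c| ∂(treeKernel Q G k ∘ₘ ν)
  have hFi := hF2.integrable one_le_two
  have hf0 : ∀ x, |f 0 x| ≤ D₀ := fun x => by
    refine (abs_integral_le_integral_abs).trans ?_
    have := integral_mono_measure (hle k x) (ae_of_all _ fun c => abs_nonneg (F c))
      (hFi.abs.smul_measure hC)
    rwa [integral_smul_measure] at this
  -- At each generation the number of subtrees doubles while one more transition contracts the
  -- oscillation by `ρ`.
  have hosc : ∀ n x x', f n x - f n x' ≤ (2 * ρ) ^ n * (2 * D₀) := by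
    intro n
    induction n with
    | zero =>
      intro x x'
      have h₁ := abs_le.1 (hf0 x); have h₂ := abs_le.1 (hf0 x')
      simp only [pow_zero, one_mul]; linarith
    | succ n ih =>
      intro x x'
      have e : ∀ x, f (n + 1) x = 2 * ∫ x', f n x' ∂Q x := fun x => by
        rw [← integral_const_mul]; exact integral_genSum_succ_comp hν hF hC hQ hF2 n x
      have := hcontr (f n) (hfm n) _ ih x x'
      rw [e, e, pow_succ]; linarith
  refine ⟨2 * D₀, fun n x => ?_⟩
  have hb : ∀ n, ∃ M, ∀ x, |f n x| ≤ M := fun n => by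
    refine ⟨|f n x| + (2 * ρ) ^ n * (2 * D₀), fun z => abs_le.2 ⟨?_, ?_⟩⟩
    · linarith [hosc n x z, neg_abs_le (f n x)]
    · linarith [hosc n z x, le_abs_self (f n x)]
  obtain ⟨M, hM⟩ := hb n
  have hfi : Integrable (f n) ν :=
    Integrable.of_bound (hfm n).aestronglyMeasurable M (ae_of_all _ hM)
  have hmean : ∫ x, f n x ∂ν = 0 := by
    have hi := (memLp_genSum hν hF hF2 n).integrable one_le_two
    have e : (treeKernel Q G (k + n) ∘ₖ Q) ∘ₘ ν = treeKernel Q G (k + n) ∘ₘ ν := by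
      rw [← Measure.comp_assoc]; congr 1
    rw [← integral_genSum_eq_zero hν hF hF2 h0 n, ← e, integral_comp_measure (e ▸ hi)]
  -- A function of zero mean under `ν` is bounded by its oscillation.
  have e : f n x = ∫ x', (f n x - f n x') ∂ν := by
    rw [integral_sub (integrable_const _) hfi, hmean]; simp
  change |f n x| ≤ _
  have hi : Integrable (fun x' => f n x - f n x') ν := (integrable_const _).sub hfi
  rw [abs_le]
  constructor
  · rw [e]
    have := integral_mono (μ := ν) (integrable_const (-((2 * ρ) ^ n * (2 * D₀)))) hi
      fun x' => by simp only; linarith [hosc n x' x]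
    simpa using this
  · rw [e]
    have := integral_mono (μ := ν) hi (integrable_const ((2 * ρ) ^ n * (2 * D₀)))
      fun x' => hosc n x x'
    simpa using this

end Variance

/-- Summing the recursion bounds a partial sum by half of the preceding one plus a constant;
monotonicity of the partial sums closes the estimate. -/
theorem summable_of_le_half_add {a b : ℕ → ℝ} (ha : ∀ n, 0 ≤ a n) (hb : ∀ n, 0 ≤ b n)
    (hs : Summable b) (h : ∀ n, a (n + 1) ≤ a n / 2 + b n) : Summable a := by
  refine summable_of_sum_range_le (c := 2 * (a 0 + ∑' n, b n)) ha fun n => ?_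
  have h₁ : ∀ n, ∑ i ∈ Finset.range (n + 1), a i ≤
      (∑ i ∈ Finset.range n, a i) / 2 + a 0 + ∑' n, b n := fun n => by
    rw [Finset.sum_range_succ']
    have := Finset.sum_le_sum fun i (_ : i ∈ Finset.range n) => h i
    rw [Finset.sum_add_distrib, ← Finset.sum_div] at this
    linarith [hs.sum_le_tsum (Finset.range n) fun i _ => hb i]
  have h₂ := h₁ n
  rw [Finset.sum_range_succ] at h₂
  linarith [ha n]

/-- Dividing the recursion by `4 ^ (n + 1)` halves the previous normalized second moment and adds
half of the squared conditional mean over `4 ^ n`, which is at most `ρ ^ (2 * n) * D ^ 2 / 2`. -/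
theorem summable_integral_sq_genSum {Q : Kernel 𝒳 𝒳} [IsMarkovKernel Q] {G : Kernel 𝒳 𝒴}
    [IsMarkovKernel G] {ν : Measure 𝒳} [IsProbabilityMeasure ν]
    (hν : Kernel.Invariant Q ν) {F : (List Bool → 𝒴) → ℝ} (hF : Measurable F) {k : ℕ}
    {C : ENNReal} (hC : C ≠ ⊤) (hQ : ∀ x, Q x ≤ C • ν) {ρ : ℝ} (hρ : 0 ≤ ρ) (hρ1 : ρ < 1)
    (hcontr : ∀ f : 𝒳 → ℝ, Measurable f → ∀ D, (∀ x x', f x - f x' ≤ D) →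
      ∀ x x', ∫ z, f z ∂Q x - ∫ z, f z ∂Q x' ≤ ρ * D)
    (hF2 : MemLp F 2 (treeKernel Q G k ∘ₘ ν)) (h0 : ∫ c, F c ∂(treeKernel Q G k ∘ₘ ν) = 0) :
    Summable fun n => ∫ c, (genSum F n c / 2 ^ n) ^ 2 ∂(treeKernel Q G (k + n) ∘ₘ ν) := by
  obtain ⟨D, hD⟩ := abs_integral_genSum_comp_le hν hF hC hQ hcontr hF2 h0
  refine summable_of_le_half_add (b := fun n => (ρ ^ 2) ^ n * (D ^ 2 / 2))
    (fun n => integral_nonneg fun _ => sq_nonneg _) (fun n => by positivity)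
    ((summable_geometric_of_lt_one (sq_nonneg ρ) (by nlinarith)).mul_right _) fun n => ?_
  simp only [div_pow, integral_div]
  rw [integral_sq_genSum_succ hν hF hF2]
  have h₁ : ∫ x, (∫ c, genSum F n c ∂(treeKernel Q G (k + n) ∘ₖ Q) x) ^ 2 ∂ν ≤
      ((2 * ρ) ^ n * D) ^ 2 := by
    have hi : Integrable (fun x => (∫ c, genSum F n c ∂(treeKernel Q G (k + n) ∘ₖ Q) x) ^ 2) ν :=
      Integrable.of_bound (((measurable_genSum hF n).stronglyMeasurable.integral_kernel).measurable
        |>.pow_const 2).aestronglyMeasurable (((2 * ρ) ^ n * D) ^ 2) (ae_of_all _ fun x => by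
          rw [Real.norm_eq_abs, abs_pow]
          exact pow_le_pow_left₀ (abs_nonneg _) (hD n x) 2)
    have := integral_mono hi (integrable_const (((2 * ρ) ^ n * D) ^ 2)) fun x => by
      simp only; rw [← sq_abs]; exact pow_le_pow_left₀ (abs_nonneg _) (hD n x) 2
    simpa using this
  generalize ∫ x, (∫ c, genSum F n c ∂(treeKernel Q G (k + n) ∘ₖ Q) x) ^ 2 ∂ν = W at h₁ ⊢
  generalize ∫ c, genSum F n c ^ 2 ∂(treeKernel Q G (k + n) ∘ₘ ν) = V
  have h4 : (0 : ℝ) < (2 ^ n) ^ 2 := by positivity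
  have h₂ : W / (2 ^ n) ^ 2 ≤ (ρ ^ 2) ^ n * D ^ 2 := by
    rw [div_le_iff₀ h4]
    refine h₁.trans_eq ?_
    rw [mul_pow, mul_pow, mul_pow, ← pow_mul ρ, ← pow_mul ρ, mul_comm n 2]; ring
  have h₃ : (2 * V + 2 * W) / (2 ^ (n + 1)) ^ 2 = V / (2 ^ n) ^ 2 / 2 + W / (2 ^ n) ^ 2 / 2 := by
    rw [pow_succ (2 : ℝ) n, mul_pow]; field_simp
  rw [h₃]; linarith

theorem shift_truncate (s : List Bool) (k : ℕ) (c : List Bool → 𝒴) :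
    shift s (truncate (k + s.length) c) = truncate k (shift s c) := by
  ext t
  simp only [shift, truncate]
  rw [add_comm, List.take_length_add_append]

theorem measurable_truncate (n : ℕ) :
    Measurable (truncate n : (List Bool → 𝒴) → List Bool → 𝒴) := by
  unfold truncate; fun_prop

/-- `c` is a random configuration, the first `n + 1` generations of which, for each `n`, are the
observations of a hidden Markov tree with initial law `ν`. -/
structure HasTreeLaw {Ω : Type*} [MeasurableSpace Ω] (P : Measure Ω) (Q : Kernel 𝒳 𝒳)
    (G : Kernel 𝒳 𝒴) (ν : Measure 𝒳) (c : Ω → List Bool → 𝒴) : Prop where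
  measurable : Measurable c
  map_eq : ∀ n, P.map (fun ω => truncate n (c ω)) = (treeKernel Q G n ∘ₘ ν).map (truncate n)

/-- For a functional of the first `n + 1` generations, computations under `P` reduce to `treeKernel
Q G n`. -/
theorem HasTreeLaw.map_comp_eq {Ω β : Type*} [MeasurableSpace Ω] [MeasurableSpace β]
    {P : Measure Ω} {Q : Kernel 𝒳 𝒳} {G : Kernel 𝒳 𝒴} {ν : Measure 𝒳} {c : Ω → List Bool → 𝒴}
    (h : HasTreeLaw P Q G ν c) {F : (List Bool → 𝒴) → β} (hF : Measurable F) {n : ℕ}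
    (hn : ∀ c, F (truncate n c) = F c) :
    P.map (fun ω => F (c ω)) = (treeKernel Q G n ∘ₘ ν).map F := by
  have hn' : F ∘ truncate n = F := funext hn
  have hm : Measurable fun ω => truncate n (c ω) := (measurable_truncate n).comp h.measurable
  have e : (fun ω => F (c ω)) = F ∘ fun ω => truncate n (c ω) := funext fun ω => (hn _).symm
  rw [e, ← Measure.map_map hF hm, h.map_eq, Measure.map_map hF (measurable_truncate n), hn']

/-- The strong law of large numbers for a hidden Markov tree. -/
theorem HasTreeLaw.tendsto_genSum {Ω : Type*} [MeasurableSpace Ω] {P : Measure Ω}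
    {Q : Kernel 𝒳 𝒳} [IsMarkovKernel Q] {G : Kernel 𝒳 𝒴}
    [IsMarkovKernel G] {ν : Measure 𝒳} [IsProbabilityMeasure ν] {c : Ω → List Bool → 𝒴}
    (h : HasTreeLaw P Q G ν c)
    (hν : Kernel.Invariant Q ν) {F : (List Bool → 𝒴) → ℝ} (hF : Measurable F) {k : ℕ}
    {C : ENNReal} (hC : C ≠ ⊤) (hQ : ∀ x, Q x ≤ C • ν) {ρ : ℝ} (hρ : 0 ≤ ρ) (hρ1 : ρ < 1)
    (hcontr : ∀ f : 𝒳 → ℝ, Measurable f → ∀ D, (∀ x x', f x - f x' ≤ D) →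
      ∀ x x', ∫ z, f z ∂Q x - ∫ z, f z ∂Q x' ≤ ρ * D)
    (hF2 : MemLp F 2 (treeKernel Q G k ∘ₘ ν)) (hk : ∀ c, F (truncate k c) = F c) :
    ∀ᵐ ω ∂P, Tendsto (fun n => genSum F n (c ω) / 2 ^ n) atTop
      (𝓝 (∫ c, F c ∂(treeKernel Q G k ∘ₘ ν))) := by
  set m := ∫ c, F c ∂(treeKernel Q G k ∘ₘ ν)
  set F' : (List Bool → 𝒴) → ℝ := fun c => F c - m with hF'_def
  have hF' : Measurable F' := hF.sub_const m
  have hF2' : MemLp F' 2 (treeKernel Q G k ∘ₘ ν) := hF2.sub (memLp_const m)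
  have h0 : ∫ c, F' c ∂(treeKernel Q G k ∘ₘ ν) = 0 := by
    rw [integral_sub (hF2.integrable one_le_two) (integrable_const _)]; simp [m]
  have hk' : ∀ c, F' (truncate k c) = F' c := fun c => by simp only [F', hk]
  have hs := summable_integral_sq_genSum hν hF' hC hQ hρ hρ1 hcontr hF2' h0
  -- The sum over generation `n` of a functional of depth `k` has depth `k + n`, the depth of the
  -- kernel under which its second moment is computed.
  have htr : ∀ n c, genSum F' n (truncate (k + n) c) = genSum F' n c := fun n c =>
    sumWord_congr fun s hs => by rw [← hs, shift_truncate, hk']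
  have hmeas : ∀ n, Measurable fun c => ENNReal.ofReal ((genSum F' n c / 2 ^ n) ^ 2) := fun n =>
    (((measurable_genSum hF' n).div_const _).pow_const 2).ennreal_ofReal
  have hint : ∀ n, ∫⁻ ω, ENNReal.ofReal ((genSum F' n (c ω) / 2 ^ n) ^ 2) ∂P =
      ENNReal.ofReal (∫ c, (genSum F' n c / 2 ^ n) ^ 2 ∂(treeKernel Q G (k + n) ∘ₘ ν)) := by
    intro n
    rw [ofReal_integral_eq_lintegral_ofReal _ (ae_of_all _ fun _ => sq_nonneg _)]
    · have := h.map_comp_eq (hmeas n) (n := k + n) fun c => by rw [htr]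
      have e := lintegral_map (μ := treeKernel Q G (k + n) ∘ₘ ν) measurable_id (hmeas n)
      have e' := lintegral_map (μ := P) measurable_id ((hmeas n).comp h.measurable)
      simp only [id, Function.comp_def] at e e'
      rw [← e, ← this, e']
    · have := (memLp_genSum hν hF' hF2' n).integrable_sq.div_const ((2 ^ n) ^ 2)
      simpa only [div_pow] using this
  have hmeas' : ∀ n, Measurable fun ω => ENNReal.ofReal ((genSum F' n (c ω) / 2 ^ n) ^ 2) :=
    fun n => (hmeas n).comp h.measurable
  -- The expected sum of the squared normalized sums is finite, so almost surely the series
  -- converges and its terms tend to zero.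
  have hsum : ∫⁻ ω, ∑' n, ENNReal.ofReal ((genSum F' n (c ω) / 2 ^ n) ^ 2) ∂P ≠ ⊤ := by
    rw [lintegral_tsum fun n => (hmeas' n).aemeasurable]
    simp only [hint]
    exact hs.tsum_ofReal_ne_top
  filter_upwards [ae_lt_top (Measurable.tsum hmeas') hsum] with ω hω
  have h₁ := ENNReal.tendsto_atTop_zero_of_tsum_ne_top hω.ne
  have h₂ : Tendsto (fun n => (genSum F' n (c ω) / 2 ^ n) ^ 2) atTop (𝓝 0) := by
    have := (ENNReal.tendsto_toReal ENNReal.zero_ne_top).comp h₁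
    refine this.congr fun n => ?_
    simp [ENNReal.toReal_ofReal (sq_nonneg _)]
  have h₃ : Tendsto (fun n => genSum F' n (c ω) / 2 ^ n) atTop (𝓝 0) := by
    rw [tendsto_zero_iff_abs_tendsto_zero]
    have := h₂.sqrt
    simpa only [Real.sqrt_sq_eq_abs, Real.sqrt_zero, Function.comp_def] using this
  have e : ∀ n, genSum F n (c ω) / 2 ^ n = genSum F' n (c ω) / 2 ^ n + m := fun n => by
    simp only [genSum, F']
    rw [sumWord_sub, sumWord_const]
    field_simp
    ring
  simp only [e]
  simpa using h₃.add_const m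

end TreeKernel

/-! ### Densities of the law of the observed tree -/

section Density

variable {Θ 𝒳 𝒴 : Type*} [MeasurableSpace 𝒳] [MeasurableSpace 𝒴] [TopologicalSpace Θ]

/-- The reference measure on configurations, a product of copies of `mu` over the vertices of
generations `0` to `n`. -/
def treeRef (mu : Measure 𝒴) : ℕ → Measure (List Bool → 𝒴)
  | 0 => mu.map fun y _ => y
  | n + 1 => (mu.prod ((treeRef mu n).prod (treeRef mu n))).map glue

instance (mu : Measure 𝒴) [SFinite mu] (n : ℕ) : SFinite (treeRef mu n) := by
  induction n with
  | zero => unfold treeRef; infer_instance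
  | succ n ih => unfold treeRef; infer_instance

theorem map_withDensity_comp {α β : Type*} {mα : MeasurableSpace α} {mβ : MeasurableSpace β}
    (μ : Measure α) {φ : α → β} (hφ : Measurable φ) {h : β → ENNReal} (hh : Measurable h) :
    (μ.withDensity (h ∘ φ)).map φ = (μ.map φ).withDensity h := by
  ext s hs
  rw [Measure.map_apply hφ hs, withDensity_apply _ (hφ hs), withDensity_apply _ hs,
    setLIntegral_map hs hh hφ]
  rfl

variable {lam : Measure 𝒳} [IsProbabilityMeasure lam] {q : Θ → 𝒳 → 𝒳 → ℝ} {g : Θ → 𝒳 → 𝒴 → ℝ}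
  {σm σp B : ℝ} [FirstCountableTopology Θ] {mu : Measure 𝒴} [SigmaFinite mu]
  {Q : Θ → Kernel 𝒳 𝒳} [∀ θ, IsMarkovKernel (Q θ)] {G : Θ → Kernel 𝒳 𝒴} [∀ θ, IsMarkovKernel (G θ)]

namespace DensityModel

theorem tame_qInt_lik (hm : DensityModel lam q g σm σp B) (n : ℕ) :
    Tame fun θ c x => qInt lam (q θ) (lik lam (q θ) (g θ) n c) x :=
  hm.tame_qInt (hm.tame_lik n)

theorem withDensity_q (hdom : FullyDominated lam mu Q G q g) (θ : Θ) (x : 𝒳) :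
    Q θ x = lam.withDensity fun x' => ENNReal.ofReal (q θ x x') :=
  Measure.ext fun s hs => by rw [hdom.Q_eq θ x s hs, withDensity_apply _ hs]

theorem withDensity_g (hdom : FullyDominated lam mu Q G q g) (θ : Θ) (x : 𝒳) :
    G θ x = mu.withDensity fun y => ENNReal.ofReal (g θ x y) :=
  Measure.ext fun s hs => by rw [hdom.G_eq θ x s hs, withDensity_apply _ hs]

theorem measurable_of_tame_left {f : Θ → (List Bool → 𝒴) → 𝒳 → ℝ} (hf : Tame f) (θ : Θ) (x : 𝒳) :
    Measurable fun c => ENNReal.ofReal (f θ c x) :=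
  ((hf.meas θ).comp (measurable_id.prodMk measurable_const)).ennreal_ofReal

theorem comp_eq_withDensity (hm : DensityModel lam q g σm σp B)
    (hdom : FullyDominated lam mu Q G q g) (θ : Θ) (n : ℕ)
    (h : ∀ x, treeKernel (Q θ) (G θ) n x = (treeRef mu n).withDensity
      fun c => ENNReal.ofReal (lik lam (q θ) (g θ) (n + 1) c x)) (x : 𝒳) :
    (treeKernel (Q θ) (G θ) n ∘ₖ Q θ) x = (treeRef mu n).withDensity
      fun c => ENNReal.ofReal (qInt lam (q θ) (lik lam (q θ) (g θ) (n + 1) c) x) := by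
  have hL := hm.tame_lik (n + 1)
  obtain ⟨M, hM⟩ := hL.bdd
  have hqm : Measurable fun x' => ENNReal.ofReal (q θ x x') := (hm.q_meas_right θ x).ennreal_ofReal
  have hLm : Measurable fun p : 𝒳 × (List Bool → 𝒴) =>
      ENNReal.ofReal (lik lam (q θ) (g θ) (n + 1) p.2 p.1) :=
    ((hL.meas θ).comp measurable_swap).ennreal_ofReal
  ext s hs
  rw [Kernel.comp_apply' _ _ _ hs, withDensity_q hdom, lintegral_withDensity_eq_lintegral_mul _ hqm
    (Kernel.measurable_coe _ hs), withDensity_apply _ hs]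
  simp only [Pi.mul_apply, h, withDensity_apply _ hs]
  have e : ∀ x', ENNReal.ofReal (q θ x x') *
      ∫⁻ c in s, ENNReal.ofReal (lik lam (q θ) (g θ) (n + 1) c x') ∂(treeRef mu n) =
      ∫⁻ c in s, ENNReal.ofReal (q θ x x') *
        ENNReal.ofReal (lik lam (q θ) (g θ) (n + 1) c x') ∂(treeRef mu n) := fun x' =>
    (lintegral_const_mul _ (hLm.comp (measurable_const.prodMk measurable_id))).symm
  simp only [e]
  rw [lintegral_lintegral_swap ((hqm.comp measurable_fst).mul hLm).aemeasurable]
  refine lintegral_congr fun c => ?_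
  rw [qInt, ofReal_integral_eq_lintegral_ofReal]
  · simp only [ENNReal.ofReal_mul (hm.q_pos θ x _).le]
  · refine hm.integrable_q_mul θ x (hL.measurable_right θ c) (M := M) fun x' => ?_
    rw [abs_of_pos (hL.pos θ c x')]; exact hM θ c x'
  · exact ae_of_all _ fun x' => (mul_pos (hm.q_pos θ x x') (hL.pos θ c x')).le

/-- `treeKernel`, `treeRef` and `lik` follow the same recursion: a root and two copies of the
previous step that are conditionally independent. The shift arises because `treeKernel` at `n`
involves `n + 1` generations, which is the count used by `lik`. -/
theorem treeKernel_eq_withDensity (hm : DensityModel lam q g σm σp B)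
    (hdom : FullyDominated lam mu Q G q g) (θ : Θ) (n : ℕ) (x : 𝒳) :
    treeKernel (Q θ) (G θ) n x = (treeRef mu n).withDensity
      fun c => ENNReal.ofReal (lik lam (q θ) (g θ) (n + 1) c x) := by
  induction n generalizing x with
  | zero =>
    rw [treeKernel, Kernel.map_apply _ measurable_const_config, treeRef,
      ← map_withDensity_comp _ measurable_const_config
        (measurable_of_tame_left (hm.tame_lik 1) θ x), withDensity_g hdom]
    congr 2
    ext y
    have : qInt lam (q θ) (fun _ => 1) x = 1 := hm.qInt_const θ x 1
    simp only [Function.comp_apply, lik, this, mul_one]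
  | succ n ih =>
    have hR := hm.comp_eq_withDensity hdom θ n ih x
    have hRm := measurable_of_tame_left (hm.tame_qInt_lik (n + 1)) θ x
    have hRm2 : Measurable fun p : (List Bool → 𝒴) × (List Bool → 𝒴) =>
        ENNReal.ofReal (qInt lam (q θ) (lik lam (q θ) (g θ) (n + 1) p.1) x) *
          ENNReal.ofReal (qInt lam (q θ) (lik lam (q θ) (g θ) (n + 1) p.2) x) :=
      (hRm.comp measurable_fst).mul (hRm.comp measurable_snd)
    have hgm : Measurable fun y => ENNReal.ofReal (g θ x y) :=
      ((hm.g_meas θ).comp (measurable_const.prodMk measurable_id)).ennreal_ofReal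
    have hf : (fun c => ENNReal.ofReal (lik lam (q θ) (g θ) (n + 1 + 1) c x)) ∘ glue =
        fun p : 𝒴 × _ × _ => ENNReal.ofReal (g θ x p.1) *
          (ENNReal.ofReal (qInt lam (q θ) (lik lam (q θ) (g θ) (n + 1) p.2.1) x) *
          ENNReal.ofReal (qInt lam (q θ) (lik lam (q θ) (g θ) (n + 1) p.2.2) x)) := by
      ext p
      have hp := fun c => ((hm.tame_qInt_lik (n + 1)).pos θ c x).le
      rw [← ENNReal.ofReal_mul (hp _), ← ENNReal.ofReal_mul (hm.g_pos θ x _).le, ← mul_assoc]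
      rfl
    rw [treeKernel_succ_apply, treeRef, ← map_withDensity_comp _ measurable_glue
      (measurable_of_tame_left (hm.tame_lik _) θ x), hf, hR, withDensity_g hdom,
      prod_withDensity hRm hRm, prod_withDensity hgm hRm2]

/-- Positivity of the Kullback-Leibler divergence, in the form in which it is used. -/
theorem integral_nonpos_of_exp_mul_le (hm : DensityModel lam q g σm σp B)
    (hdom : FullyDominated lam mu Q G q g) (θ θ' : Θ) (n : ℕ) {ν : Measure 𝒳}
    [IsProbabilityMeasure ν] (hν : Kernel.Invariant (Q θ') ν) {H : (List Bool → 𝒴) → ℝ}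
    (hH : Measurable H) (hHi : Integrable H (treeKernel (Q θ') (G θ') n ∘ₘ ν))
    (hle : ∀ c x, Real.exp (H c) * qInt lam (q θ') (lik lam (q θ') (g θ') (n + 1) c) x ≤
      qInt lam (q θ) (lik lam (q θ) (g θ) (n + 1) c) x) :
    ∫ c, H c ∂(treeKernel (Q θ') (G θ') n ∘ₘ ν) ≤ 0 := by
  have hEm : Measurable fun c => ENNReal.ofReal (Real.exp (H c)) :=
    (Real.measurable_exp.comp hH).ennreal_ofReal
  -- Both densities are taken given the same state `x` of the parent of the root, so no relation
  -- between `ν` and `Q θ` is needed: the integral of `exp H` is at most the total mass of the law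
  -- under `θ`.
  have h₁ : ∀ x, ∫⁻ c, ENNReal.ofReal (Real.exp (H c)) ∂(treeKernel (Q θ') (G θ') n ∘ₖ Q θ') x
      ≤ 1 := by
    intro x
    rw [hm.comp_eq_withDensity hdom θ' n (hm.treeKernel_eq_withDensity hdom θ' n),
      lintegral_withDensity_eq_lintegral_mul _
        (measurable_of_tame_left (hm.tame_qInt_lik _) θ' x) hEm]
    calc _ ≤ ∫⁻ c, ENNReal.ofReal (qInt lam (q θ) (lik lam (q θ) (g θ) (n + 1) c) x)
          ∂(treeRef mu n) := by
          refine lintegral_mono fun c => ?_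
          rw [Pi.mul_apply, ← ENNReal.ofReal_mul ((hm.tame_qInt_lik _).pos θ' c x).le, mul_comm]
          exact ENNReal.ofReal_le_ofReal (hle c x)
      _ = (treeKernel (Q θ) (G θ) n ∘ₖ Q θ) x Set.univ := by
          rw [hm.comp_eq_withDensity hdom θ n (hm.treeKernel_eq_withDensity hdom θ n),
            withDensity_apply _ MeasurableSet.univ, setLIntegral_univ]
      _ = 1 := measure_univ
  have h₂ : ∫⁻ c, ENNReal.ofReal (Real.exp (H c)) ∂(treeKernel (Q θ') (G θ') n ∘ₘ ν) ≤ 1 := by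
    have e : (treeKernel (Q θ') (G θ') n ∘ₖ Q θ') ∘ₘ ν = treeKernel (Q θ') (G θ') n ∘ₘ ν := by
      rw [← Measure.comp_assoc]; congr 1
    rw [← e, Measure.lintegral_bind (Kernel.aemeasurable _) hEm.aemeasurable]
    exact (lintegral_mono h₁).trans (by simp)
  have hEi : Integrable (fun c => Real.exp (H c)) (treeKernel (Q θ') (G θ') n ∘ₘ ν) := by
    refine ⟨(Real.measurable_exp.comp hH).aestronglyMeasurable, ?_⟩
    rw [hasFiniteIntegral_iff_ofReal (ae_of_all _ fun c => (Real.exp_pos _).le)]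
    exact h₂.trans_lt ENNReal.one_lt_top
  have h₃ : ∫ c, Real.exp (H c) ∂(treeKernel (Q θ') (G θ') n ∘ₘ ν) ≤ 1 := by
    rw [integral_eq_lintegral_of_nonneg_ae (ae_of_all _ fun c => (Real.exp_pos _).le)
      hEi.aestronglyMeasurable]
    exact ENNReal.toReal_le_of_le_ofReal zero_le_one (by simpa using h₂)
  -- The inequality `t ≤ exp t - 1` plays the part of Jensen's inequality.
  have h₄ : ∫ c, H c ∂(treeKernel (Q θ') (G θ') n ∘ₘ ν) ≤
      ∫ c, (Real.exp (H c) - 1) ∂(treeKernel (Q θ') (G θ') n ∘ₘ ν) :=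
    integral_mono hHi (hEi.sub (integrable_const 1)) fun c => by
      have := Real.add_one_le_exp (H c)
      simp only; linarith
  rw [integral_sub hEi (integrable_const 1)] at h₄
  simp only [integral_const, probReal_univ, smul_eq_mul, mul_one] at h₄
  linarith

end DensityModel

end Density

namespace ExtTree

/-! ### Words and vertices of the extended tree -/

/-- The left or right child of a vertex, for the plane embedding determined by `U`. -/
def child (U : ℕ → Bool) : ExtTree → Bool → ExtTree
  | main s, b => main (b :: s)
  | spine 0, b => if b = U 0 then main [] else graft 0 []
  | spine (j + 1), b => if b = U (j + 1) then spine j else graft (j + 1) []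
  | graft j s, b => graft j (b :: s)

theorem parent_child (U : ℕ → Bool) (v : ExtTree) (b : Bool) : parent (child U v b) = v := by
  rcases v with s | (_ | j) | ⟨j, s⟩ <;> simp only [child, parent] <;> split_ifs <;> rfl

theorem label_child (U : ℕ → Bool) (v : ExtTree) (b : Bool) : label U (child U v b) = b := by
  rcases v with s | (_ | j) | ⟨j, s⟩ <;> simp only [child, label] <;> split_ifs with h <;>
    cases b <;> simp_all

theorem child_parent_label (U : ℕ → Bool) (v : ExtTree) :
    child U (parent v) (label U v) = v := by
  rcases v with (_ | ⟨b, s⟩) | j | ⟨(_ | j), (_ | ⟨b, s⟩)⟩ <;> simp [child, parent, label]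

theorem parent_eq_iff (U : ℕ → Bool) (v w : ExtTree) :
    parent w = v ↔ w = child U v false ∨ w = child U v true := by
  constructor
  · rintro rfl
    have := child_parent_label U w
    cases h : label U w <;> rw [h] at this
    · exact Or.inl this.symm
    · exact Or.inr this.symm
  · rintro (rfl | rfl) <;> exact parent_child _ _ _

theorem child_injective (U : ℕ → Bool) (v : ExtTree) : Function.Injective (child U v) :=
  fun b b' h => by rw [← label_child U v b, h, label_child]

theorem children_eq (U : ℕ → Bool) (v : ExtTree) :
    children v = {child U v false, child U v true} := by
  ext w
  rw [mem_children, parent_eq_iff U]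
  simp

/-- The vertex reached from `v` along a word. -/
def desc (U : ℕ → Bool) : ExtTree → List Bool → ExtTree
  | v, [] => v
  | v, b :: s => desc U (child U v b) s

theorem parent_iterate_desc (U : ℕ → Bool) (v : ExtTree) (s : List Bool) :
    parent^[s.length] (desc U v s) = v := by
  induction s generalizing v with
  | nil => rfl
  | cons b s ih => rw [List.length_cons, Function.iterate_succ_apply', desc, ih, parent_child]

theorem height_desc (U : ℕ → Bool) (v : ExtTree) (s : List Bool) :
    (desc U v s).height = v.height + s.length := by
  have := height_parent_iterate (desc U v s) s.length
  rw [parent_iterate_desc] at this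
  omega

theorem height_child (U : ℕ → Bool) (v : ExtTree) (b : Bool) :
    (child U v b).height = v.height + 1 := by
  have := height_parent (child U v b)
  rw [parent_child] at this
  omega

/-! ### Breadth-first pasts, described recursively -/

/-- The first `n` generations of the descendants of `v`. -/
def fullSet (U : ℕ → Bool) : ℕ → ExtTree → Finset ExtTree
  | 0, _ => ∅
  | n + 1, v => insert v (fullSet U n (child U v false) ∪ fullSet U n (child U v true))

/-- The descendants of `v` which precede the vertex reached from `v` along the given word, with
that vertex included if and only if `e` is true. -/
def pastSet (U : ℕ → Bool) (e : Bool) : List Bool → ExtTree → Finset ExtTree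
  | [], v => if e then {v} else ∅
  | b :: s, v => insert v (pastSet U e s (child U v b) ∪
      fullSet U (s.length + b.toNat) (child U v (!b)))

theorem iterate_succ_eq_iff (U : ℕ → Bool) (v w : ExtTree) (i : ℕ) :
    parent^[i + 1] w = v ↔ ∃ b, parent^[i] w = child U v b := by
  rw [Function.iterate_succ_apply', parent_eq_iff U]
  simp

theorem mem_fullSet {U : ℕ → Bool} {n : ℕ} {u v : ExtTree} :
    u ∈ fullSet U n v ↔ ∃ i < n, parent^[i] u = v := by
  induction n generalizing v with
  | zero => simp [fullSet]
  | succ n ih =>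
    simp only [fullSet, Finset.mem_insert, Finset.mem_union, ih]
    constructor
    · rintro (rfl | ⟨i, hi, h⟩ | ⟨i, hi, h⟩)
      · exact ⟨0, by omega, rfl⟩
      · exact ⟨i + 1, by omega, (iterate_succ_eq_iff U _ _ _).2 ⟨_, h⟩⟩
      · exact ⟨i + 1, by omega, (iterate_succ_eq_iff U _ _ _).2 ⟨_, h⟩⟩
    · rintro ⟨_ | i, hi, h⟩
      · exact Or.inl h
      · obtain ⟨_ | _, hb⟩ := (iterate_succ_eq_iff U _ _ _).1 h
        · exact Or.inr (Or.inl ⟨i, by omega, hb⟩)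
        · exact Or.inr (Or.inr ⟨i, by omega, hb⟩)

theorem T_eq_fullSet (U : ℕ → Bool) (n : ℕ) : T n = fullSet U (n + 1) root := by
  ext v
  simp only [T, mem_subtree, mem_fullSet, Nat.lt_succ_iff]

/-- A vertex cannot descend from both children of a vertex. -/
theorem not_iterate_children {U : ℕ → Bool} {u v : ExtTree} {i j : ℕ} {b : Bool}
    (hi : parent^[i] u = child U v b) (hj : parent^[j] u = child U v !b) : False := by
  have h₁ := congrArg height hi
  have h₂ := congrArg height hj
  rw [height_parent_iterate, height_child] at h₁ h₂
  have : i = j := by omega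
  subst this
  have := child_injective U v (hi.symm.trans hj)
  cases b <;> simp at this

theorem not_iterate_self_child {U : ℕ → Bool} {v : ExtTree} {i : ℕ} {b : Bool}
    (hi : parent^[i] v = child U v b) : False := by
  have h₁ := congrArg height hi
  rw [height_parent_iterate, height_child] at h₁
  omega

theorem parent_iterate_of_mem_pastSet {U : ℕ → Bool} {e : Bool} {s : List Bool} {u v : ExtTree}
    (h : u ∈ pastSet U e s v) : ∃ i, parent^[i] u = v := by
  induction s generalizing v with
  | nil =>
    cases e <;> simp [pastSet] at h
    exact ⟨0, h⟩
  | cons b s ih =>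
    simp only [pastSet, Finset.mem_insert, Finset.mem_union] at h
    rcases h with rfl | h | h
    · exact ⟨0, rfl⟩
    · obtain ⟨i, hi⟩ := ih h
      exact ⟨i + 1, (iterate_succ_eq_iff U _ _ _).2 ⟨_, hi⟩⟩
    · obtain ⟨i, -, hi⟩ := mem_fullSet.1 h
      exact ⟨i + 1, (iterate_succ_eq_iff U _ _ _).2 ⟨_, hi⟩⟩

/-- Lower heights always precede. Equal height, that is `i = s.length`, precedes only from a left
sibling subtree, that is when `b = true`; hence the bound `s.length + b.toNat`. -/
theorem lt_desc_iff {U : ℕ → Bool} {u v : ExtTree} {b : Bool} {s : List Bool} {i : ℕ}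
    (hi : parent^[i] u = child U v !b) :
    lt U u (desc U v (b :: s)) ↔ i < s.length + b.toNat := by
  have hu := congrArg height hi
  rw [height_parent_iterate, height_child] at hu
  have ht := height_desc U v (b :: s)
  have hp : parent^[s.length] (desc U v (b :: s)) = child U v b := parent_iterate_desc U _ s
  simp only [List.length_cons] at ht
  generalize desc U v (b :: s) = t at ht hp
  constructor
  · rintro (h | ⟨h, j, hj, h₁, h₂⟩)
    · have : i < s.length := by push_cast at ht; omega
      omega
    · have his : i = s.length := by push_cast at ht; omega
      subst his
      -- The paths to `u` and to the target separate exactly at `v`. Meeting strictly below `v`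
      -- would identify its two children; above `v` the paths coincide and cannot carry different
      -- labels.
      rcases lt_trichotomy j s.length with hjs | rfl | hjs
      · exfalso
        obtain ⟨m, hm⟩ : ∃ m, s.length = m + (j + 1) := ⟨s.length - (j + 1), by omega⟩
        rw [hm, Function.iterate_add_apply, hj, ← Function.iterate_add_apply, ← hm, hp] at hi
        have := child_injective U v hi
        cases b <;> simp at this
      · rw [hi, label_child] at h₁
        cases b <;> simp_all
      · exfalso
        obtain ⟨m, rfl⟩ : ∃ m, j = m + (s.length + 1) :=
          ⟨j - (s.length + 1), by omega⟩
        rw [Function.iterate_add_apply, Function.iterate_succ_apply', hi, parent_child] at h₁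
        rw [Function.iterate_add_apply, Function.iterate_succ_apply', hp, parent_child, h₁] at h₂
        simp at h₂
  · intro h
    rcases lt_or_ge i s.length with his | his
    · left; push_cast at ht; omega
    · cases b
      · simp at h; omega
      · have his' : i = s.length := by simp at h; omega
        subst his'
        refine Or.inr ⟨by push_cast at ht; omega, s.length, ?_, ?_, ?_⟩
        · rw [Function.iterate_succ_apply', Function.iterate_succ_apply', hi, hp, parent_child,
            parent_child]
        · rw [hi, label_child]; rfl
        · rw [hp, label_child]

/-- The bridge from the order-theoretic past to the recursive one on which `pastLik` is modelled. -/
theorem mem_pastSet_false {U : ℕ → Bool} {s : List Bool} {u v : ExtTree} :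
    u ∈ pastSet U false s v ↔ (∃ i, parent^[i] u = v) ∧ lt U u (desc U v s) := by
  induction s generalizing v with
  | nil =>
    simp only [pastSet, Bool.false_eq_true, if_false, Finset.notMem_empty, desc, false_iff,
      not_and]
    rintro ⟨i, rfl⟩ h
    have hh := height_parent_iterate u i
    rcases h with h | ⟨h, j, -, h₁, h₂⟩
    · omega
    · have : i = 0 := by omega
      subst this
      rw [Function.iterate_zero, id] at h₂
      rw [h₁] at h₂
      simp at h₂
  | cons b s ih =>
    have hv : lt U v (desc U v (b :: s)) := Or.inl (by rw [height_desc]; simp)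
    simp only [pastSet, Finset.mem_insert, Finset.mem_union, ih]
    constructor
    · rintro (rfl | ⟨⟨i, hi⟩, h⟩ | h)
      · exact ⟨⟨0, rfl⟩, hv⟩
      · exact ⟨⟨i + 1, (iterate_succ_eq_iff U _ _ _).2 ⟨_, hi⟩⟩, h⟩
      · obtain ⟨i, hi, h⟩ := mem_fullSet.1 h
        exact ⟨⟨i + 1, (iterate_succ_eq_iff U _ _ _).2 ⟨_, h⟩⟩, (lt_desc_iff h).2 hi⟩
    · rintro ⟨⟨_ | i, hi⟩, h⟩
      · exact Or.inl hi
      · obtain ⟨b', hb'⟩ := (iterate_succ_eq_iff U _ _ _).1 hi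
        by_cases hbb : b' = b
        · subst hbb
          exact Or.inr (Or.inl ⟨⟨i, hb'⟩, h⟩)
        · have : b' = !b := by cases b <;> cases b' <;> simp_all
          subst this
          exact Or.inr (Or.inr (mem_fullSet.2 ⟨i, (lt_desc_iff hb').1 h, hb'⟩))

theorem pastSet_true (U : ℕ → Bool) (s : List Bool) (v : ExtTree) :
    pastSet U true s v = insert (desc U v s) (pastSet U false s v) := by
  induction s generalizing v with
  | nil => simp [pastSet, desc]
  | cons b s ih => simp only [pastSet, ih, desc, Finset.insert_union, Finset.insert_comm]

/-- The word leading from the `k`-th ancestor of the root to the root. -/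
def spineWord (U : ℕ → Bool) : ℕ → List Bool
  | 0 => []
  | k + 1 => U k :: spineWord U k

theorem length_spineWord (U : ℕ → Bool) (k : ℕ) : (spineWord U k).length = k := by
  induction k with
  | zero => rfl
  | succ k ih => rw [spineWord, List.length_cons, ih]

theorem parent_iterate_root_succ (k : ℕ) : parent^[k + 1] root = spine k := by
  induction k with
  | zero => rfl
  | succ k ih => rw [Function.iterate_succ_apply', ih]; rfl

theorem child_parent_iterate_root (U : ℕ → Bool) (k : ℕ) :
    child U (parent^[k + 1] root) (U k) = parent^[k] root := by
  rw [Function.iterate_succ_apply']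
  convert child_parent_label U (parent^[k] root)
  rcases k with _ | k
  · rfl
  · rw [parent_iterate_root_succ]; rfl

theorem desc_spineWord (U : ℕ → Bool) (k : ℕ) :
    desc U (parent^[k] root) (spineWord U k) = root := by
  induction k with
  | zero => rfl
  | succ k ih => rw [spineWord, desc, child_parent_iterate_root, ih]

theorem pastStrict_root (U : ℕ → Bool) (k : ℕ) :
    pastStrict U root k = pastSet U false (spineWord U k) (parent^[k] root) := by
  ext v
  rw [mem_pastStrict, mem_pastSet_false, desc_spineWord]

theorem past_root (U : ℕ → Bool) (k : ℕ) :
    past U root k = pastSet U true (spineWord U k) (parent^[k] root) := by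
  rw [past, pastStrict_root, pastSet_true, desc_spineWord]

end ExtTree

open ExtTree

/-! ### Conditional densities, computed recursively -/

section CondDensity

variable {𝒳 𝒴 : Type*} [MeasurableSpace 𝒳] [MeasurableSpace 𝒴]
  {lam : Measure 𝒳} [IsProbabilityMeasure lam]

theorem lmarginal_mul_left {f h : (ExtTree → 𝒳) → ENNReal} {E : Finset ExtTree}
    {a : ExtTree → 𝒳} (hh : Measurable h) (hf : ∀ z, f (Function.updateFinset a E z) = f a) :
    (∫⋯∫⁻_E, (fun z => f z * h z) ∂fun _ => lam) a = f a * (∫⋯∫⁻_E, h ∂fun _ => lam) a := by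
  simp only [lmarginal, hf]
  exact lintegral_const_mul _ (hh.comp measurable_updateFinset)

/-- The integrand of the conditional density. -/
def treeProd (q : 𝒳 → 𝒳 → ℝ) (g : 𝒳 → 𝒴 → ℝ) (y : ExtTree → 𝒴) (E : Finset ExtTree)
    (z : ExtTree → 𝒳) : ENNReal :=
  ∏ v ∈ E, (ENNReal.ofReal (q (z (parent v)) (z v)) * ENNReal.ofReal (g (z v) (y v)))

/-- The integral of `treeProd` over the hidden states of the vertices of `E`. -/
def treeInt (lam : Measure 𝒳) (q : 𝒳 → 𝒳 → ℝ) (g : 𝒳 → 𝒴 → ℝ) (y : ExtTree → 𝒴)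
    (E : Finset ExtTree) : (ExtTree → 𝒳) → ENNReal :=
  ∫⋯∫⁻_E, treeProd q g y E ∂fun _ => lam

variable {q : 𝒳 → 𝒳 → ℝ} {g : 𝒳 → 𝒴 → ℝ} (hq : Measurable fun p : 𝒳 × 𝒳 => q p.1 p.2)
  (hg : Measurable fun p : 𝒳 × 𝒴 => g p.1 p.2) (y : ExtTree → 𝒴)

include hq hg

theorem measurable_treeProd (E : Finset ExtTree) : Measurable (treeProd q g y E) := by
  refine Finset.measurable_fun_prod _ fun v _ => ?_
  have h₁ : Measurable fun z : ExtTree → 𝒳 => q (z (parent v)) (z v) :=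
    hq.comp (by fun_prop : Measurable fun z : ExtTree → 𝒳 => (z (parent v), z v))
  have h₂ : Measurable fun z : ExtTree → 𝒳 => g (z v) (y v) :=
    hg.comp (by fun_prop : Measurable fun z : ExtTree → 𝒳 => (z v, y v))
  exact h₁.ennreal_ofReal.mul h₂.ennreal_ofReal

theorem treeProd_congr {E : Finset ExtTree} {z z' : ExtTree → 𝒳} (h : ∀ v ∈ E, z v = z' v)
    (h' : ∀ v ∈ E, z (parent v) = z' (parent v)) : treeProd q g y E z = treeProd q g y E z' :=
  Finset.prod_congr rfl fun v hv => by rw [h v hv, h' v hv]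

theorem treeInt_congr {E : Finset ExtTree} {a a' : ExtTree → 𝒳}
    (h : ∀ v ∈ E, parent v ∉ E → a (parent v) = a' (parent v)) :
    treeInt lam q g y E a = treeInt lam q g y E a' := by
  refine lintegral_congr fun z => treeProd_congr hq hg y (fun v hv => ?_) fun v hv => ?_
  · simp [Function.updateFinset, hv]
  · by_cases hp : parent v ∈ E
    · simp [Function.updateFinset, hp]
    · simp [Function.updateFinset, hp, h v hv hp]

/-- No edge joins the two sets, so each integrand is constant in the hidden states of the other set
and the integral factorizes. -/
theorem treeInt_union {E₀ E₁ : Finset ExtTree} (hd : Disjoint E₀ E₁)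
    (h₀ : ∀ v ∈ E₀, parent v ∉ E₁) (h₁ : ∀ v ∈ E₁, parent v ∉ E₀) (a : ExtTree → 𝒳) :
    treeInt lam q g y (E₀ ∪ E₁) a = treeInt lam q g y E₀ a * treeInt lam q g y E₁ a := by
  have hp : treeProd q g y (E₀ ∪ E₁) = fun z => treeProd q g y E₀ z * treeProd q g y E₁ z :=
    funext fun z => Finset.prod_union hd
  have h₂ : (∫⋯∫⁻_E₁, (fun z => treeProd q g y E₀ z * treeProd q g y E₁ z) ∂fun _ => lam) =
      fun b => treeInt lam q g y E₁ b * treeProd q g y E₀ b := by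
    ext b
    rw [lmarginal_mul_left (measurable_treeProd hq hg y _), mul_comm]
    · rfl
    · intro z
      refine treeProd_congr hq hg y (fun v hv => ?_) fun v hv => ?_
      · simp [Function.updateFinset, Finset.disjoint_left.1 hd hv]
      · simp [Function.updateFinset, h₀ v hv]
  have hmul : Measurable fun z => treeProd q g y E₀ z * treeProd q g y E₁ z :=
    (measurable_treeProd hq hg y _).mul (measurable_treeProd hq hg y _)
  rw [treeInt, hp, lmarginal_union _ _ hmul hd, h₂, lmarginal_mul_left (measurable_treeProd hq hg y _),
    mul_comm]
  · rfl
  · intro z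
    refine treeInt_congr hq hg y fun v hv _ => ?_
    simp [Function.updateFinset, h₁ v hv]

theorem treeInt_insert {c : ExtTree} {E : Finset ExtTree} (hc : c ∉ E) (hp : parent c ∉ E)
    (a : ExtTree → 𝒳) :
    treeInt lam q g y (insert c E) a = ∫⁻ x', ENNReal.ofReal (q (a (parent c)) x') *
      (ENNReal.ofReal (g x' (y c)) * treeInt lam q g y E (Function.update a c x')) ∂lam := by
  have hpc : parent c ≠ c := fun h => by
    have := height_parent c
    rw [h] at this; omega
  have hpr : treeProd q g y (insert c E) = fun z =>
      (ENNReal.ofReal (q (z (parent c)) (z c)) * ENNReal.ofReal (g (z c) (y c))) *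
        treeProd q g y E z := funext fun z => Finset.prod_insert hc
  rw [treeInt, lmarginal_insert _ (measurable_treeProd hq hg y _) hc, hpr]
  refine lintegral_congr fun x' => ?_
  rw [lmarginal_mul_left (measurable_treeProd hq hg y _)]
  · simp [hpc, mul_assoc, treeInt]
  · intro z
    simp [Function.updateFinset, hc, hp]

theorem condDensity_eq (hq0 : ∀ x x', 0 ≤ q x x') (hg0 : ∀ x y, 0 ≤ g x y)
    {Δ : Finset ExtTree} (hΔ : Δ.Nonempty) (w : ExtTree) (x : 𝒳) :
    condDensity lam q g Δ w x y = (ENNReal.ofReal (g x (y w)) *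
      treeInt lam q g y (Δ.erase w) fun _ => x).toReal := by
  rw [condDensity, if_neg hΔ.ne_empty, ENNReal.toReal_mul, ENNReal.toReal_ofReal (hg0 _ _)]
  congr 1
  -- Filling with the constant `x` outside `Δ.erase w` gives the root, as a parent, the state `x`.
  have e : ∀ z, hiddenAt Δ w x z = Function.updateFinset (fun _ => x) (Δ.erase w) z :=
    fun z => rfl
  have e' : ∀ (z : Δ.erase w → 𝒳) (v : Δ.erase w), z v = hiddenAt Δ w x z v := fun z v => by
    rw [hiddenAt, dif_pos v.2]
  have hz : Measurable fun z : Δ.erase w → 𝒳 => hiddenAt Δ w x z := by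
    simp only [e]; exact measurable_updateFinset
  rw [integral_eq_lintegral_of_nonneg_ae]
  · congr 1
    refine lintegral_congr fun z => ?_
    rw [ENNReal.ofReal_prod_of_nonneg fun v _ => mul_nonneg (hq0 _ _) (hg0 _ _), treeProd]
    refine Eq.trans (Finset.prod_congr rfl fun v _ => ?_) (Finset.prod_coe_sort (Δ.erase w) _)
    rw [ENNReal.ofReal_mul (hq0 _ _), ← e, ← e']
  · exact ae_of_all _ fun z => Finset.prod_nonneg fun v _ => mul_nonneg (hq0 _ _) (hg0 _ _)
  · refine (Finset.measurable_fun_prod _ fun v _ => ?_).aestronglyMeasurable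
    have h₁ : Measurable fun z : Δ.erase w → 𝒳 => (hiddenAt Δ w x z (parent v), z v) :=
      ((measurable_pi_apply _).comp hz).prodMk (measurable_pi_apply v)
    have h₂ : Measurable fun z : Δ.erase w → 𝒳 => (z v, y v) := by fun_prop
    exact (hq.comp h₁).mul (hg.comp h₂)

end CondDensity

section Recursion

variable {Θ 𝒳 𝒴 : Type*} [MeasurableSpace 𝒳] [MeasurableSpace 𝒴] [TopologicalSpace Θ]
  [FirstCountableTopology Θ] {lam : Measure 𝒳} [IsProbabilityMeasure lam] {q : Θ → 𝒳 → 𝒳 → ℝ}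
  {g : Θ → 𝒳 → 𝒴 → ℝ} {σm σp B : ℝ} (hm : DensityModel lam q g σm σp B) (θ : Θ)

/-- The configuration of `y` on the tree of the descendants of `v`. -/
def config (U : ℕ → Bool) (y : ExtTree → 𝒴) (v : ExtTree) : List Bool → 𝒴 := fun s => y (desc U v s)

theorem sub_config (U : ℕ → Bool) (y : ExtTree → 𝒴) (v : ExtTree) (b : Bool) :
    sub b (config U y v) = config U y (child U v b) := rfl

include hm

/-- Passing from the subtrees of the two children to the tree without its root. -/
theorem treeInt_children (U : ℕ → Bool) (y : ExtTree → 𝒴) {v : ExtTree} {b : Bool}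
    {E E' : Finset ExtTree} (hE : ∀ u ∈ E, ∃ i, parent^[i] u = child U v b)
    (hE' : ∀ u ∈ E', ∃ i, parent^[i] u = child U v (!b)) (a : ExtTree → 𝒳) :
    treeInt lam (q θ) (g θ) y ((insert v (E ∪ E')).erase v) a =
      treeInt lam (q θ) (g θ) y E a * treeInt lam (q θ) (g θ) y E' a := by
  have hv : v ∉ E ∪ E' := by
    intro h
    rcases Finset.mem_union.1 h with h | h
    · obtain ⟨i, hi⟩ := hE v h; exact not_iterate_self_child hi
    · obtain ⟨i, hi⟩ := hE' v h; exact not_iterate_self_child hi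
  rw [Finset.erase_insert hv, treeInt_union (hm.q_meas θ) (hm.g_meas θ) y]
  · refine Finset.disjoint_left.2 fun u hu hu' => ?_
    obtain ⟨i, hi⟩ := hE u hu
    obtain ⟨j, hj⟩ := hE' u hu'
    exact not_iterate_children hi hj
  · intro u hu hu'
    obtain ⟨i, hi⟩ := hE u hu
    obtain ⟨j, hj⟩ := hE' _ hu'
    exact not_iterate_children (j := j + 1) hi hj
  · intro u hu hu'
    obtain ⟨i, hi⟩ := hE' u hu
    obtain ⟨j, hj⟩ := hE _ hu'
    exact not_iterate_children (i := j + 1) hj hi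

/-- Integration over the hidden state of the root of a subtree. -/
theorem treeInt_eq_qInt {y : ExtTree → 𝒴} {v : ExtTree} {E : Finset ExtTree}
    (hv : v ∈ E) (hE : ∀ u ∈ E, ∃ i, parent^[i] u = v) {f : Θ → (List Bool → 𝒴) → 𝒳 → ℝ}
    (hf : Tame f) (c : List Bool → 𝒴)
    (h : ∀ a : ExtTree → 𝒳, ENNReal.ofReal (g θ (a v) (y v)) *
      treeInt lam (q θ) (g θ) y (E.erase v) a = ENNReal.ofReal (f θ c (a v))) (a : ExtTree → 𝒳) :
    treeInt lam (q θ) (g θ) y E a =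
      ENNReal.ofReal (qInt lam (q θ) (f θ c) (a (parent v))) := by
  have hp : parent v ∉ E.erase v := fun hp => by
    obtain ⟨i, hi⟩ := hE _ (Finset.mem_of_mem_erase hp)
    have := congrArg height hi
    rw [height_parent_iterate, height_parent] at this
    omega
  obtain ⟨M, hM⟩ := hf.bdd
  conv_lhs => rw [← Finset.insert_erase hv]
  rw [treeInt_insert (hm.q_meas θ) (hm.g_meas θ) y (Finset.notMem_erase _ _) hp, qInt,
    ofReal_integral_eq_lintegral_ofReal]
  · refine lintegral_congr fun x' => ?_
    have := h (Function.update a v x')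
    rw [Function.update_self] at this
    rw [this, ENNReal.ofReal_mul (hm.q_pos θ _ _).le]
  · refine hm.integrable_q_mul θ _ (hf.measurable_right θ c) (M := M) fun x' => ?_
    rw [abs_of_pos (hf.pos θ c x')]; exact hM θ c x'
  · exact ae_of_all _ fun x' => (mul_pos (hm.q_pos θ _ x') (hf.pos θ c x')).le

theorem treeInt_empty (y : ExtTree → 𝒴) (a : ExtTree → 𝒳) :
    treeInt lam (q θ) (g θ) y ∅ a = 1 := by
  rw [treeInt, lmarginal_empty, treeProd, Finset.prod_empty]

/-- Two forms of one recursion, proved together: the integral over `n` full generations gives the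
integrand with the hidden state at the top vertex of `n + 1` generations still fixed, and
integrating this state gives the next full integral. -/
theorem treeInt_fullSet (U : ℕ → Bool) (y : ExtTree → 𝒴) (n : ℕ) (v : ExtTree)
    (a : ExtTree → 𝒳) :
    (treeInt lam (q θ) (g θ) y (fullSet U n v) a = ENNReal.ofReal
      (qInt lam (q θ) (lik lam (q θ) (g θ) n (config U y v)) (a (parent v)))) ∧
    ENNReal.ofReal (g θ (a v) (y v)) *
      treeInt lam (q θ) (g θ) y ((fullSet U (n + 1) v).erase v) a =
        ENNReal.ofReal (lik lam (q θ) (g θ) (n + 1) (config U y v) (a v)) := by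
  have key : ∀ n, (∀ v a, treeInt lam (q θ) (g θ) y (fullSet U n v) a = ENNReal.ofReal
      (qInt lam (q θ) (lik lam (q θ) (g θ) n (config U y v)) (a (parent v)))) →
      ∀ v a, ENNReal.ofReal (g θ (a v) (y v)) *
        treeInt lam (q θ) (g θ) y ((fullSet U (n + 1) v).erase v) a =
        ENNReal.ofReal (lik lam (q θ) (g θ) (n + 1) (config U y v) (a v)) := by
    intro n ih v a
    have hE : ∀ b, ∀ u ∈ fullSet U n (child U v b), ∃ i, parent^[i] u = child U v b :=
      fun b u hu => by obtain ⟨i, -, hi⟩ := mem_fullSet.1 hu; exact ⟨i, hi⟩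
    have hp := fun c x => ((hm.tame_qInt_lik n).pos θ c x).le
    rw [fullSet, treeInt_children hm θ U y (hE false) (hE true), ih, ih, parent_child,
      parent_child, lik, ← ENNReal.ofReal_mul (hp _ _), ← ENNReal.ofReal_mul (hm.g_pos θ _ _).le,
      ← mul_assoc]
    rfl
  have main : ∀ n, (∀ v a, treeInt lam (q θ) (g θ) y (fullSet U n v) a = ENNReal.ofReal
      (qInt lam (q θ) (lik lam (q θ) (g θ) n (config U y v)) (a (parent v)))) := by
    intro n
    induction n with
    | zero =>
      intro v a
      have : qInt lam (q θ) (lik lam (q θ) (g θ) 0 (config U y v)) (a (parent v)) = 1 :=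
        hm.qInt_const θ _ 1
      rw [this, fullSet, treeInt_empty hm, ENNReal.ofReal_one]
    | succ n ih =>
      intro v a
      exact treeInt_eq_qInt hm θ (E := fullSet U (n + 1) v) (Finset.mem_insert_self _ _)
        (fun u hu => by obtain ⟨i, -, hi⟩ := mem_fullSet.1 hu; exact ⟨i, hi⟩)
        (hm.tame_lik (n + 1)) _ (key n ih v) a
  exact ⟨main n v a, key n (main n) v a⟩

/-- The root factor of `pastLik` attached to `pastSet U e`. -/
def baseFactor (g : 𝒳 → 𝒴 → ℝ) (e : Bool) : 𝒳 → 𝒴 → ℝ := if e then g else fun _ _ => 1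

theorem tame_baseFactor (e : Bool) :
    Tame fun θ (c : List Bool → 𝒴) x => baseFactor (g θ) e x (c []) := by
  cases e
  · exact Tame.one
  · exact hm.tame_g

theorem treeInt_pastSet_erase {U : ℕ → Bool} {y : ExtTree → 𝒴} {e : Bool} {s : List Bool}
    (ih : ∀ v (a : ExtTree → 𝒳), treeInt lam (q θ) (g θ) y (pastSet U e s v) a = ENNReal.ofReal
      (qInt lam (q θ) (pastLik lam (q θ) (g θ) (baseFactor (g θ) e) s (config U y v))
        (a (parent v)))) (b : Bool) (v : ExtTree) (a : ExtTree → 𝒳) :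
    ENNReal.ofReal (g θ (a v) (y v)) *
      treeInt lam (q θ) (g θ) y ((pastSet U e (b :: s) v).erase v) a =
      ENNReal.ofReal (pastLik lam (q θ) (g θ) (baseFactor (g θ) e) (b :: s) (config U y v)
        (a v)) := by
  have hp := fun c x => ((hm.tame_qInt (hm.tame_pastLik (f₀ := fun θ => baseFactor (g θ) e)
    (tame_baseFactor hm e) s)).pos θ c x).le
  rw [pastSet, treeInt_children hm θ U y (b := b) (fun u hu => parent_iterate_of_mem_pastSet hu)
    (fun u hu => by obtain ⟨i, -, hi⟩ := mem_fullSet.1 hu; exact ⟨i, hi⟩), ih,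
    (treeInt_fullSet hm θ U y _ _ a).1, parent_child, parent_child, pastLik,
    ← ENNReal.ofReal_mul (hp _ _), ← ENNReal.ofReal_mul (hm.g_pos θ _ _).le, ← mul_assoc]
  rfl

theorem treeInt_pastSet (U : ℕ → Bool) (y : ExtTree → 𝒴) (e : Bool) (s : List Bool) (v : ExtTree)
    (a : ExtTree → 𝒳) :
    treeInt lam (q θ) (g θ) y (pastSet U e s v) a = ENNReal.ofReal
      (qInt lam (q θ) (pastLik lam (q θ) (g θ) (baseFactor (g θ) e) s (config U y v))
        (a (parent v))) := by
  induction s generalizing v a with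
  | nil =>
    cases e
    · have : qInt lam (q θ) (pastLik lam (q θ) (g θ) (baseFactor (g θ) false) []
        (config U y v)) (a (parent v)) = 1 := hm.qInt_const θ _ 1
      rw [this, ENNReal.ofReal_one]
      exact treeInt_empty hm θ y a
    · refine treeInt_eq_qInt hm θ (by simp [pastSet])
        (fun u hu => parent_iterate_of_mem_pastSet hu)
        (hm.tame_pastLik (f₀ := fun θ => baseFactor (g θ) true) (tame_baseFactor hm true) []) _
        (fun a => ?_) a
      have : (pastSet U true [] v).erase v = ∅ := by simp [pastSet]
      rw [this, treeInt_empty hm, mul_one]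
      rfl
  | cons b s ih =>
    exact treeInt_eq_qInt hm θ (E := pastSet U e (b :: s) v) (Finset.mem_insert_self _ _)
      (fun u hu => parent_iterate_of_mem_pastSet hu)
      (hm.tame_pastLik (f₀ := fun θ => baseFactor (g θ) e) (tame_baseFactor hm e) (b :: s)) _
      (treeInt_pastSet_erase hm θ ih b v) a

theorem condDensity_T (U : ℕ → Bool) (n : ℕ) (x : 𝒳) (y : ExtTree → 𝒴) :
    condDensity lam (q θ) (g θ) (T n) root x y =
      lik lam (q θ) (g θ) (n + 1) (config U y root) x := by
  rw [T_eq_fullSet U, condDensity_eq (hm.q_meas θ) (hm.g_meas θ) y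
    (fun x x' => (hm.q_pos θ x x').le) (fun x y => (hm.g_pos θ x y).le)
    (Δ := fullSet U (n + 1) root) ⟨_, Finset.mem_insert_self _ _⟩, (treeInt_fullSet hm θ U y n root fun _ => x).2,
    ENNReal.toReal_ofReal ((hm.tame_lik _).pos θ _ _).le]

theorem condDensity_pastSet (U : ℕ → Bool) (e b : Bool) (s : List Bool) (v : ExtTree) (x : 𝒳)
    (y : ExtTree → 𝒴) :
    condDensity lam (q θ) (g θ) (pastSet U e (b :: s) v) v x y =
      pastLik lam (q θ) (g θ) (baseFactor (g θ) e) (b :: s) (config U y v) x := by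
  rw [condDensity_eq (hm.q_meas θ) (hm.g_meas θ) y
    (fun x x' => (hm.q_pos θ x x').le) (fun x y => (hm.g_pos θ x y).le)
    (Δ := pastSet U e (b :: s) v) ⟨v, Finset.mem_insert_self _ _⟩,
    treeInt_pastSet_erase hm θ (treeInt_pastSet hm θ U y e s) b v fun _ => x,
    ENNReal.toReal_ofReal]
  exact ((hm.tame_pastLik (f₀ := fun θ => baseFactor (g θ) e) (tame_baseFactor hm e)
    (b :: s)).pos θ _ _).le

/-- In the quotient the factors of the top ancestor and of the sibling subtree cancel. What remains
is seen from the `k`-th ancestor, `x` being the state of its parent. For a past of depth zero there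
is no such parent, hence the index `k + 1`. -/
theorem logIncr_root_succ (U : ℕ → Bool) (k : ℕ) (x : 𝒳) (y : ExtTree → 𝒴) :
    logIncr lam (q θ) (g θ) U root (k + 1) x y = Real.log
      (condRatio lam (q θ) (g θ) (spineWord U k) (config U y (parent^[k] root)) x) := by
  rw [logIncr, past_root, pastStrict_root, spineWord, condDensity_pastSet hm,
    condDensity_pastSet hm, condRatio, pastLik, pastLik, sub_config, child_parent_iterate_root]
  congr 1
  have h₁ := (hm.g_pos θ x (config U y (parent^[k + 1] root) [])).ne'
  have h₂ := ((hm.tame_qInt_lik ((spineWord U k).length + (U k).toNat)).pos θ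
    (sub (!(U k)) (config U y (parent^[k + 1] root))) x).ne'
  rw [mul_div_mul_right _ _ h₂, mul_div_mul_left _ _ h₁]
  rfl

end Recursion

open ExtTree

/-! ### The law of the observations of a hidden Markov tree -/

namespace ExtTree

theorem subtree_zero (w : ExtTree) : subtree w 0 = {w} := by
  simp [subtree, gen]

theorem subtree_succ (w : ExtTree) (n : ℕ) : subtree w (n + 1) = gen w (n + 1) ∪ subtree w n := by
  rw [subtree, Finset.range_add_one, Finset.biUnion_insert]; rfl

theorem disjoint_gen_subtree (w : ExtTree) (n : ℕ) : Disjoint (gen w (n + 1)) (subtree w n) := by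
  refine Finset.disjoint_left.2 fun v hv hv' => ?_
  rw [mem_gen] at hv
  obtain ⟨i, hi, h⟩ := (mem_subtree _ _ _).1 hv'
  have h₁ := congrArg height hv
  have h₂ := congrArg height h
  rw [height_parent_iterate] at h₁ h₂
  omega

theorem prod_gen_succ {M : Type*} [CommMonoid M] (w : ExtTree) (n : ℕ) (f : ExtTree → M) :
    ∏ v ∈ gen w (n + 1), f v = ∏ v ∈ gen w n, ∏ c ∈ children v, f c := by
  rw [gen, Finset.prod_biUnion]
  intro u _ v _ huv
  refine Finset.disjoint_left.2 fun c hu hv => huv ?_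
  rw [← (mem_children _ _).1 hu, (mem_children _ _).1 hv]

theorem desc_injective (U : ℕ → Bool) (w : ExtTree) : Function.Injective (desc U w) := by
  intro s t h
  have hl : s.length = t.length := by
    have := congrArg height h
    rw [height_desc, height_desc] at this
    omega
  induction s generalizing t w with
  | nil => exact (List.eq_nil_of_length_eq_zero hl.symm).symm
  | cons b s ih =>
    obtain _ | ⟨b', t⟩ := t
    · simp at hl
    · have hl' : s.length = t.length := by simpa using hl
      have hb : b = b' := by
        apply child_injective U w
        rw [← parent_iterate_desc U (child U w b) s, ← parent_iterate_desc U (child U w b') t, hl']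
        exact congrArg _ h
      subst hb
      rw [ih _ h hl']

theorem desc_mem_subtree (U : ℕ → Bool) (w : ExtTree) {s : List Bool} {n : ℕ} (h : s.length ≤ n) :
    desc U w s ∈ subtree w n :=
  (mem_subtree _ _ _).2 ⟨s.length, h, parent_iterate_desc U w s⟩

theorem exists_desc_eq (U : ℕ → Bool) {w v : ExtTree} {n : ℕ} (hv : v ∈ subtree w n) :
    ∃ s : List Bool, s.length ≤ n ∧ desc U w s = v := by
  obtain ⟨i, hi, h⟩ := (mem_subtree _ _ _).1 hv
  suffices ∃ s : List Bool, s.length = i ∧ desc U w s = v by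
    obtain ⟨s, hs, h⟩ := this; exact ⟨s, hs.trans_le hi, h⟩
  clear hi hv
  induction i generalizing w with
  | zero => exact ⟨[], rfl, h.symm⟩
  | succ i ih =>
    obtain ⟨b, hb⟩ := (iterate_succ_eq_iff U _ _ _).1 h
    obtain ⟨s, hs, h⟩ := ih hb
    exact ⟨b :: s, by simp [hs], h⟩

end ExtTree

section Law

variable {Ω 𝒳 𝒴 : Type*} [MeasurableSpace Ω] [MeasurableSpace 𝒳] [MeasurableSpace 𝒴]
  {P : Measure Ω} [IsProbabilityMeasure P] {Q : Kernel 𝒳 𝒳} [IsMarkovKernel Q]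
  {G : Kernel 𝒳 𝒴} [IsMarkovKernel G] {ν : Measure 𝒳} [IsProbabilityMeasure ν]
  {X : ExtTree → Ω → 𝒳} {Y : ExtTree → Ω → 𝒴} {w : ExtTree}

/-- Two functionals of the form `E[a ψ(Z)]`, `E[a' (κ ψ)(Z')]` which coincide on indicator
functions coincide. -/
theorem lintegral_mul_comp_eq {α β : Type*} {mα : MeasurableSpace α} {mβ : MeasurableSpace β}
    (κ : Kernel β α) {a a' : Ω → ENNReal} {Z : Ω → α} {Z' : Ω → β}
    (ha : Measurable a) (ha' : Measurable a') (hZ : Measurable Z) (hZ' : Measurable Z')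
    (h : ∀ C, MeasurableSet C → ∫⁻ ω, a ω * C.indicator (1 : α → ENNReal) (Z ω) ∂P =
      ∫⁻ ω, a' ω * κ (Z' ω) C ∂P) {ψ : α → ENNReal} (hψ : Measurable ψ) :
    ∫⁻ ω, a ω * ψ (Z ω) ∂P = ∫⁻ ω, a' ω * ∫⁻ z, ψ z ∂κ (Z' ω) ∂P := by
  have h₁ : ∀ ψ : α → ENNReal, Measurable ψ → ∫⁻ ω, a ω * ψ (Z ω) ∂P =
      ∫⁻ z, ψ z ∂((P.withDensity a).map Z) := fun ψ hψ => by
    have hm : Measurable fun ω => ψ (Z ω) := hψ.comp hZ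
    rw [lintegral_map hψ hZ, lintegral_withDensity_eq_lintegral_mul _ ha hm]; rfl
  have h₂ : ∀ ψ : α → ENNReal, Measurable ψ → ∫⁻ ω, a' ω * ∫⁻ z, ψ z ∂κ (Z' ω) ∂P =
      ∫⁻ z, ψ z ∂(κ ∘ₘ ((P.withDensity a').map Z')) := fun ψ hψ => by
    have hm : Measurable fun ω => ∫⁻ z, ψ z ∂κ (Z' ω) := hψ.lintegral_kernel.comp hZ'
    rw [Measure.lintegral_bind κ.aemeasurable hψ.aemeasurable,
      lintegral_map hψ.lintegral_kernel hZ',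
      lintegral_withDensity_eq_lintegral_mul _ ha' hm]
    rfl
  rw [h₁ ψ hψ, h₂ ψ hψ]
  congr 1
  ext C hC
  have e := h C hC
  have hC1 : Measurable (C.indicator (1 : α → ENNReal)) := measurable_one.indicator hC
  rw [h₁ _ hC1, lintegral_indicator_one hC] at e
  have e' := h₂ _ hC1
  simp only [lintegral_indicator_one hC] at e'
  rw [e, e']

/-- Extension of `transition` from indicators to nonnegative measurable functions, one vertex of the
last generation at a time and the earlier generations at the end. -/
theorem IsBranchingMarkov.lintegral_transition (h : IsBranchingMarkov P Q ν X w) (n : ℕ)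
    {f : (subtree w n → 𝒳) → ENNReal} (hf : Measurable f) {φ : ExtTree → 𝒳 → ENNReal}
    (hφ : ∀ v, Measurable (φ v)) :
    ∫⁻ ω, f (fun v => X v ω) * ∏ v ∈ gen w (n + 1), φ v (X v ω) ∂P =
      ∫⁻ ω, f (fun v => X v ω) * ∏ v ∈ gen w (n + 1), ∫⁻ x, φ v x ∂Q (X (parent v) ω) ∂P := by
  classical
  have hXs : Measurable fun ω => (fun v : subtree w n => X v ω) :=
    measurable_pi_lambda _ fun v => h.measurable v
  have hφX : ∀ {φ : ExtTree → 𝒳 → ENNReal}, (∀ v, Measurable (φ v)) → ∀ v,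
      Measurable fun ω => φ v (X v ω) := fun hφ v => (hφ v).comp (h.measurable v)
  have hφQ : ∀ {φ : ExtTree → 𝒳 → ENNReal}, (∀ v, Measurable (φ v)) → ∀ v,
      Measurable fun ω => ∫⁻ x, φ v x ∂Q (X (parent v) ω) := fun hφ v =>
    (hφ v).lintegral_kernel.comp (h.measurable _)
  -- `J` is the set of vertices at which `φ` is allowed not to be an indicator; it grows from `∅`,
  -- where the claim is `transition` itself.
  have key : ∀ S, MeasurableSet S → ∀ (J : Finset ExtTree), J ⊆ gen w (n + 1) →
      ∀ φ : ExtTree → 𝒳 → ENNReal, (∀ v, Measurable (φ v)) →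
      (∀ v ∉ J, ∃ C, MeasurableSet C ∧ φ v = C.indicator (1 : 𝒳 → ENNReal)) →
      ∫⁻ ω, S.indicator (1 : (subtree w n → 𝒳) → ENNReal) (fun v : subtree w n => X v ω) *
        ∏ v ∈ gen w (n + 1), φ v (X v ω) ∂P =
      ∫⁻ ω, S.indicator (1 : (subtree w n → 𝒳) → ENNReal) (fun v : subtree w n => X v ω) *
        ∏ v ∈ gen w (n + 1), ∫⁻ x, φ v x ∂Q (X (parent v) ω) ∂P := by
    intro S hS J
    induction J using Finset.induction_on with
    | empty =>
      intro _ φ hφ hC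
      choose! C hCm hC using hC
      have hC' : ∀ v, φ v = (C v).indicator (1 : 𝒳 → ENNReal) := fun v => hC v (Finset.notMem_empty v)
      have hCm' : ∀ v, MeasurableSet (C v) := fun v => hCm v (Finset.notMem_empty v)
      have := h.transition n S hS C hCm'
      have hmS : MeasurableSet {ω | (fun v : subtree w n => X v ω) ∈ S} := hXs hS
      have hmC : MeasurableSet {ω | ∀ v ∈ gen w (n + 1), X v ω ∈ C v} := by
        have e : {ω | ∀ v ∈ gen w (n + 1), X v ω ∈ C v} =
            ⋂ v ∈ gen w (n + 1), X v ⁻¹' C v := by ext; simp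
        rw [e]
        exact Finset.measurableSet_biInter _ fun v _ => h.measurable v (hCm' v)
      rw [← lintegral_indicator hmS] at this
      have e₁ : ∀ ω, S.indicator (1 : (subtree w n → 𝒳) → ENNReal) (fun v : subtree w n => X v ω) *
          ∏ v ∈ gen w (n + 1), φ v (X v ω) =
          ({ω | (fun v : subtree w n => X v ω) ∈ S} ∩
            {ω | ∀ v ∈ gen w (n + 1), X v ω ∈ C v}).indicator (1 : Ω → ENNReal) ω := by
        intro ω
        simp only [hC', Set.indicator_apply, Set.mem_inter_iff, Set.mem_ofPred_eq, Pi.one_apply,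
          Finset.prod_ite_zero, Finset.prod_const_one]
        by_cases h₁ : (fun v : subtree w n => X v ω) ∈ S <;> simp [h₁]
      simp only [e₁]
      rw [lintegral_indicator_one (hmS.inter hmC)]
      refine Eq.trans this (lintegral_congr fun ω => ?_)
      simp only [hC', lintegral_indicator_one (hCm' _)]
      by_cases h₁ : (fun v : subtree w n => X v ω) ∈ S <;>
        simp [h₁]
    | insert c J hcJ ih =>
      intro hJ φ hφ hC
      have hc : c ∈ gen w (n + 1) := hJ (Finset.mem_insert_self _ _)
      have hrest : ∀ ψ : 𝒳 → ENNReal, ∀ v ∈ (gen w (n + 1)).erase c,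
          Function.update φ c ψ v = φ v := fun ψ v hv =>
        Function.update_of_ne (Finset.ne_of_mem_erase hv) _ _
      have split₁ : ∀ (ψ : 𝒳 → ENNReal) ω, ∏ v ∈ gen w (n + 1), Function.update φ c ψ v (X v ω) =
          (∏ v ∈ (gen w (n + 1)).erase c, φ v (X v ω)) * ψ (X c ω) := fun ψ ω => by
        rw [← Finset.prod_erase_mul _ _ hc, Function.update_self]
        congr 1
        exact Finset.prod_congr rfl fun v hv => by rw [hrest ψ v hv]
      have split₂ : ∀ (ψ : 𝒳 → ENNReal) ω,
          ∏ v ∈ gen w (n + 1), ∫⁻ x, Function.update φ c ψ v x ∂Q (X (parent v) ω) =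
          (∏ v ∈ (gen w (n + 1)).erase c, ∫⁻ x, φ v x ∂Q (X (parent v) ω)) *
            ∫⁻ x, ψ x ∂Q (X (parent c) ω) := fun ψ ω => by
        rw [← Finset.prod_erase_mul _ _ hc, Function.update_self]
        congr 1
        exact Finset.prod_congr rfl fun v hv => by rw [hrest ψ v hv]
      have := lintegral_mul_comp_eq (P := P) Q (Z := X c) (Z' := X (parent c))
        (a := fun ω => S.indicator (1 : (subtree w n → 𝒳) → ENNReal) (fun v : subtree w n => X v ω) *
          ∏ v ∈ (gen w (n + 1)).erase c, φ v (X v ω))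
        (a' := fun ω => S.indicator (1 : (subtree w n → 𝒳) → ENNReal) (fun v : subtree w n => X v ω) *
          ∏ v ∈ (gen w (n + 1)).erase c, ∫⁻ x, φ v x ∂Q (X (parent v) ω))
        (((measurable_one.indicator hS).comp hXs).mul
          (Finset.measurable_fun_prod _ fun v _ => hφX hφ v))
        (((measurable_one.indicator hS).comp hXs).mul
          (Finset.measurable_fun_prod _ fun v _ => hφQ hφ v))
        (h.measurable _) (h.measurable _) (fun C hCm => ?_) (hφ c)
      · simp only [mul_assoc, ← split₁, ← split₂, Function.update_eq_self] at this
        exact this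
      · have := ih (fun v hv => hJ (Finset.mem_insert_of_mem hv))
          (Function.update φ c (C.indicator (1 : 𝒳 → ENNReal))) (fun v => ?_) (fun v hv => ?_)
        · simp only [split₁, split₂, ← mul_assoc, lintegral_indicator_one hCm] at this
          exact this
        · by_cases hvc : v = c
          · subst hvc; rw [Function.update_self]; exact measurable_one.indicator hCm
          · rw [Function.update_of_ne hvc]; exact hφ v
        · by_cases hvc : v = c
          · subst hvc; exact ⟨C, hCm, Function.update_self _ _ _⟩
          · rw [Function.update_of_ne hvc]
            exact hC v (by simp [hvc, hv])
  -- With the identity kernel, the same extension principle replaces the indicator of `S` by `f`.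
  have := lintegral_mul_comp_eq (P := P) (Kernel.id : Kernel (subtree w n → 𝒳) _)
    (a := fun ω => ∏ v ∈ gen w (n + 1), φ v (X v ω))
    (a' := fun ω => ∏ v ∈ gen w (n + 1), ∫⁻ x, φ v x ∂Q (X (parent v) ω))
    (Z := fun ω => (fun v : subtree w n => X v ω)) (Z' := fun ω => (fun v : subtree w n => X v ω))
    (Finset.measurable_fun_prod _ fun v _ => hφX hφ v)
    (Finset.measurable_fun_prod _ fun v _ => hφQ hφ v) hXs hXs (fun S hS => ?_) hf
  · simp only [Kernel.id_apply, lintegral_dirac' _ hf] at this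
    simpa only [mul_comm] using this
  -- Off the generation `φ` has no effect, and is replaced there by the zero indicator so that `J`
  -- can be the whole generation.
  · have := key S hS (gen w (n + 1)) subset_rfl
      (fun v => if v ∈ gen w (n + 1) then φ v else (∅ : Set 𝒳).indicator 1)
      (fun v => by
        split_ifs
        · exact hφ v
        · exact measurable_one.indicator .empty)
      (fun v hv => ⟨∅, .empty, if_neg hv⟩)
    have e₁ : ∀ ω, ∏ v ∈ gen w (n + 1), (if v ∈ gen w (n + 1) then φ v
        else (∅ : Set 𝒳).indicator 1) (X v ω) = ∏ v ∈ gen w (n + 1), φ v (X v ω) := fun ω =>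
      Finset.prod_congr rfl fun v hv => by rw [if_pos hv]
    have e₂ : ∀ ω, ∏ v ∈ gen w (n + 1), ∫⁻ x, (if v ∈ gen w (n + 1) then φ v
        else (∅ : Set 𝒳).indicator 1) x ∂Q (X (parent v) ω) =
        ∏ v ∈ gen w (n + 1), ∫⁻ x, φ v x ∂Q (X (parent v) ω) := fun ω =>
      Finset.prod_congr rfl fun v hv => by rw [if_pos hv]
    simp only [e₁, e₂] at this
    simp only [Kernel.id_apply, Measure.dirac_apply' _ hS]
    simpa only [mul_comm] using this

/-- The probability that the observations on the first generations below `v` belong to `B`, given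
the hidden state at `v`. -/
def boxProb (Q : Kernel 𝒳 𝒳) (G : Kernel 𝒳 𝒴) (B : ExtTree → Set 𝒴) :
    ℕ → ExtTree → 𝒳 → ENNReal
  | 0, v, x => G x (B v)
  | n + 1, v, x => G x (B v) * ∏ c ∈ children v, ∫⁻ x', boxProb Q G B n c x' ∂Q x

theorem measurable_boxProb {B : ExtTree → Set 𝒴} (hB : ∀ v, MeasurableSet (B v)) (n : ℕ)
    (v : ExtTree) : Measurable (boxProb Q G B n v) := by
  induction n generalizing v with
  | zero => exact G.measurable_coe (hB v)
  | succ n ih =>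
    exact (G.measurable_coe (hB v)).mul
      (Finset.measurable_fun_prod _ fun c _ => (ih c).lintegral_kernel)

/-- Integrating out generation `n + 1` and absorbing the emissions of generation `n` turns `boxProb`
of depth `m` into depth `m + 1` one generation higher; the recursion ends at `w`. -/
theorem IsBranchingMarkov.lintegral_boxProb (h : IsBranchingMarkov P Q ν X w)
    {B : ExtTree → Set 𝒴} (hB : ∀ v, MeasurableSet (B v)) (n m : ℕ) :
    ∫⁻ ω, (∏ v ∈ subtree w n, G (X v ω) (B v)) *
      ∏ v ∈ gen w (n + 1), boxProb Q G B m v (X v ω) ∂P =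
      ∫⁻ x, boxProb Q G B (n + 1 + m) w x ∂ν := by
  have step : ∀ n m, ∫⁻ ω, (∏ v ∈ subtree w n, G (X v ω) (B v)) *
      ∏ v ∈ gen w (n + 1), boxProb Q G B m v (X v ω) ∂P =
      ∫⁻ ω, (∏ v ∈ subtree w n, G (X v ω) (B v)) *
      ∏ v ∈ gen w n, ∏ c ∈ children v, ∫⁻ x, boxProb Q G B m c x ∂Q (X v ω) ∂P := fun n m => by
    have := h.lintegral_transition n (f := fun z => ∏ v : subtree w n, G (z v) (B v))
      (Finset.measurable_fun_prod _ fun v _ =>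
        (G.measurable_coe (hB v)).comp (measurable_pi_apply v))
      (measurable_boxProb (Q := Q) (G := G) hB m)
    have e : ∀ ω, ∏ v : subtree w n, G (X v ω) (B v) = ∏ v ∈ subtree w n, G (X v ω) (B v) :=
      fun ω => Finset.prod_coe_sort _ fun v => G (X v ω) (B v)
    simp only [e] at this
    rw [this]
    refine lintegral_congr fun ω => ?_
    rw [prod_gen_succ]
    congr 1
    exact Finset.prod_congr rfl fun v _ => Finset.prod_congr rfl fun c hc => by
      rw [(mem_children _ _).1 hc]
  induction n generalizing m with
  | zero =>
    rw [step, ← h.initial, lintegral_map (measurable_boxProb hB _ _) (h.measurable w)]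
    refine lintegral_congr fun ω => ?_
    rw [subtree_zero, gen, Finset.prod_singleton, Finset.prod_singleton,
      show 0 + 1 + m = m + 1 by omega]
    rfl
  | succ n ih =>
    rw [step, show n + 1 + 1 + m = n + 1 + (m + 1) by omega, ← ih]
    refine lintegral_congr fun ω => ?_
    rw [subtree_succ, Finset.prod_union (disjoint_gen_subtree _ _), mul_right_comm, mul_comm,
      ← Finset.prod_mul_distrib]
    rfl

theorem IsHMT.measure_box (h : IsHMT P Q G ν X Y w) {B : ExtTree → Set 𝒴}
    (hB : ∀ v, MeasurableSet (B v)) (n : ℕ) :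
    P {ω | ∀ v ∈ subtree w n, Y v ω ∈ B v} = ∫⁻ x, boxProb Q G B n w x ∂ν := by
  have := h.emission n Set.univ .univ B hB
  simp only [Set.mem_univ, true_and, Set.ofPred_true, Measure.restrict_univ] at this
  rw [this]
  cases n with
  | zero =>
    rw [← h.hidden.initial, lintegral_map (measurable_boxProb hB _ _) (h.hidden.measurable w)]
    simp only [subtree_zero, Finset.prod_singleton]
    rfl
  | succ n =>
    rw [show n + 1 = n + 1 + 0 by omega, ← h.hidden.lintegral_boxProb hB]
    refine lintegral_congr fun ω => ?_
    rw [add_zero, subtree_succ, Finset.prod_union (disjoint_gen_subtree _ _), mul_comm]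
    rfl

theorem measurableSet_box {B : List Bool → Set 𝒴} (hB : ∀ s, MeasurableSet (B s)) (n : ℕ) :
    MeasurableSet {c : List Bool → 𝒴 | ∀ s, s.length ≤ n → c s ∈ B s} := by
  have e : {c : List Bool → 𝒴 | ∀ s, s.length ≤ n → c s ∈ B s} =
      ⋂ s : List Bool, ⋂ _ : s.length ≤ n, (fun c => c s) ⁻¹' B s := by ext; simp
  rw [e]
  exact .iInter fun s => .iInter fun _ => measurable_pi_apply s (hB s)

theorem treeKernel_box {B : ExtTree → Set 𝒴} (hB : ∀ v, MeasurableSet (B v)) (U : ℕ → Bool)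
    (n : ℕ) (v : ExtTree) (x : 𝒳) :
    treeKernel Q G n x {c | ∀ s, s.length ≤ n → c s ∈ B (desc U v s)} = boxProb Q G B n v x := by
  have hm : ∀ n v, MeasurableSet {c : List Bool → 𝒴 | ∀ s, s.length ≤ n → c s ∈ B (desc U v s)} :=
    fun n v => measurableSet_box (fun s => hB _) n
  induction n generalizing v x with
  | zero =>
    rw [treeKernel, Kernel.map_apply' _ measurable_const_config _ (hm 0 v)]
    congr 1
    ext y
    exact ⟨fun hy => hy [] le_rfl, fun hy s hs => by
      rw [List.eq_nil_of_length_eq_zero (Nat.le_zero.1 hs)]; exact hy⟩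
  | succ n ih =>
    rw [treeKernel_succ_apply, Measure.map_apply measurable_glue (hm (n + 1) v)]
    have e : glue ⁻¹' {c : List Bool → 𝒴 | ∀ s, s.length ≤ n + 1 → c s ∈ B (desc U v s)} =
        B v ×ˢ ({c | ∀ s, s.length ≤ n → c s ∈ B (desc U (child U v false) s)} ×ˢ
          {c | ∀ s, s.length ≤ n → c s ∈ B (desc U (child U v true) s)}) := by
      ext p
      refine ⟨fun hp => ⟨hp [] (Nat.zero_le _), fun s hs => hp (false :: s) (by simpa using hs),
        fun s hs => hp (true :: s) (by simpa using hs)⟩, fun hp s hs => ?_⟩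
      rcases s with _ | ⟨_ | _, s⟩
      · exact hp.1
      · exact hp.2.1 s (by simpa using hs)
      · exact hp.2.2 s (by simpa using hs)
    have hb : ∀ b, (treeKernel Q G n ∘ₖ Q) x
        {c | ∀ s, s.length ≤ n → c s ∈ B (desc U (child U v b) s)} =
        ∫⁻ x', boxProb Q G B n (child U v b) x' ∂Q x := fun b => by
      rw [Kernel.comp_apply' _ _ _ (hm n _)]
      exact lintegral_congr fun x' => ih _ _
    rw [e, Measure.prod_prod, Measure.prod_prod, hb, hb, boxProb, children_eq U,
      Finset.prod_pair fun hh => by simpa using child_injective U v hh]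

/-- Both laws are compared on cylinders, where each equals an integral of `boxProb`; cylinders form
a generating π-system. -/
theorem IsHMT.hasTreeLaw (h : IsHMT P Q G ν X Y w) (U : ℕ → Bool) :
    HasTreeLaw P Q G ν fun ω => config U (fun v => Y v ω) w := by
  have hmc : Measurable fun ω => config U (fun v => Y v ω) w :=
    measurable_pi_lambda _ fun s => h.measurable _
  refine ⟨hmc, fun n => ?_⟩
  have : IsProbabilityMeasure ((treeKernel Q G n ∘ₘ ν).map (truncate n)) :=
    Measure.isProbabilityMeasure_map (measurable_truncate n).aemeasurable
  have : IsProbabilityMeasure (P.map fun ω => truncate n (config U (fun v => Y v ω) w)) :=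
    Measure.isProbabilityMeasure_map ((measurable_truncate n).comp hmc).aemeasurable
  refine ext_of_generate_finite _ generateFrom_squareCylinders.symm
    (isPiSystem_squareCylinders (fun _ => MeasurableSpace.isPiSystem_measurableSet)
      fun _ => .univ) ?_ (by simp)
  rintro _ ⟨I, B, hB, rfl⟩
  have hB : ∀ s, MeasurableSet (B s) := fun s => hB s (Set.mem_univ _)
  -- A truncated configuration reads `s` at `s.take n`, so all constraints on words with the same
  -- truncation are intersected at that word.
  set B' : List Bool → Set 𝒴 := fun t => ⋂ s ∈ I, ⋂ _ : s.take n = t, B s with hB'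
  -- Transport of the constraints to the vertices; vertices that do not descend from `w` are
  -- unconstrained.
  set C : ExtTree → Set 𝒴 := Function.extend (desc U w) B' fun _ => Set.univ with hC
  have hCd : ∀ s, C (desc U w s) = B' s := fun s => (desc_injective U w).extend_apply _ _ _
  have hCm : ∀ v, MeasurableSet (C v) := fun v => by
    by_cases hv : ∃ s, desc U w s = v
    · obtain ⟨s, rfl⟩ := hv
      rw [hCd]
      exact Finset.measurableSet_biInter _ fun s _ => .iInter fun _ => hB s
    · rw [hC, Function.extend_apply' _ _ _ hv]; exact .univ
  have hpre : truncate n ⁻¹' (I : Set (List Bool)).pi B =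
      {c : List Bool → 𝒴 | ∀ s, s.length ≤ n → c s ∈ C (desc U w s)} := by
    ext c
    simp only [hCd, hB', Set.mem_preimage, Set.mem_pi, Set.mem_ofPred_eq, Set.mem_iInter, truncate]
    refine ⟨fun hc s _ t ht e => ?_, fun hc s hs => hc _ (List.length_take_le _ _) s hs rfl⟩
    rw [← e]
    exact hc t ht
  have hmI : MeasurableSet ((I : Set (List Bool)).pi B) :=
    MeasurableSet.pi I.countable_toSet fun s _ => hB s
  rw [Measure.map_apply (measurable_truncate n) hmI, hpre,
    Measure.bind_apply (measurableSet_box (fun s => hCm _) n) (treeKernel Q G n).aemeasurable]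
  simp only [treeKernel_box hCm]
  have hmt : Measurable fun ω => truncate n (config U (fun v => Y v ω) w) :=
    (measurable_truncate n).comp hmc
  rw [← h.measure_box hCm, Measure.map_apply hmt hmI]
  congr 1
  have e : (fun ω => truncate n (config U (fun v => Y v ω) w)) ⁻¹' (I : Set (List Bool)).pi B =
      (fun ω => config U (fun v => Y v ω) w) ⁻¹' (truncate n ⁻¹' (I : Set (List Bool)).pi B) := rfl
  rw [e, hpre]
  ext ω
  refine ⟨fun hω v hv => ?_, fun hω s hs => hω _ (desc_mem_subtree U w hs)⟩
  obtain ⟨s, hs, rfl⟩ := exists_desc_eq U hv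
  exact hω s hs

end Law

open ExtTree

/-! ### Random plane embeddings -/

namespace ExtTree

instance : Countable ExtTree := by
  refine Function.Injective.countable
    (β := List Bool ⊕ ℕ ⊕ ℕ × List Bool)
    (f := fun v => match v with
      | main s => Sum.inl s
      | spine j => Sum.inr (Sum.inl j)
      | graft j s => Sum.inr (Sum.inr (j, s))) fun v w h => ?_
  rcases v with s | j | ⟨j, s⟩ <;> rcases w with s' | j' | ⟨j', s'⟩ <;> simp_all

instance : MeasurableSpace ExtTree := ⊤

instance : DiscreteMeasurableSpace ExtTree := ⟨fun _ => trivial⟩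

/-- The discrete `σ`-field. -/
instance : MeasurableSpace (List Bool) := ⊤

instance : DiscreteMeasurableSpace (List Bool) := ⟨fun _ => trivial⟩

theorem measurable_child (v : ExtTree) (b : Bool) : Measurable fun U => child U v b := by
  rcases v with s | (_ | j) | ⟨j, s⟩
  · exact measurable_const
  · exact (Measurable.of_discrete (f := fun b' : Bool => if b = b' then main [] else graft 0 [])).comp
      (measurable_pi_apply 0)
  · exact (Measurable.of_discrete (f := fun b' : Bool => if b = b' then spine j
      else graft (j + 1) [])).comp (measurable_pi_apply (j + 1))
  · exact measurable_const

theorem measurable_desc (v : ExtTree) (s : List Bool) : Measurable fun U => desc U v s := by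
  induction s generalizing v with
  | nil => exact measurable_const
  | cons b s ih =>
    have : Measurable fun p : ExtTree × (ℕ → Bool) => desc p.2 p.1 s :=
      measurable_from_prod_countable_right fun v => ih v
    exact this.comp ((measurable_child v b).prodMk measurable_id)

theorem measurable_spineWord (k : ℕ) : Measurable fun U => spineWord U k := by
  induction k with
  | zero => exact measurable_const
  | succ k ih =>
    have : Measurable fun p : Bool × List Bool => p.1 :: p.2 := .of_discrete
    exact this.comp ((measurable_pi_apply k).prodMk ih)

theorem measurable_config {Ω 𝒴 : Type*} [MeasurableSpace Ω] [MeasurableSpace 𝒴]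
    {Y : ExtTree → Ω → 𝒴} (hY : ∀ v, Measurable (Y v)) (w : ExtTree) :
    Measurable fun p : (ℕ → Bool) × Ω => config p.1 (fun v => Y v p.2) w := by
  refine measurable_pi_lambda _ fun s => ?_
  have : Measurable fun p : ExtTree × Ω => Y p.1 p.2 := measurable_from_prod_countable_right hY
  exact this.comp (((measurable_desc w s).comp measurable_fst).prodMk measurable_snd)

/-- The path from a higher ancestor to the root passes through the `k`-th ancestor: increments with
different depths of past have the form required by the forgetting estimate. -/
theorem exists_spineWord_add {𝒴 : Type*} [MeasurableSpace 𝒴] (U : ℕ → Bool)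
    (y : ExtTree → 𝒴) (j k : ℕ) : ∃ s : List Bool, spineWord U (j + k) = s ++ spineWord U k ∧
      shift s (config U y (parent^[j + k] root)) = config U y (parent^[k] root) := by
  induction j with
  | zero => exact ⟨[], by simp, by simp [shift_nil]⟩
  | succ j ih =>
    obtain ⟨s, hs, h⟩ := ih
    refine ⟨U (j + k) :: s, ?_, ?_⟩
    · rw [Nat.succ_add_eq_add_succ, Nat.add_succ, spineWord, hs, List.cons_append]
    · rw [Nat.succ_add_eq_add_succ, Nat.add_succ, shift_cons, sub_config,
        child_parent_iterate_root, h]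

end ExtTree

/-! ### The random word leading to the root is uniform -/

instance : IsProbabilityMeasure coinLaw := by unfold coinLaw; infer_instance

/-- A prescribed word fixes exactly the first `s.length` coins. The path starts with the coin of the
highest index, hence the reversal in the proof. -/
theorem coinLaw_spineWord (s : List Bool) :
    coinLaw.real {U | spineWord U s.length = s} = (2 ^ s.length)⁻¹ := by
  have e : {U : ℕ → Bool | spineWord U s.length = s} =
      (Finset.range s.length : Set ℕ).pi fun i => {s.reverse.getD i false} := by
    ext U
    simp only [Set.mem_ofPred_eq, Set.mem_pi, Finset.coe_range, Set.mem_Iio, Set.mem_singleton_iff]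
    induction s with
    | nil => simp [spineWord]
    | cons b s ih =>
      rw [List.length_cons, spineWord, List.cons_eq_cons, ih]
      refine ⟨fun ⟨h₁, h₂⟩ i hi => ?_, fun h => ⟨?_, fun i hi => ?_⟩⟩
      · rcases Nat.lt_succ_iff_lt_or_eq.1 hi with hi | rfl
        · rw [h₂ i hi, List.reverse_cons, List.getD_append _ _ _ _ (by simpa using hi)]
        · rw [h₁, List.reverse_cons, List.getD_append_right _ _ _ _ (by simp)]; simp
      · rw [h _ (Nat.lt_succ_self _), List.reverse_cons,
          List.getD_append_right _ _ _ _ (by simp)]; simp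
      · rw [h i (hi.trans (Nat.lt_succ_self _)), List.reverse_cons,
          List.getD_append _ _ _ _ (by simpa using hi)]
  rw [e, coinLaw, measureReal_def, Measure.infinitePi_pi _ fun i _ => .singleton _]
  simp

theorem sumWord_mul (n : ℕ) (f : List Bool → ℝ) (a : ℝ) :
    sumWord n (fun s => f s * a) = sumWord n f * a := by
  induction n generalizing f with
  | zero => rfl
  | succ n ih => simp only [sumWord, ih, add_mul]

theorem integral_sumWord {Ω : Type*} [MeasurableSpace Ω] {P : Measure Ω} {n : ℕ}
    {F : List Bool → Ω → ℝ} (hF : ∀ s, s.length = n → Integrable (F s) P) :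
    ∫ ω, sumWord n (fun s => F s ω) ∂P = sumWord n fun s => ∫ ω, F s ω ∂P := by
  induction n generalizing F with
  | zero => rfl
  | succ n ih =>
    have h : ∀ b s, s.length = n → Integrable (F (b :: s)) P := fun b s hs => hF _ (by simp [hs])
    have hi : ∀ b, Integrable (fun ω => sumWord n fun s => F (b :: s) ω) P := fun b =>
      sumWord_induction (p := fun f => Integrable f P) (fun _ _ h₁ h₂ => h₁.add h₂)
        (h b)
    simp only [sumWord]
    rw [integral_add (hi _) (hi _), ih (h _), ih (h _)]

theorem sumWord_ite {n : ℕ} (f : List Bool → ℝ) {t : List Bool} (ht : t.length = n) :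
    sumWord n (fun s => if t = s then f s else 0) = f t := by
  induction n generalizing f t with
  | zero => rw [List.eq_nil_of_length_eq_zero ht]; simp [sumWord]
  | succ n ih =>
    obtain _ | ⟨b, t⟩ := t
    · simp at ht
    · have ht' : t.length = n := by simpa using ht
      have h0 : sumWord n (fun _ => (0 : ℝ)) = 0 := by simp [sumWord_const]
      cases b <;> simp [sumWord, ih (fun s => f (_ :: s)) ht', h0]

/-- Averaging over the embedding equals averaging over a generation: this relates the contrast,
defined at the single vertex `∂`, to the likelihood of a whole generation. -/
theorem integral_spineWord (k : ℕ) (f : List Bool → ℝ) :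
    ∫ U, f (spineWord U k) ∂coinLaw = sumWord k f / 2 ^ k := by
  have hms : ∀ s, MeasurableSet {U | spineWord U k = s} := fun s =>
    measurable_spineWord k (measurableSet_singleton s)
  have e : ∀ U, f (spineWord U k) = sumWord k fun s =>
      {U | spineWord U k = s}.indicator (fun _ => f s) U := fun U => by
    rw [← sumWord_ite f (length_spineWord U k)]
    simp only [Set.indicator_apply, Set.mem_ofPred_eq]
  simp only [e]
  rw [integral_sumWord fun s _ => (integrable_const _).indicator (hms s), div_eq_mul_inv,
    ← sumWord_mul]
  refine sumWord_congr fun s hs => ?_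
  rw [integral_indicator (hms s), integral_const, smul_eq_mul, mul_comm]
  subst hs
  rw [measureReal_restrict_apply_univ, coinLaw_spineWord]

/-! ### The contrast function -/

section Contrast

variable {Ω Θ 𝒳 𝒴 : Type*} [MeasurableSpace Ω] [MeasurableSpace 𝒳] [MeasurableSpace 𝒴]
  [TopologicalSpace Θ] [FirstCountableTopology Θ]
  {lam : Measure 𝒳} [IsProbabilityMeasure lam] {q : Θ → 𝒳 → 𝒳 → ℝ} {g : Θ → 𝒳 → 𝒴 → ℝ}
  {σm σp B : ℝ}

/-- Forgetting makes the increments Cauchy at a geometric rate uniform in the initial state. The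
limit therefore exists, so `logIncrInf` is not a default value, and the rate passes to the limit. -/
theorem DensityModel.abs_log_condRatio_sub_logIncrInf_le (hm : DensityModel lam q g σm σp B)
    (θ : Θ) (U : ℕ → Bool) (y : ExtTree → 𝒴) (k : ℕ) (x : 𝒳) :
    |Real.log (condRatio lam (q θ) (g θ) (spineWord U k) (config U y (parent^[k] root)) x) -
      logIncrInf lam (q θ) (g θ) U root y| ≤ (σp - σm) / σm * (1 - σm / σp) ^ k := by
  have : Nonempty 𝒳 := ⟨x⟩
  set t : ℕ → 𝒳 → ℝ := fun k x =>
    Real.log (condRatio lam (q θ) (g θ) (spineWord U k) (config U y (parent^[k] root)) x)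
  set C := (σp - σm) / σm
  set ρ := 1 - σm / σp
  have hρ : 0 ≤ ρ := hm.rate_nonneg θ x
  have hρ1 : ρ < 1 := hm.rate_lt_one θ x
  have hcauchy : ∀ j k x x', |t (j + k) x - t k x'| ≤ C * ρ ^ k := fun j k x x' => by
    obtain ⟨s, hs, h⟩ := exists_spineWord_add U y j k
    have := hm.abs_log_condRatio_append_sub_le θ s (spineWord U k)
      (config U y (parent^[j + k] root)) x x'
    rwa [← hs, h, length_spineWord] at this
  have hlim : Tendsto (fun k => C * ρ ^ k) atTop (𝓝 0) := by
    simpa using (tendsto_pow_atTop_nhds_zero_of_lt_one hρ hρ1).const_mul C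
  have hcs : CauchySeq fun k => t k x := by
    refine cauchySeq_of_le_tendsto_0' (fun k => C * ρ ^ k) (fun k m hkm => ?_) hlim
    obtain ⟨j, rfl⟩ := Nat.exists_eq_add_of_le' hkm
    rw [dist_comm]
    exact hcauchy j k x x
  obtain ⟨L, hL⟩ := cauchySeq_tendsto_of_complete hcs
  have hbound : ∀ k x', |t k x' - L| ≤ C * ρ ^ k := fun k x' => by
    refine le_of_tendsto ((tendsto_const_nhds.sub (hL.comp (tendsto_add_atTop_nat k))).abs)
      (Eventually.of_forall fun j => ?_)
    rw [abs_sub_comm]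
    exact hcauchy j k x x'
  have hfull : Tendsto (fun p : ℕ × 𝒳 => logIncr lam (q θ) (g θ) U root p.1 p.2 y)
      (atTop ×ˢ ⊤) (𝓝 L) := by
    -- `logIncr` at depth `k + 1` is the term of index `k`, hence the exponent `p.1 - 1`; depth zero
    -- is discarded below.
    have hz : Tendsto (fun p : ℕ × 𝒳 => C * ρ ^ (p.1 - 1)) (atTop ×ˢ ⊤) (𝓝 0) :=
      (hlim.comp (tendsto_sub_atTop_nat 1)).comp tendsto_fst
    rw [tendsto_iff_dist_tendsto_zero]
    refine squeeze_zero' (Eventually.of_forall fun _ => dist_nonneg) ?_ hz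
    filter_upwards [tendsto_fst.eventually (eventually_ge_atTop 1)] with p hp
    obtain ⟨k, hk⟩ := Nat.exists_eq_add_of_le' hp
    rw [hk, logIncr_root_succ hm, Nat.add_sub_cancel]
    exact hbound k p.2
  rw [logIncrInf, hfull.limUnder_eq]
  exact hbound k x

variable {P : Measure Ω} [IsProbabilityMeasure P] {Q : Kernel 𝒳 𝒳} [IsMarkovKernel Q]
  {G : Kernel 𝒳 𝒴} [IsMarkovKernel G] {ν : Measure 𝒳} [IsProbabilityMeasure ν]
  {X : ExtTree → Ω → 𝒳} {Y : ExtTree → Ω → 𝒴}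

theorem memLp_comp_word {p : ENNReal} (hν : Kernel.Invariant Q ν) {b : 𝒴 → ℝ}
    (hb : ∀ k, MemLp (fun c : List Bool → 𝒴 => b (c [])) p (treeKernel Q G k ∘ₘ ν))
    {s : List Bool} {k : ℕ} (hs : s.length ≤ k) :
    MemLp (fun c : List Bool → 𝒴 => b (c s)) p (treeKernel Q G k ∘ₘ ν) := by
  induction s generalizing k with
  | nil => exact hb k
  | cons a s ih =>
    obtain ⟨k, rfl⟩ := Nat.exists_eq_add_of_le' (Nat.one_le_of_lt hs)
    exact (ih (by simpa using hs)).comp_measurePreserving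
      ⟨measurable_sub a, map_sub_treeKernel_comp G hν a k⟩

theorem DensityModel.memLp_genLik {p : ENNReal} (hm : DensityModel lam q g σm σp B)
    (hν : Kernel.Invariant Q ν) {b : 𝒴 → ℝ}
    (hb : ∀ k, MemLp (fun c : List Bool → 𝒴 => b (c [])) p (treeKernel Q G k ∘ₘ ν))
    (hle : ∀ θ s c x, |Real.log (condRatio lam (q θ) (g θ) s c x)| ≤ b (c s)) (θ : Θ) (x : 𝒳)
    {m k : ℕ} (hmk : m ≤ k) : MemLp (genLik lam (q θ) (g θ) m x) p (treeKernel Q G k ∘ₘ ν) := by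
  have : MemLp (fun c => sumWord m fun s => b (c s)) p (treeKernel Q G k ∘ₘ ν) :=
    sumWord_induction (p := fun f => MemLp f p (treeKernel Q G k ∘ₘ ν))
      (fun _ _ h₁ h₂ => h₁.add h₂) fun s hs => memLp_comp_word hν hb (hs.trans_le hmk)
  exact this.mono' (hm.measurable_genLik θ m x).aestronglyMeasurable
    (ae_of_all _ fun c => abs_sumWord_le fun s _ => hle θ s c x)

theorem HasTreeLaw.integral_comp_eq {c : Ω → List Bool → 𝒴} (h : HasTreeLaw P Q G ν c)
    {F : (List Bool → 𝒴) → ℝ} (hF : Measurable F) {n : ℕ} (hn : ∀ c, F (truncate n c) = F c) :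
    ∫ ω, F (c ω) ∂P = ∫ c, F c ∂(treeKernel Q G n ∘ₘ ν) := by
  have hFc : Measurable fun ω => F (c ω) := hF.comp h.measurable
  calc ∫ ω, F (c ω) ∂P = ∫ r, r ∂(P.map fun ω => F (c ω)) :=
        (integral_map hFc.aemeasurable measurable_id.aestronglyMeasurable).symm
    _ = ∫ r, r ∂((treeKernel Q G n ∘ₘ ν).map F) := by rw [h.map_comp_eq hF hn]
    _ = ∫ c, F c ∂(treeKernel Q G n ∘ₘ ν) :=
        integral_map hF.aemeasurable measurable_id.aestronglyMeasurable

/-- The contrast function is the limit of the mean log-likelihood contributions of a generation. -/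
theorem DensityModel.abs_integral_genLik_sub_contrast_le (hm : DensityModel lam q g σm σp B)
    (hXY : IsStationaryHMT P Q G ν X Y) {b : 𝒴 → ℝ}
    (hb : Integrable (fun ω => b (Y root ω)) P)
    (hb' : ∀ k, MemLp (fun c : List Bool → 𝒴 => b (c [])) 1 (treeKernel Q G k ∘ₘ ν))
    (hle : ∀ θ s c x, |Real.log (condRatio lam (q θ) (g θ) s c x)| ≤ b (c s)) (θ : Θ) (k : ℕ)
    (x : 𝒳) :
    |(∫ c, genLik lam (q θ) (g θ) k x c ∂(treeKernel Q G k ∘ₘ ν)) / 2 ^ k -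
      contrast P Y lam (q θ) (g θ)| ≤ (σp - σm) / σm * (1 - σm / σp) ^ k := by
  have hY : ∀ v, Measurable (Y v) := (hXY.isHMT 0).measurable
  set t : ℕ → (ℕ → Bool) × Ω → ℝ := fun k p =>
    Real.log (condRatio lam (q θ) (g θ) (spineWord p.1 k)
      (config p.1 (fun v => Y v p.2) (parent^[k] root)) x) with ht
  set H : (ℕ → Bool) × Ω → ℝ := fun p => logIncrInf lam (q θ) (g θ) p.1 root fun v => Y v p.2
  have hbound : ∀ k p, |t k p - H p| ≤ (σp - σm) / σm * (1 - σm / σp) ^ k := fun k p =>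
    hm.abs_log_condRatio_sub_logIncrInf_le θ p.1 _ k x
  have hlog : ∀ s, Measurable fun c => Real.log (condRatio lam (q θ) (g θ) s c x) := fun s =>
    Real.measurable_log.comp ((hm.measurable_condRatio θ s).comp
      (measurable_id.prodMk measurable_const))
  have htm : ∀ k, Measurable (t k) := fun k => by
    have : Measurable fun p : List Bool × (List Bool → 𝒴) =>
        Real.log (condRatio lam (q θ) (g θ) p.1 p.2 x) :=
      measurable_from_prod_countable_right hlog
    exact this.comp (((measurable_spineWord k).comp measurable_fst).prodMk (measurable_config hY _))
  have hHm : Measurable H := by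
    refine measurable_of_tendsto_metrizable htm (tendsto_pi_nhds.2 fun p => ?_)
    rw [tendsto_iff_dist_tendsto_zero]
    refine squeeze_zero (fun _ => dist_nonneg) (fun k => hbound k p) ?_
    simpa using (tendsto_pow_atTop_nhds_zero_of_lt_one (hm.rate_nonneg θ x)
      (hm.rate_lt_one θ x)).const_mul ((σp - σm) / σm)
  have hbi : Integrable (fun p : (ℕ → Bool) × Ω => b (Y root p.2)) (coinLaw.prod P) :=
    hb.comp_snd coinLaw
  -- Whatever the embedding and the depth, the observation at the end of the spine word is that of
  -- the root, so one integrable variable dominates all terms.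
  have hti : ∀ k, Integrable (t k) (coinLaw.prod P) := fun k =>
    hbi.mono' (htm k).aestronglyMeasurable (ae_of_all _ fun p => by
      refine (hle θ _ _ x).trans_eq ?_
      rw [config, desc_spineWord])
  have hHi : Integrable H (coinLaw.prod P) :=
    ((hti 0).abs.add (integrable_const ((σp - σm) / σm * (1 - σm / σp) ^ 0))).mono'
      hHm.aestronglyMeasurable (ae_of_all _ fun p => by
        have := hbound 0 p
        rw [abs_sub_comm] at this
        have h' := abs_sub_abs_le_abs_sub (H p) (t 0 p)
        simp only [Pi.add_apply, Real.norm_eq_abs]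
        linarith)
  -- For a fixed embedding the tree below the `k`-th ancestor has a law independent of `U`, by
  -- stationarity; only the word still depends on `U`.
  have hφ : ∀ U, ∫ ω, t k (U, ω) ∂P = ∫ c, Real.log (condRatio lam (q θ) (g θ) (spineWord U k) c x)
      ∂(treeKernel Q G k ∘ₘ ν) := fun U => by
    have h := (hXY.isHMT k).hasTreeLaw U
    exact h.integral_comp_eq (hlog (spineWord U k)) (n := k) fun c => by
      rw [condRatio_truncate (length_spineWord U k).le]
  have e : (∫ c, genLik lam (q θ) (g θ) k x c ∂(treeKernel Q G k ∘ₘ ν)) / 2 ^ k =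
      ∫ p, t k p ∂(coinLaw.prod P) := by
    rw [integral_prod _ (hti k)]
    simp only [hφ]
    rw [integral_spineWord k fun s => ∫ c, Real.log (condRatio lam (q θ) (g θ) s c x)
      ∂(treeKernel Q G k ∘ₘ ν)]
    congr 1
    refine integral_sumWord fun s hs => ?_
    refine (memLp_one_iff_integrable.1 (memLp_comp_word hXY.invariant hb' hs.le)).mono'
      (hlog s).aestronglyMeasurable (ae_of_all _ fun c => hle θ s c x)
  rw [e, contrast, ← integral_sub (hti k) hHi]
  refine (norm_integral_le_of_norm_le_const (f := fun p => t k p - H p)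
    (ae_of_all _ fun p => hbound k p)).trans_eq ?_
  simp

end Contrast

open ExtTree

/-! ### The true parameter maximizes the contrast function -/

theorem add_mul_le_of_add_le_succ {D : ℕ → ℝ} {ε : ℝ} {N : ℕ}
    (h : ∀ n ≥ N, D n + ε ≤ D (n + 1)) (n : ℕ) : D N + n * ε ≤ D (N + n) := by
  induction n with
  | zero => simp
  | succ n ih =>
    have := h (N + n) (Nat.le_add_right _ _)
    rw [← add_assoc]
    push_cast
    linarith

section KL

variable {Ω Θ 𝒳 𝒴 : Type*} [MeasurableSpace Ω] [MeasurableSpace 𝒳] [MeasurableSpace 𝒴]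
  [TopologicalSpace Θ] [FirstCountableTopology Θ]
  {lam : Measure 𝒳} [IsProbabilityMeasure lam] {mu : Measure 𝒴} [SigmaFinite mu]
  {q : Θ → 𝒳 → 𝒳 → ℝ} {g : Θ → 𝒳 → 𝒴 → ℝ} {σm σp B : ℝ}
  {P : Measure Ω} [IsProbabilityMeasure P] {Q : Θ → Kernel 𝒳 𝒳} [∀ θ, IsMarkovKernel (Q θ)]
  {G : Θ → Kernel 𝒳 𝒴} [∀ θ, IsMarkovKernel (G θ)] {ν : Measure 𝒳} [IsProbabilityMeasure ν]
  {X : ExtTree → Ω → 𝒳} {Y : ExtTree → Ω → 𝒴}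

theorem DensityModel.abs_genLik_sub_genLik_le (hm : DensityModel lam q g σm σp B) (θ : Θ) (m : ℕ)
    (x x' : 𝒳) (c : List Bool → 𝒴) :
    |genLik lam (q θ) (g θ) m x c - genLik lam (q θ) (g θ) m x' c| ≤
      2 ^ m * ((σp - σm) / σm * (1 - σm / σp) ^ m) := by
  have := hm.abs_genLik_add_sub_le θ 0 m x x' c
  rwa [zero_add] at this

theorem DensityModel.integral_genLik_of_le (hm : DensityModel lam q g σm σp B) {θ' : Θ}
    (hXY : IsStationaryHMT P (Q θ') (G θ') ν X Y) (θ : Θ) (x : 𝒳) {m n : ℕ} (hmn : m ≤ n) :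
    ∫ c, genLik lam (q θ) (g θ) m x c ∂(treeKernel (Q θ') (G θ') n ∘ₘ ν) =
      ∫ c, genLik lam (q θ) (g θ) m x c ∂(treeKernel (Q θ') (G θ') m ∘ₘ ν) := by
  have h := (hXY.isHMT 0).hasTreeLaw fun _ => false
  rw [← h.integral_comp_eq (hm.measurable_genLik θ m x) fun c => genLik_truncate hmn x c,
    ← h.integral_comp_eq (hm.measurable_genLik θ m x) fun c => genLik_truncate le_rfl x c]

/-- If the contrast at `θ` exceeded that at `θ'` by `δ`, the mean contributions of all late
generations would differ by at least `δ / 2` even after the corrections for the initial state, and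
their sum would become positive, against Kullback-Leibler positivity for finite trees. -/
theorem DensityModel.contrast_le (hm : DensityModel lam q g σm σp B)
    (hdom : FullyDominated lam mu Q G q g) (θ θ' : Θ)
    (hXY : IsStationaryHMT P (Q θ') (G θ') ν X Y) {b : 𝒴 → ℝ}
    (hb : Integrable (fun ω => b (Y root ω)) P)
    (hb' : ∀ k, MemLp (fun c : List Bool → 𝒴 => b (c [])) 1 (treeKernel (Q θ') (G θ') k ∘ₘ ν))
    (hle : ∀ θ s c x, |Real.log (condRatio lam (q θ) (g θ) s c x)| ≤ b (c s)) (x₀ : 𝒳) :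
    contrast P Y lam (q θ) (g θ) ≤ contrast P Y lam (q θ') (g θ') := by
  set C := (σp - σm) / σm
  set ρ := 1 - σm / σp
  have hρ : 0 ≤ ρ := hm.rate_nonneg θ x₀
  have hρ1 : ρ < 1 := hm.rate_lt_one θ x₀
  have hi : ∀ θ, ∀ m n, m ≤ n → Integrable (genLik lam (q θ) (g θ) m x₀)
      (treeKernel (Q θ') (G θ') n ∘ₘ ν) := fun θ m n hmn =>
    memLp_one_iff_integrable.1 (hm.memLp_genLik hXY.invariant hb' hle θ x₀ hmn)
  set A : Θ → ℕ → ℝ := fun θ m =>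
    ∫ c, genLik lam (q θ) (g θ) m x₀ c ∂(treeKernel (Q θ') (G θ') m ∘ₘ ν)
  -- The log-likelihood ratio is evaluated at the fixed state `x₀` and lowered by one forgetting
  -- error for `θ` and one for `θ'` in each generation. Its exponential is then dominated by the
  -- density ratio at every state `x`.
  have hsum : ∀ n, ∑ m ∈ Finset.range (n + 1), (A θ m - A θ' m - 2 * (2 ^ m * (C * ρ ^ m))) ≤ 0 := by
    intro n
    have hHi : ∀ m ∈ Finset.range (n + 1), Integrable (fun c => genLik lam (q θ) (g θ) m x₀ c -
        genLik lam (q θ') (g θ') m x₀ c - 2 * (2 ^ m * (C * ρ ^ m)))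
        (treeKernel (Q θ') (G θ') n ∘ₘ ν) := fun m hmn => by
      have hmn := Nat.lt_succ_iff.1 (Finset.mem_range.1 hmn)
      exact ((hi θ m n hmn).sub (hi θ' m n hmn)).sub (integrable_const _)
    have := hm.integral_nonpos_of_exp_mul_le hdom θ θ' n hXY.invariant
      (H := fun c => ∑ m ∈ Finset.range (n + 1), (genLik lam (q θ) (g θ) m x₀ c -
        genLik lam (q θ') (g θ') m x₀ c - 2 * (2 ^ m * (C * ρ ^ m))))
      (Finset.measurable_fun_sum _ fun m _ => ((hm.measurable_genLik θ m x₀).sub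
        (hm.measurable_genLik θ' m x₀)).sub_const _)
      (integrable_finsetSum _ hHi) fun c x => by
        have hp := (hm.tame_qInt (hm.tame_lik (n + 1))).pos θ c x
        have hp' := (hm.tame_qInt (hm.tame_lik (n + 1))).pos θ' c x
        rw [← Real.log_le_log_iff (mul_pos (Real.exp_pos _) hp') hp,
          Real.log_mul (Real.exp_pos _).ne' hp'.ne', Real.log_exp, hm.log_qInt_lik,
          hm.log_qInt_lik, ← Finset.sum_add_distrib]
        refine Finset.sum_le_sum fun m _ => ?_
        have h₁ := abs_le.1 (hm.abs_genLik_sub_genLik_le θ m x x₀ c)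
        have h₂ := abs_le.1 (hm.abs_genLik_sub_genLik_le θ' m x x₀ c)
        linarith [h₁.1, h₂.2]
    rw [integral_finsetSum _ hHi] at this
    refine le_of_eq_of_le (Finset.sum_congr rfl fun m hmn => ?_) this
    have hmn := Nat.lt_succ_iff.1 (Finset.mem_range.1 hmn)
    have hi₁ : Integrable (fun c => genLik lam (q θ) (g θ) m x₀ c - genLik lam (q θ') (g θ') m x₀ c)
        (treeKernel (Q θ') (G θ') n ∘ₘ ν) := (hi θ m n hmn).sub (hi θ' m n hmn)
    rw [integral_sub hi₁ (integrable_const _), integral_sub (hi θ m n hmn) (hi θ' m n hmn), hm.integral_genLik_of_le hXY θ x₀ hmn,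
      hm.integral_genLik_of_le hXY θ' x₀ hmn]
    simp [A]
  by_contra! hlt
  set δ := contrast P Y lam (q θ) (g θ) - contrast P Y lam (q θ') (g θ') with hδ
  have hδ0 : 0 < δ := sub_pos.2 hlt
  -- The factor 4 counts two errors in comparing the means with the contrasts and the two
  -- corrections above.
  have hlim : Tendsto (fun m => 4 * (C * ρ ^ m)) atTop (𝓝 0) := by
    simpa using ((tendsto_pow_atTop_nhds_zero_of_lt_one hρ hρ1).const_mul C).const_mul 4
  obtain ⟨N, hN⟩ := eventually_atTop.1 (hlim.eventually_le_const (half_pos hδ0))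
  have hstep : ∀ m ≥ N, δ / 2 ≤ A θ m - A θ' m - 2 * (2 ^ m * (C * ρ ^ m)) := fun m hmN => by
    have h2 : (0 : ℝ) < 2 ^ m := by positivity
    have h₁ := (abs_le.1 (hm.abs_integral_genLik_sub_contrast_le hXY hb hb' hle θ m x₀)).1
    have h₂ := (abs_le.1 (hm.abs_integral_genLik_sub_contrast_le hXY hb hb' hle θ' m x₀)).2
    have h₃ := hN m hmN
    have h₄ : δ / 2 ≤ A θ m / 2 ^ m - A θ' m / 2 ^ m - 2 * (C * ρ ^ m) := by
      simp only [A, C, ρ, hδ] at *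
      linarith
    have h₅ : A θ m - A θ' m - 2 * (2 ^ m * (C * ρ ^ m)) =
        2 ^ m * (A θ m / 2 ^ m - A θ' m / 2 ^ m - 2 * (C * ρ ^ m)) := by field_simp
    rw [h₅]
    have h₆ : (1 : ℝ) ≤ 2 ^ m := one_le_pow₀ one_le_two
    nlinarith
  have hgrow := add_mul_le_of_add_le_succ (N := N) (ε := δ / 2)
    (D := fun n => ∑ m ∈ Finset.range (n + 1), (A θ m - A θ' m - 2 * (2 ^ m * (C * ρ ^ m))))
    fun n hn => by
      rw [Finset.sum_range_succ _ (n + 1)]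
      linarith [hstep (n + 1) (by omega)]
  obtain ⟨n, hn⟩ := exists_nat_gt
    (-(∑ m ∈ Finset.range (N + 1), (A θ m - A θ' m - 2 * (2 ^ m * (C * ρ ^ m)))) / (δ / 2))
  rw [div_lt_iff₀ (half_pos hδ0)] at hn
  have h₁ := hgrow n
  have h₂ := hsum (N + n)
  linarith

end KL

open ExtTree

/-! ### Consequences of the assumptions on the model -/

section Assumptions

variable {Ω Θ 𝒳 𝒴 : Type*} [MeasurableSpace Ω] [MeasurableSpace 𝒳] [MeasurableSpace 𝒴]
  [TopologicalSpace Θ] [FirstCountableTopology Θ]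
  {lam : Measure 𝒳} [IsProbabilityMeasure lam] {mu : Measure 𝒴} [SigmaFinite mu]
  {q : Θ → 𝒳 → 𝒳 → ℝ} {g : Θ → 𝒳 → 𝒴 → ℝ} {σm σp B : ℝ}
  {P : Measure Ω} [IsProbabilityMeasure P] {Q : Θ → Kernel 𝒳 𝒳} [∀ θ, IsMarkovKernel (Q θ)]
  {G : Θ → Kernel 𝒳 𝒴} [∀ θ, IsMarkovKernel (G θ)] {ν : Measure 𝒳} [IsProbabilityMeasure ν]
  {X : ExtTree → Ω → 𝒳} {Y : ExtTree → Ω → 𝒴}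

theorem FullyDominated.densityModel (hdom : FullyDominated lam mu Q G q g)
    (hσm : 0 < σm) (hq : ∀ θ x x', σm ≤ q θ x x' ∧ q θ x x' ≤ σp)
    (hgpos : ∀ θ x y, 0 < g θ x y) (hgle : ∀ θ x y, g θ x y ≤ B)
    (hqcont : ∀ x x', Continuous fun θ => q θ x x')
    (hgcont : ∀ x y, Continuous fun θ => g θ x y) : DensityModel lam q g σm σp B where
  q_meas := hdom.measurable_q
  g_meas := hdom.measurable_g
  σm_pos := hσm
  le_q θ x x' := (hq θ x x').1
  q_le θ x x' := (hq θ x x').2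
  q_int θ x := by
    have h := hdom.Q_eq θ x Set.univ .univ
    rw [measure_univ, Measure.restrict_univ] at h
    rw [integral_eq_lintegral_of_nonneg_ae (ae_of_all _ fun x' => hσm.le.trans (hq θ x x').1)
      ((hdom.measurable_q θ).comp (measurable_const.prodMk measurable_id)).aestronglyMeasurable,
      ← h, ENNReal.toReal_one]
  g_pos := hgpos
  g_le := hgle
  q_cont := hqcont
  g_cont := hgcont

/-- The lower bound on `q` and invariance give `σm • lam ≤ ν`, while the upper bound gives `Q θ x ≤
σp • lam`. -/
theorem DensityModel.kernel_le_smul (hm : DensityModel lam q g σm σp B)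
    (hdom : FullyDominated lam mu Q G q g) {θ : Θ} (hν : Kernel.Invariant (Q θ) ν) (x : 𝒳) :
    Q θ x ≤ (ENNReal.ofReal σp / ENNReal.ofReal σm) • ν := by
  refine Measure.le_iff.2 fun s hs => ?_
  have h₁ : Q θ x s ≤ ENNReal.ofReal σp * lam s := by
    rw [hdom.Q_eq θ x s hs, ← setLIntegral_const]
    exact lintegral_mono fun x' => ENNReal.ofReal_le_ofReal (hm.q_le θ x x')
  have h₂ : ENNReal.ofReal σm * lam s ≤ ν s := by
    rw [← hν.def, Measure.bind_apply hs (Q θ).aemeasurable]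
    calc ENNReal.ofReal σm * lam s = ∫⁻ _, ENNReal.ofReal σm * lam s ∂ν := by simp
      _ ≤ ∫⁻ x, Q θ x s ∂ν := lintegral_mono fun x => by
        rw [hdom.Q_eq θ x s hs, ← setLIntegral_const]
        exact lintegral_mono fun x' => ENNReal.ofReal_le_ofReal (hm.le_q θ x x')
  have hσ : ENNReal.ofReal σm ≠ 0 := (ENNReal.ofReal_pos.2 hm.σm_pos).ne'
  rw [Measure.smul_apply, smul_eq_mul]
  calc Q θ x s ≤ ENNReal.ofReal σp * lam s := h₁
    _ = ENNReal.ofReal σp / ENNReal.ofReal σm * (ENNReal.ofReal σm * lam s) := by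
      rw [← mul_assoc, ENNReal.div_mul_cancel hσ ENNReal.ofReal_ne_top]
    _ ≤ _ := by gcongr

theorem DensityModel.integral_kernel (hm : DensityModel lam q g σm σp B)
    (hdom : FullyDominated lam mu Q G q g) (θ : Θ) (x : 𝒳) (f : 𝒳 → ℝ) :
    ∫ x', f x' ∂Q θ x = qInt lam (q θ) f x := by
  rw [withDensity_q hdom, integral_withDensity_eq_integral_toReal_smul
    (hm.q_meas_right θ x).ennreal_ofReal (ae_of_all _ fun _ => ENNReal.ofReal_lt_top), qInt]
  simp only [ENNReal.toReal_ofReal (hm.q_pos θ x _).le, smul_eq_mul]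

theorem DensityModel.continuous_integral_g
    (hm : DensityModel lam q g σm σp B) (y : 𝒴) : Continuous fun θ => ∫ x, g θ x y ∂lam := by
  refine continuous_of_dominated (bound := fun _ => B) (fun θ => ?_)
    (fun θ => ae_of_all _ fun x => ?_) (integrable_const _) (ae_of_all _ fun x => hm.g_cont x y)
  · exact (hm.integrable_g θ y).aestronglyMeasurable
  · rw [Real.norm_eq_abs, abs_of_pos (hm.g_pos θ x y)]
    exact hm.g_le θ x y

/-- Continuity in `θ` reduces the infimum to a countable dense set. -/
theorem DensityModel.measurable_bMinus [SecondCountableTopology Θ]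
    (hm : DensityModel lam q g σm σp B) : Measurable (bMinus lam g) := by
  obtain ⟨S, hS, hSd⟩ := TopologicalSpace.exists_countable_dense Θ
  have : Countable S := hS
  have e : bMinus lam g = fun y => ⨅ θ : S, ∫ x, g θ x y ∂lam :=
    funext fun y => (hSd.ciInf' (hm.continuous_integral_g y)).symm
  rw [e]
  refine Measurable.iInf fun θ => ?_
  have : StronglyMeasurable fun p : 𝒴 × 𝒳 => g θ p.2 p.1 :=
    ((hm.g_meas θ).comp measurable_swap).stronglyMeasurable
  exact this.integral_prod_right.measurable

theorem DensityModel.bMinus_le (hm : DensityModel lam q g σm σp B) (θ : Θ) (y : 𝒴) :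
    bMinus lam g y ≤ ∫ x, g θ x y ∂lam :=
  ciInf_le ⟨0, by rintro _ ⟨θ, rfl⟩; exact (hm.integral_g_pos θ y).le⟩ θ

/-- Domination by a function of the single observation at `s`, uniformly in `θ`, the past and the
initial state; it supplies all integrability used later. -/
theorem DensityModel.abs_log_condRatio_le
    (hm : DensityModel lam q g σm σp B)
    (hb : ∀ y, 0 < bMinus lam g y) (θ : Θ) (s : List Bool) (c : List Bool → 𝒴) (x : 𝒳) :
    |Real.log (condRatio lam (q θ) (g θ) s c x)| ≤
      |Real.log (bMinus lam g (c s))| + (|Real.log σm| + |Real.log (σp * B)|) := by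
  obtain ⟨h₁, h₂⟩ := hm.condRatio_mem θ s c x
  have hpos := hm.condRatio_pos θ s c x
  have hI : ∫ x, g θ x (c s) ∂lam ≤ B := by
    have := integral_mono (hm.integrable_g θ (c s)) (integrable_const (μ := lam) B)
      fun x => hm.g_le θ x (c s)
    simpa using this
  have u : Real.log (condRatio lam (q θ) (g θ) s c x) ≤ Real.log (σp * B) :=
    Real.log_le_log hpos (h₂.trans (mul_le_mul_of_nonneg_left hI (hm.σp_pos θ x).le))
  have l : Real.log σm + Real.log (bMinus lam g (c s)) ≤
      Real.log (condRatio lam (q θ) (g θ) s c x) := by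
    rw [← Real.log_mul hm.σm_pos.ne' (hb _).ne']
    exact Real.log_le_log (mul_pos hm.σm_pos (hb _))
      ((mul_le_mul_of_nonneg_left (hm.bMinus_le θ _) hm.σm_pos.le).trans h₁)
  rw [abs_le]
  have a₁ := neg_abs_le (Real.log σm)
  have a₂ := neg_abs_le (Real.log (bMinus lam g (c s)))
  have a₃ := le_abs_self (Real.log (σp * B))
  have a₄ := abs_nonneg (Real.log (σp * B))
  have a₅ := abs_nonneg (Real.log σm)
  have a₆ := abs_nonneg (Real.log (bMinus lam g (c s)))
  constructor <;> linarith

theorem IsStationaryHMT.memLp_root {Q : Kernel 𝒳 𝒳} [IsMarkovKernel Q] {G : Kernel 𝒳 𝒴}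
    [IsMarkovKernel G] (hXY : IsStationaryHMT P Q G ν X Y) {b : 𝒴 → ℝ}
    (hbm : Measurable b) {p : ENNReal} (hb : MemLp (fun ω => b (Y root ω)) p P) (k : ℕ) :
    MemLp (fun c : List Bool → 𝒴 => b (c [])) p (treeKernel Q G k ∘ₘ ν) := by
  have h := ((hXY.isHMT 0).hasTreeLaw fun _ => false).map_comp_eq
    (F := fun c => c []) (measurable_pi_apply []) (n := k) fun c => truncate_eq c (Nat.zero_le _)
  have h₁ : MemLp b p (P.map (Y root)) :=
    (memLp_map_measure_iff hbm.aestronglyMeasurable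
      ((hXY.isHMT 0).measurable root).aemeasurable).2 hb
  have h₂ : MemLp b p ((treeKernel Q G k ∘ₘ ν).map fun c => c []) := h ▸ h₁
  exact (memLp_map_measure_iff hbm.aestronglyMeasurable (measurable_pi_apply []).aemeasurable).1 h₂

end Assumptions

open ExtTree

/-! ### Consistency -/

section Consistency

variable {Ω Θ 𝒳 𝒴 : Type*} [MeasurableSpace Ω] [MeasurableSpace 𝒳] [MeasurableSpace 𝒴]
  [PseudoMetricSpace Θ] [SecondCountableTopology Θ]
  {lam : Measure 𝒳} [IsProbabilityMeasure lam] {mu : Measure 𝒴} [SigmaFinite mu]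
  {q : Θ → 𝒳 → 𝒳 → ℝ} {g : Θ → 𝒳 → 𝒴 → ℝ} {σm σp B : ℝ}

/-- Local suprema of a dominated family of random functions which are continuous in the
parameter. -/
theorem exists_local_sup {α : Type*} [MeasurableSpace α] {π : Measure α} {f : Θ → α → ℝ}
    {b : α → ℝ} (hf : ∀ θ, Measurable (f θ)) (hc : ∀ a, Continuous fun θ => f θ a)
    (hb : Integrable b π) (hle : ∀ θ a, |f θ a| ≤ b a) (θ : Θ) {ε : ℝ} (hε : 0 < ε) :
    ∃ (V : Set Θ) (W : α → ℝ), V ∈ 𝓝 θ ∧ Measurable W ∧ (∀ a, |W a| ≤ b a) ∧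
      (∀ a, ∀ θ' ∈ V, f θ' a ≤ W a) ∧ ∫ a, W a ∂π ≤ ∫ a, f θ a ∂π + ε ∧
      ∀ a a', (∀ θ, f θ a = f θ a') → W a = W a' := by
  -- The suprema run over a countable dense set to be measurable; by continuity they still dominate
  -- on the whole open balls.
  obtain ⟨S, hS, hSd⟩ := TopologicalSpace.exists_countable_dense Θ
  set V : ℕ → Set Θ := fun i => Metric.ball θ (1 / ((i : ℝ) + 1)) with hV
  have hVpos : ∀ i : ℕ, (0 : ℝ) < 1 / ((i : ℝ) + 1) := fun i => Nat.one_div_pos_of_nat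
  set W : ℕ → α → ℝ := fun i a => ⨆ θ' : (V i ∩ S : Set Θ), f θ' a with hW
  have hcount : ∀ i, Countable (V i ∩ S : Set Θ) := fun i => hS.mono Set.inter_subset_right
  have hne : ∀ i, Nonempty (V i ∩ S : Set Θ) := fun i =>
    (hSd.inter_open_nonempty _ Metric.isOpen_ball
      ⟨θ, Metric.mem_ball_self (hVpos i)⟩).to_subtype
  have hbdd : ∀ i a, BddAbove (Set.range fun θ' : (V i ∩ S : Set Θ) => f θ' a) := fun i a =>
    ⟨b a, by rintro _ ⟨θ', rfl⟩; exact (abs_le.1 (hle θ' a)).2⟩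
  have hWm : ∀ i, Measurable (W i) := fun i => Measurable.iSup fun θ' => hf θ'
  have hWV : ∀ i a, ∀ θ' ∈ V i, f θ' a ≤ W i a := fun i a θ' hθ' => by
    have hcl : IsClosed {θ' | f θ' a ≤ W i a} := isClosed_le (hc a) continuous_const
    have hsub : V i ∩ S ⊆ {θ' | f θ' a ≤ W i a} := fun θ'' h =>
      le_ciSup (hbdd i a) (⟨θ'', h⟩ : (V i ∩ S : Set Θ))
    exact hcl.closure_subset_iff.2 hsub
      (hSd.open_subset_closure_inter Metric.isOpen_ball hθ')
  have hWb : ∀ i a, |W i a| ≤ b a := fun i a => abs_le.2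
    ⟨(abs_le.1 (hle θ a)).1.trans (hWV i a θ (Metric.mem_ball_self (hVpos i))),
      ciSup_le fun θ' => (abs_le.1 (hle θ' a)).2⟩
  have hlim : ∀ a, Tendsto (fun i => W i a) atTop (𝓝 (f θ a)) := fun a => by
    refine tendsto_order.2 ⟨fun r hr => Eventually.of_forall fun i =>
      hr.trans_le (hWV i a θ (Metric.mem_ball_self (hVpos i))), fun r hr => ?_⟩
    obtain ⟨r', hr₁, hr₂⟩ := exists_between hr
    obtain ⟨δ, hδ, h⟩ := Metric.eventually_nhds_iff_ball.1
      ((hc a).continuousAt.eventually_le_const hr₁)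
    obtain ⟨N, hN⟩ := exists_nat_one_div_lt hδ
    filter_upwards [eventually_ge_atTop N] with i hi
    refine lt_of_le_of_lt (ciSup_le fun θ' => h θ' ?_) hr₂
    refine Metric.ball_subset_ball ?_ θ'.2.1
    exact (Nat.one_div_le_one_div hi).trans hN.le
  have hint := tendsto_integral_of_dominated_convergence b
    (fun i => (hWm i).aestronglyMeasurable) hb (fun i => ae_of_all _ (hWb i))
    (ae_of_all π hlim)
  obtain ⟨i, hi⟩ := (hint.eventually_le_const (lt_add_of_pos_right _ hε)).exists
  -- The final clause says that `W` depends on no more of `a` than the family does: a supremum of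
  -- functionals of finitely many generations is again one, as the law of large numbers requires.
  exact ⟨V i, W i, Metric.ball_mem_nhds _ (hVpos i), hWm i, hWb i, hWV i, hi,
    fun a a' h => by simp only [hW, h]⟩

variable {P : Measure Ω} [IsProbabilityMeasure P] {Q : Θ → Kernel 𝒳 𝒳} [∀ θ, IsMarkovKernel (Q θ)]
  {G : Θ → Kernel 𝒳 𝒴} [∀ θ, IsMarkovKernel (G θ)] {ν : Measure 𝒳} [IsProbabilityMeasure ν]
  {X : ExtTree → Ω → 𝒳} {Y : ExtTree → Ω → 𝒴}

theorem DensityModel.tendsto_genSum (hm : DensityModel lam q g σm σp B)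
    (hdom : FullyDominated lam mu Q G q g) {θ : Θ}
    (hXY : IsStationaryHMT P (Q θ) (G θ) ν X Y) {F : (List Bool → 𝒴) → ℝ} (hF : Measurable F)
    {k : ℕ} (hF2 : MemLp F 2 (treeKernel (Q θ) (G θ) k ∘ₘ ν))
    (hk : ∀ c, F (truncate k c) = F c) (U : ℕ → Bool) (x₀ : 𝒳) :
    ∀ᵐ ω ∂P, Tendsto (fun n => genSum F n (config U (fun v => Y v ω) root) / 2 ^ n) atTop
      (𝓝 (∫ c, F c ∂(treeKernel (Q θ) (G θ) k ∘ₘ ν))) := by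
  refine ((hXY.isHMT 0).hasTreeLaw U).tendsto_genSum hXY.invariant hF
    (C := ENNReal.ofReal σp / ENNReal.ofReal σm)
    (ENNReal.div_ne_top ENNReal.ofReal_ne_top (ENNReal.ofReal_pos.2 hm.σm_pos).ne')
    (hm.kernel_le_smul hdom hXY.invariant) (hm.rate_nonneg θ x₀) (hm.rate_lt_one θ x₀)
    (fun f hf D hD x x' => ?_) hF2 hk
  rw [hm.integral_kernel hdom, hm.integral_kernel hdom]
  exact hm.qInt_sub_le θ hf hD x x'

/-- Comparison of the increment of the log-likelihood with a sum over disjoint subtrees. -/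
theorem DensityModel.abs_log_lik_sub_genSum_le (hm : DensityModel lam q g σm σp B) (θ : Θ)
    (j k : ℕ) (x x₀ : 𝒳) (c : List Bool → 𝒴) :
    |Real.log (lik lam (q θ) (g θ) (j + k + 2) c x) -
        Real.log (lik lam (q θ) (g θ) (j + k + 1) c x) -
      genSum (genLik lam (q θ) (g θ) k x₀) (j + 1) c| ≤
      2 ^ (j + 1) * (2 ^ k * ((σp - σm) / σm * (1 - σm / σp) ^ k)) := by
  have h₁ := abs_le.1 (hm.abs_genLik_add_sub_le θ j k x x₀ (sub false c))
  have h₂ := abs_le.1 (hm.abs_genLik_add_sub_le θ j k x x₀ (sub true c))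
  rw [hm.log_lik_succ_sub, genSum_succ]
  have e : (2 : ℝ) ^ (j + 1) * (2 ^ k * ((σp - σm) / σm * (1 - σm / σp) ^ k)) =
    2 * (2 ^ (j + k) * ((σp - σm) / σm * (1 - σm / σp) ^ k)) := by ring
  rw [e, abs_le]
  simp only [genSum] at *
  constructor <;> linarith [h₁.1, h₁.2, h₂.1, h₂.2]

/-- A depth `k` is fixed at which forgetting errors are small against the contrast gap `δ`. The law
of large numbers is then applied to one function dominating `genLik` near `θ` and to `genLik` at
`θ'`, which makes all estimates uniform over the neighbourhood. -/
theorem DensityModel.exists_nhds_logLik_lt (hm : DensityModel lam q g σm σp B)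
    (hdom : FullyDominated lam mu Q G q g) {θ θ' : Θ}
    (hXY : IsStationaryHMT P (Q θ') (G θ') ν X Y) {b : 𝒴 → ℝ}
    (hb : MemLp (fun ω => b (Y root ω)) 2 P) (hbm : Measurable b)
    (hle : ∀ θ s c x, |Real.log (condRatio lam (q θ) (g θ) s c x)| ≤ b (c s))
    (hlt : contrast P Y lam (q θ) (g θ) < contrast P Y lam (q θ') (g θ')) (x : 𝒳) :
    ∃ V ∈ 𝓝 θ, ∀ᵐ ω ∂P, ∀ᶠ n in atTop, ∀ θ'' ∈ V,
      logLik lam (q θ'') (g θ'') n x (fun v => Y v ω) <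
        logLik lam (q θ') (g θ') n x (fun v => Y v ω) := by
  have hb2 := hXY.memLp_root hbm hb
  have hb1 : ∀ k, MemLp (fun c : List Bool → 𝒴 => b (c [])) 1
      (treeKernel (Q θ') (G θ') k ∘ₘ ν) := fun k => (hb2 k).mono_exponent one_le_two
  have hbi : Integrable (fun ω => b (Y root ω)) P := hb.integrable one_le_two
  set C := (σp - σm) / σm
  set ρ := 1 - σm / σp
  set δ := contrast P Y lam (q θ') (g θ') - contrast P Y lam (q θ) (g θ) with hδ
  have hδ0 : 0 < δ := sub_pos.2 hlt
  -- This choice gives `C * ρ ^ k ≤ δ / 16`. Four errors of this size (two for the means, two for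
  -- the increments) and the `δ / 8` lost in the local supremum leave `5 * δ / 8`, more than the `δ
  -- / 2` claimed.
  have hlim : Tendsto (fun m => 8 * (C * ρ ^ m)) atTop (𝓝 0) := by
    simpa using ((tendsto_pow_atTop_nhds_zero_of_lt_one (hm.rate_nonneg θ x)
      (hm.rate_lt_one θ x)).const_mul C).const_mul 8
  obtain ⟨k, hk⟩ := (hlim.eventually_le_const (half_pos hδ0)).exists
  set π := treeKernel (Q θ') (G θ') k ∘ₘ ν
  have hSb : MemLp (fun c => sumWord k fun s => b (c s)) 2 π :=
    sumWord_induction (p := fun f => MemLp f 2 π) (fun _ _ h₁ h₂ => h₁.add h₂)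
      fun s hs => memLp_comp_word hXY.invariant hb2 hs.le
  have h2k : (0 : ℝ) < 2 ^ k := by positivity
  obtain ⟨V, W, hV, hWm, hWb, hWV, hWi, hWt⟩ := exists_local_sup (π := π)
    (f := fun θ => genLik lam (q θ) (g θ) k x) (fun θ => hm.measurable_genLik θ k x)
    (hm.continuous_genLik k x) (hSb.integrable one_le_two)
    (fun θ c => abs_sumWord_le fun s _ => hle θ s c x) θ (ε := 2 ^ k * (δ / 8)) (by positivity)
  refine ⟨V, hV, ?_⟩
  have hW2 : MemLp W 2 π := hSb.mono' hWm.aestronglyMeasurable (ae_of_all _ hWb)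
  have lln₁ := hm.tendsto_genSum hdom hXY hWm hW2
    (fun c => hWt _ _ fun θ => genLik_truncate le_rfl x c) (fun _ => false) x
  have lln₂ := hm.tendsto_genSum hdom hXY (hm.measurable_genLik θ' k x)
    (hm.memLp_genLik hXY.invariant hb2 hle θ' x le_rfl)
    (fun c => genLik_truncate le_rfl x c) (fun _ => false) x
  have c₁ := (abs_le.1 (hm.abs_integral_genLik_sub_contrast_le hXY hbi hb1 hle θ k x)).2
  have c₂ := (abs_le.1 (hm.abs_integral_genLik_sub_contrast_le hXY hbi hb1 hle θ' k x)).1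
  set I := ∫ c, genLik lam (q θ) (g θ) k x c ∂π
  set I' := ∫ c, genLik lam (q θ') (g θ') k x c ∂π
  have hgap : 2 ^ k * (δ / 2) + 2 * (2 ^ k * (C * ρ ^ k)) < I' - ∫ c, W c ∂π := by
    have h₁ : I = 2 ^ k * (I / 2 ^ k) := by field_simp
    have h₂ : I' = 2 ^ k * (I' / 2 ^ k) := by field_simp
    have h₃ : 2 ^ k * (δ / 2 + 2 * (C * ρ ^ k)) < 2 ^ k * (I' / 2 ^ k - I / 2 ^ k - δ / 8) := by
      refine mul_lt_mul_of_pos_left ?_ h2k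
      linarith
    linarith
  filter_upwards [lln₁, lln₂] with ω h₁ h₂
  set c := config (fun _ => false) (fun v => Y v ω) root
  set D : Θ → ℕ → ℝ := fun θ'' n => Real.log (lik lam (q θ') (g θ') (n + 1) c x) -
    Real.log (lik lam (q θ'') (g θ'') (n + 1) c x) with hD
  have hlogLik : ∀ θ n, logLik lam (q θ) (g θ) n x (fun v => Y v ω) =
      Real.log (lik lam (q θ) (g θ) (n + 1) c x) := fun θ n => by
    rw [logLik, condDensity_T hm θ (fun _ => false)]
  obtain ⟨N, hN⟩ := eventually_atTop.1 ((h₂.sub h₁).eventually_const_lt hgap)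
  -- `N` depends on `ω` but not on `θ''`. The gap is of order `2 ^ (j + 1)`; only a fixed positive
  -- amount of it is kept, which suffices for divergence.
  have hstep : ∀ θ'' ∈ V, ∀ n ≥ N + k, D θ'' n + 2 ^ k * (δ / 2) ≤ D θ'' (n + 1) := by
    intro θ'' hθ'' n hn
    obtain ⟨j, rfl⟩ := Nat.exists_eq_add_of_le' (le_of_add_le_right hn)
    have a₁ := (abs_le.1 (hm.abs_log_lik_sub_genSum_le θ' j k x x c)).1
    have a₂ := (abs_le.1 (hm.abs_log_lik_sub_genSum_le θ'' j k x x c)).2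
    have a₃ : genSum (genLik lam (q θ'') (g θ'') k x) (j + 1) c ≤ genSum W (j + 1) c :=
      sumWord_le fun s _ => hWV _ θ'' hθ''
    have a₄ := (hN (j + 1) (by omega)).le
    have h2j : (1 : ℝ) ≤ 2 ^ (j + 1) := one_le_pow₀ one_le_two
    rw [← sub_div, le_div_iff₀ (by positivity)] at a₄
    have a₅ : 2 ^ k * (δ / 2) ≤ 2 ^ k * (δ / 2) * 2 ^ (j + 1) :=
      le_mul_of_one_le_right (by positivity) h2j
    simp only [hD]
    rw [show j + k + 1 + 1 = j + k + 2 from rfl]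
    nlinarith
  -- The starting value may be negative, but a bound on the likelihood uniform in the parameter
  -- keeps it above a constant independent of `θ''`.
  obtain ⟨M, hM⟩ := (hm.tame_lik (N + k + 1)).bdd
  have hstart : ∀ θ'', Real.log (lik lam (q θ') (g θ') (N + k + 1) c x) - Real.log M ≤
      D θ'' (N + k) := fun θ'' =>
    sub_le_sub_left (Real.log_le_log ((hm.tame_lik _).pos θ'' c x) (hM θ'' c x)) _
  obtain ⟨n₀, hn₀⟩ := exists_nat_gt
    (-(Real.log (lik lam (q θ') (g θ') (N + k + 1) c x) - Real.log M) / (2 ^ k * (δ / 2)))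
  have hpos : 0 < 2 ^ k * (δ / 2) := by positivity
  filter_upwards [eventually_ge_atTop (N + k + n₀)] with n hn θ'' hθ''
  rw [hlogLik, hlogLik]
  obtain ⟨m, rfl⟩ := Nat.exists_eq_add_of_le ((Nat.le_add_right _ _).trans hn)
  have hmn : (n₀ : ℝ) ≤ m := by exact_mod_cast (by omega : n₀ ≤ m)
  have hgrow := add_mul_le_of_add_le_succ (hstep θ'' hθ'') m
  rw [div_lt_iff₀ hpos] at hn₀
  have := mul_le_mul_of_nonneg_right hmn hpos.le
  have := hstart θ''
  have hDpos : 0 < D θ'' (N + k + m) := by linarith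
  exact sub_pos.1 hDpos

/-- Uniform comparison of the likelihoods outside any neighbourhood of the true parameter. -/
theorem tendsto_argmax [CompactSpace Θ] {L : ℕ → Θ → Ω → ℝ} {θ₀ : Θ}
    (h : ∀ θ ≠ θ₀, ∃ V ∈ 𝓝 θ, ∀ᵐ ω ∂P, ∀ᶠ n in atTop, ∀ θ' ∈ V, L n θ' ω < L n θ₀ ω)
    {θhat : ℕ → Ω → Θ} (hmax : ∀ n, ∀ᵐ ω ∂P, ∀ θ, L n θ ω ≤ L n (θhat n ω) ω) :
    ∀ᵐ ω ∂P, Tendsto (fun n => θhat n ω) atTop (𝓝 θ₀) := by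
  -- Only countably many balls are used, so the exceptional null sets can be united.
  have key : ∀ i : ℕ, ∀ᵐ ω ∂P, ∀ᶠ n in atTop, ∀ θ ∈ (Metric.ball θ₀ (1 / ((i : ℝ) + 1)))ᶜ,
      L n θ ω < L n θ₀ ω := by
    intro i
    refine (Metric.isOpen_ball.isClosed_compl.isCompact).induction_on
      (p := fun S => ∀ᵐ ω ∂P, ∀ᶠ n in atTop, ∀ θ ∈ S, L n θ ω < L n θ₀ ω) (by simp)
      (fun S T hST hT => ?_) (fun S T hS hT => ?_) fun θ hθ => ?_
    · filter_upwards [hT] with ω hω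
      filter_upwards [hω] with n hn θ hθ using hn θ (hST hθ)
    · filter_upwards [hS, hT] with ω h₁ h₂
      filter_upwards [h₁, h₂] with n k₁ k₂ θ hθ using hθ.elim (k₁ θ) (k₂ θ)
    · obtain ⟨V, hV, hω⟩ := h θ fun e => hθ (e ▸ Metric.mem_ball_self Nat.one_div_pos_of_nat)
      exact ⟨V, mem_nhdsWithin_of_mem_nhds hV, hω⟩
  filter_upwards [ae_all_iff.2 key, ae_all_iff.2 hmax] with ω h₁ h₂
  refine Metric.tendsto_nhds.2 fun ε hε => ?_
  obtain ⟨i, hi⟩ := exists_nat_one_div_lt hε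
  filter_upwards [h₁ i] with n hn
  by_contra hfar
  refine (hn (θhat n ω) fun hmem => hfar ?_).not_ge (h₂ n θ₀)
  exact (Metric.mem_ball.1 hmem).trans hi

end Consistency

end HMT

end

/-! ### The consistency theorem -/

theorem mainTheorem1
    {Ω : Type*} [MeasurableSpace Ω] (P : Measure Ω) [IsProbabilityMeasure P]
    {𝒳 : Type*} [MetricSpace 𝒳] [MeasurableSpace 𝒳] [BorelSpace 𝒳]
    {𝒴 : Type*} [MetricSpace 𝒴] [MeasurableSpace 𝒴] [BorelSpace 𝒴]
    {d : ℕ} (Θ : Set (EuclideanSpace ℝ (Fin d))) (θstar : Θ)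
    (Q : Θ → Kernel 𝒳 𝒳) [∀ θ, IsMarkovKernel (Q θ)]
    (G : Θ → Kernel 𝒳 𝒴) [∀ θ, IsMarkovKernel (G θ)]
    (lam : Measure 𝒳) [IsProbabilityMeasure lam]
    (mu : Measure 𝒴) [SigmaFinite mu]
    (q : Θ → 𝒳 → 𝒳 → ℝ) (g : Θ → 𝒳 → 𝒴 → ℝ)
    (ν : Measure 𝒳) [IsProbabilityMeasure ν]
    (X : HMT.ExtTree → Ω → 𝒳) (Y : HMT.ExtTree → Ω → 𝒴)
    -- the process is a stationary hidden Markov tree under the true parameter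
    (hXY : HMT.IsStationaryHMT P (Q θstar) (G θstar) ν X Y)
    (hdom : HMT.FullyDominated lam mu Q G q g)
    (hreg : HMT.Regular lam q g)
    -- `L¹` and `L²` regularity
    (hgbdd : ∃ b : ℝ, ∀ θ x y, g θ x y ≤ b)
    (hL1 : Integrable (fun ω => Real.log (HMT.bMinus lam g (Y HMT.ExtTree.root ω))) P)
    (hL2 : Integrable (fun ω => Real.log (HMT.bMinus lam g (Y HMT.ExtTree.root ω)) ^ 2) P)
    -- continuity in the parameter
    (hqcont : ∀ x x', Continuous fun θ => q θ x x')
    (hgcont : ∀ x y, Continuous fun θ => g θ x y)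
    (hΘ : IsCompact Θ)
    -- the contrast function has a unique maximum
    (hmax : ∃! θ : Θ, ∀ θ' : Θ,
      HMT.contrast P Y lam (q θ') (g θ') ≤ HMT.contrast P Y lam (q θ) (g θ)) :
    -- the maximum is located at the true parameter
    (∀ θ : Θ, HMT.contrast P Y lam (q θ) (g θ) ≤
      HMT.contrast P Y lam (q θstar) (g θstar)) ∧
    -- every maximum likelihood estimator is strongly consistent
    ∀ (x : 𝒳) (θhat : ℕ → Ω → Θ),
      (∀ n, ∀ᵐ ω ∂P, ∀ θ : Θ,
        HMT.logLik lam (q θ) (g θ) n x (fun v => Y v ω) ≤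
          HMT.logLik lam (q (θhat n ω)) (g (θhat n ω)) n x (fun v => Y v ω)) →
      ∀ᵐ ω ∂P, Tendsto (fun n => θhat n ω) atTop (𝓝 θstar) := by
  have : CompactSpace Θ := isCompact_iff_compactSpace.1 hΘ
  obtain ⟨σm, σp, hσm, hq⟩ := hreg.q_bounds
  obtain ⟨B, hB⟩ := hgbdd
  have hm : HMT.DensityModel lam q g σm σp B :=
    hdom.densityModel hσm hq hreg.g_pos hB hqcont hgcont
  set b : 𝒴 → ℝ := fun y =>
    |Real.log (HMT.bMinus lam g y)| + (|Real.log σm| + |Real.log (σp * B)|)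
  have hbm : Measurable b := (Real.measurable_log.comp hm.measurable_bMinus).abs.add_const _
  have hle := hm.abs_log_condRatio_le hreg.bMinus_pos
  have hb : MemLp (fun ω => b (Y HMT.ExtTree.root ω)) 2 P :=
    ((memLp_two_iff_integrable_sq hL1.aestronglyMeasurable).2 hL2).abs.add (memLp_const _)
  obtain ⟨x₀⟩ : Nonempty 𝒳 := ν.nonempty_of_neZero
  have hmaxstar : ∀ θ : Θ, HMT.contrast P Y lam (q θ) (g θ) ≤
      HMT.contrast P Y lam (q θstar) (g θstar) := fun θ =>
    hm.contrast_le hdom θ θstar hXY (hb.integrable one_le_two)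
      (fun k => (hXY.memLp_root hbm hb k).mono_exponent one_le_two) hle x₀
  refine ⟨hmaxstar, fun x θhat hθhat => ?_⟩
  refine HMT.tendsto_argmax (L := fun n θ ω => HMT.logLik lam (q θ) (g θ) n x fun v => Y v ω)
    (fun θ hθ => ?_) hθhat
  -- Uniqueness of the maximizer turns the weak inequality between contrasts into a strict one away
  -- from `θstar`.
  refine hm.exists_nhds_logLik_lt hdom hXY hb hbm hle ((hmaxstar θ).lt_of_ne fun e => hθ ?_) x
  exact hmax.unique (fun θ' => e ▸ hmaxstar θ') hmaxstar
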